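/- Let $K$ be a field and $(P,\preceq)$ a finite poset. Let $KP=\{M\in \mathrm{Mat}_{P\times P}(K) : M_{ji}\neq 0 \Rightarrow i\preceq j\}$ be its incidence algebra. **The bocs of $P$.** Let $Q$ be the quiver with vertices $P\cup\{0\}$, an arrow $\alpha_i:i\to 0$ of degree $0$ for each $i\in P$ and an arrow $v_{ij}:j\to i$ of degree $1$ for each $i\prec j$; let $T=KQ$ be its graded path algebra (arrows composed from right to left, trivial paths $e_x$), and let $\delta$ be the differential (degree one, Leibniz rule $\delta(ab)=\delta(a)b+(-1)^{|a|}a\delta(b)$, zero on the $e_x$) with $$\delta(\alpha_j)=-\sum_{i\prec j}\alpha_i v_{ij},\qquad \delta(v_{ij})=\sum_{i\prec k\prec j}v_{ik}v_{kj}.$$ Put $A=T_0$, $V=T_1$ (so $T_2=V\otimes_A V$), and let $U=\omega A\oplus V$ be the $A$-$A$-bimodule with $a(\omega b+v)=\omega ab+\delta(a)b+av$ and $(\omega b+v)a=\omega ba+va$. With the counit $\epsilon(\omega b+v)=b$ and the comultiplication $\mu(\omega b+v)=\omega\otimes\omega b+\delta(v)+\omega\otimes v+v\otimes\omega\in U\otimes_A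 U$, the pair $(A,U)$ is the bocs associated to $P$. **Its right and left algebras.** Writing $\mu(u)=\sum_i u_i^1\otimes u_i^2$, let $\mathcal R=\mathrm{Hom}_A({}_AU,{}_AA)$ with product $(fg)(u)=\sum_i g(u_i^1f(u_i^2))$ and $\mathcal L=\mathrm{Hom}_A(U_A,A_A)$ with product $(\psi\varphi)(u)=\sum_i\psi(\varphi(u_i^1)u_i^2)$; both have identity $\epsilon$. There are algebra morphisms $A\to\mathcal R$, $z\mapsto[u\mapsto\epsilon(u)z]$, and $A\to\mathcal L$, $z\mapsto[u\mapsto z\epsilon(u)]$; write $e_0$ also for the images of $e_0$. A left $\mathcal R$-module is *induced* if it is isomorphic to $\mathcal R\otimes_A N$ for some left $A$-module $N$. A left $\mathcal L$-module is *co-induced* if it is isomorphic to $\mathrm{Hom}_A(\mathcal L,N)$ for some left $A$-module $N$, where $(sg)(x)=g(xs)$. **Theorem.** There are isomorphisms of $K$-algebras $(1-e_0)\mathcal R(1-e_0)\cong KP\cong(1-e_0)\mathcal L(1-e_0)$, and for any choice of them, regarding the idempotent restriction $(1-e_0)M$ of a module $M$ as a left $KP$-module through the chosen isomorphism: (a)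 a left $\mathcal R$-module $M$ is induced if and only if $(1-e_0)M$ is a projective $KP$-module; (b) a left $\mathcal L$-module $M$ is co-induced if and only if $(1-e_0)M$ is an injective $KP$-module. Both equivalences hold for arbitrary modules $M$ and $N$; moreover, for $M$ of finite dimension over $K$ they hold with $N$ required to be finite dimensional. -/

import Mathlib

open scoped TensorProduct
open MulOpposite (op)

universe u v w

set_option linter.unusedSectionVars false

namespace PosetBocs

/-! ## Tensor products over a noncommutative ring -/

section BalancedTensor

variable (A : Type*) [Ring A]

/-- The tensor product `M ⊗_A N` of a right `A`-module `M` and a left `A`-module `N`: the quotient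
of the tensor product of abelian groups by the relations `(m a) ⊗ n = m ⊗ (a n)`. Right
`A`-modules are modules over the opposite ring. -/
def BalTensor (M N : Type*) [AddCommGroup M] [Module Aᵐᵒᵖ M] [AddCommGroup N] [Module A N] :
    Type _ :=
  (M ⊗[ℤ] N) ⧸ AddSubgroup.closure
    {t : M ⊗[ℤ] N | ∃ (m : M) (a : A) (n : N), t = (op a • m) ⊗ₜ[ℤ] n - m ⊗ₜ[ℤ] (a • n)}

namespace BalTensor

noncomputable instance (M N : Type*) [AddCommGroup M] [Module Aᵐᵒᵖ M] [AddCommGroup N]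
    [Module A N] : AddCommGroup (BalTensor A M N) :=
  inferInstanceAs (AddCommGroup ((M ⊗[ℤ] N) ⧸ AddSubgroup.closure
    {t : M ⊗[ℤ] N | ∃ (m : M) (a : A) (n : N), t = (op a • m) ⊗ₜ[ℤ] n - m ⊗ₜ[ℤ] (a • n)}))

variable {M N G : Type*} [AddCommGroup M] [Module Aᵐᵒᵖ M] [AddCommGroup N] [Module A N]
  [AddCommGroup G]

/-- The pure tensor `m ⊗ n`. -/
noncomputable def tmul (m : M) (n : N) : BalTensor A M N :=
  QuotientAddGroup.mk (m ⊗ₜ[ℤ] n)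

theorem tmul_add (m : M) (n n' : N) : tmul A m (n + n') = tmul A m n + tmul A m n' := by
  unfold tmul; rw [TensorProduct.tmul_add]; rfl

theorem add_tmul (m m' : M) (n : N) : tmul A (m + m') n = tmul A m n + tmul A m' n := by
  unfold tmul; rw [TensorProduct.add_tmul]; rfl

theorem smul_tmul (a : A) (m : M) (n : N) : tmul A (op a • m) n = tmul A m (a • n) := by
  unfold tmul
  refine QuotientAddGroup.eq_iff_sub_mem.mpr (AddSubgroup.subset_closure ⟨m, a, n, rfl⟩)

/-- The additive map `n ↦ m ⊗ n`. -/
noncomputable def tmulHom (m : M) : N →+ BalTensor A M N :=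
  AddMonoidHom.mk' (tmul A m) (tmul_add A m)

/-- The additive map `m ↦ m ⊗ n`. -/
noncomputable def tmulHom' (n : N) : M →+ BalTensor A M N :=
  AddMonoidHom.mk' (fun m => tmul A m n) (fun m m' => add_tmul A m m' n)

theorem tmul_zero (m : M) : tmul A m (0 : N) = 0 := (tmulHom A m).map_zero
theorem zero_tmul (n : N) : tmul A (0 : M) n = 0 := (tmulHom' A n).map_zero
theorem tmul_neg (m : M) (n : N) : tmul A m (-n) = -tmul A m n := (tmulHom A m).map_neg n
theorem neg_tmul (m : M) (n : N) : tmul A (-m) n = -tmul A m n := (tmulHom' A n).map_neg m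
theorem tmul_sum {ι : Type*} (s : Finset ι) (m : M) (f : ι → N) :
    tmul A m (∑ i ∈ s, f i) = ∑ i ∈ s, tmul A m (f i) := map_sum (tmulHom A m) f s
theorem sum_tmul {ι : Type*} (s : Finset ι) (f : ι → M) (n : N) :
    tmul A (∑ i ∈ s, f i) n = ∑ i ∈ s, tmul A (f i) n := map_sum (tmulHom' A n) f s

variable {A}

@[elab_as_elim]
theorem induction_on {p : BalTensor A M N → Prop} (t : BalTensor A M N)
    (ht : ∀ m n, p (tmul A m n)) (ha : ∀ s t, p s → p t → p (s + t)) : p t := by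
  induction t using QuotientAddGroup.induction_on with
  | H z =>
    induction z using TensorProduct.induction_on with
    | zero =>
      have := ht 0 0
      rwa [tmul_zero] at this
    | tmul x y => exact ht x y
    | add x y hx hy => exact ha _ _ hx hy

/-- The additive map out of `M ⊗_A N` given by a balanced biadditive map. -/
noncomputable def lift (f : M → N → G) (h₁ : ∀ m m' n, f (m + m') n = f m n + f m' n)
    (h₂ : ∀ m n n', f m (n + n') = f m n + f m n')
    (h : ∀ (a : A) m n, f (op a • m) n = f m (a • n)) : BalTensor A M N →+ G :=
  QuotientAddGroup.lift _
    (TensorProduct.liftAddHom (R := ℤ)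
      (AddMonoidHom.mk' (fun m => AddMonoidHom.mk' (f m) (h₂ m))
        (fun m m' => AddMonoidHom.ext (h₁ m m')))
      (fun r m n => by
        rw [map_zsmul, AddMonoidHom.smul_apply, map_zsmul])) (by
    rw [AddSubgroup.closure_le]
    rintro _ ⟨m, a, n, rfl⟩
    have := h a m n
    simp [this])

@[simp]
theorem lift_tmul (f : M → N → G) (h₁ h₂) (h : ∀ (a : A) m n, f (op a • m) n = f m (a • n))
    (m : M) (n : N) : lift f h₁ h₂ h (tmul A m n) = f m n := rfl

theorem hom_ext {f g : BalTensor A M N →+ G} (h : ∀ m n, f (tmul A m n) = g (tmul A m n)) :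
    f = g := by
  ext t
  induction t using induction_on with
  | ht m n => exact h m n
  | ha s t hs ht => rw [map_add, map_add, hs, ht]

/-- The map `f ⊗ g`. -/
noncomputable def map {M' N' : Type*} [AddCommGroup M'] [Module Aᵐᵒᵖ M'] [AddCommGroup N']
    [Module A N'] (f : M →ₗ[Aᵐᵒᵖ] M') (g : N →ₗ[A] N') :
    BalTensor A M N →+ BalTensor A M' N' :=
  lift (fun m n => tmul A (f m) (g n)) (fun m m' n => by rw [map_add, add_tmul])
    (fun m n n' => by rw [map_add, tmul_add]) (fun a m n => by rw [map_smul, map_smul, smul_tmul])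

@[simp]
theorem map_tmul {M' N' : Type*} [AddCommGroup M'] [Module Aᵐᵒᵖ M'] [AddCommGroup N']
    [Module A N'] (f : M →ₗ[Aᵐᵒᵖ] M') (g : N →ₗ[A] N') (m : M) (n : N) :
    map f g (tmul A m n) = tmul A (f m) (g n) := lift_tmul _ _ _ _ _ _

section Left

variable [Module A M] [SMulCommClass A Aᵐᵒᵖ M]

/-- For an `A`-`A`-bimodule `M`, the left action `a (m ⊗ n) = (a m) ⊗ n` on `M ⊗_A N`. -/
noncomputable instance : SMul A (BalTensor A M N) where
  smul a t := lift (fun m n => tmul A (a • m) n) (fun m m' n => by rw [smul_add, add_tmul])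
    (fun m n n' => by rw [tmul_add]) (fun b m n => by rw [smul_comm, smul_tmul]) t

theorem smul_tmul_left (a : A) (m : M) (n : N) : a • tmul A m n = tmul A (a • m) n :=
  lift_tmul _ _ _ _ _ _

noncomputable instance : Module A (BalTensor A M N) where
  one_smul t := by
    induction t using induction_on with
    | ht m n => rw [smul_tmul_left, one_smul]
    | ha s t hs ht => exact (map_add (lift _ _ _ _) s t).trans (congrArg₂ _ hs ht)
  mul_smul a b t := by
    induction t using induction_on with
    | ht m n => simp only [smul_tmul_left, mul_smul]
    | ha s t hs ht =>
      have h : ∀ c : A, c • (s + t) = c • s + c • t := fun c => map_add (lift _ _ _ _) s t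
      have h' : ∀ (c : A) (s t : BalTensor A M N), c • (s + t) = c • s + c • t :=
        fun c s t => map_add (lift _ _ _ _) s t
      rw [h, h, h', hs, ht]
  smul_zero a := map_zero (lift _ _ _ _)
  smul_add a s t := map_add (lift _ _ _ _) s t
  add_smul a b t := by
    induction t using induction_on with
    | ht m n => simp only [smul_tmul_left, add_smul, add_tmul]
    | ha s t hs ht =>
      have h : ∀ c : A, c • (s + t) = c • s + c • t := fun c => map_add (lift _ _ _ _) s t
      rw [h, h, h, hs, ht]
      abel
  zero_smul t := by
    induction t using induction_on with
    | ht m n => rw [smul_tmul_left, zero_smul, zero_tmul]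
    | ha s t hs ht =>
      have h : ∀ c : A, c • (s + t) = c • s + c • t := fun c => map_add (lift _ _ _ _) s t
      rw [h, hs, ht, add_zero]

end Left

section Right

variable [Module Aᵐᵒᵖ N] [SMulCommClass A Aᵐᵒᵖ N]

/-- For an `A`-`A`-bimodule `N`, the right action `(m ⊗ n) a = m ⊗ (n a)` on `M ⊗_A N`. -/
noncomputable instance : SMul Aᵐᵒᵖ (BalTensor A M N) where
  smul a t := lift (fun m n => tmul A m (a • n)) (fun m m' n => by rw [add_tmul])
    (fun m n n' => by rw [smul_add, tmul_add])
    (fun b m n => by rw [smul_tmul, smul_comm]) t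

theorem smul_tmul_right (a : Aᵐᵒᵖ) (m : M) (n : N) : a • tmul A m n = tmul A m (a • n) :=
  lift_tmul _ _ _ _ _ _

noncomputable instance : Module Aᵐᵒᵖ (BalTensor A M N) where
  one_smul t := by
    induction t using induction_on with
    | ht m n => rw [smul_tmul_right, one_smul]
    | ha s t hs ht => exact (map_add (lift _ _ _ _) s t).trans (congrArg₂ _ hs ht)
  mul_smul a b t := by
    induction t using induction_on with
    | ht m n => simp only [smul_tmul_right, mul_smul]
    | ha s t hs ht =>
      have h' : ∀ (c : Aᵐᵒᵖ) (s t : BalTensor A M N), c • (s + t) = c • s + c • t :=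
        fun c s t => map_add (lift _ _ _ _) s t
      rw [h', h', h', hs, ht]
  smul_zero a := map_zero (lift _ _ _ _)
  smul_add a s t := map_add (lift _ _ _ _) s t
  add_smul a b t := by
    induction t using induction_on with
    | ht m n => simp only [smul_tmul_right, add_smul, tmul_add]
    | ha s t hs ht =>
      have h : ∀ c : Aᵐᵒᵖ, c • (s + t) = c • s + c • t := fun c => map_add (lift _ _ _ _) s t
      rw [h, h, h, hs, ht]
      abel
  zero_smul t := by
    induction t using induction_on with
    | ht m n => rw [smul_tmul_right, zero_smul, tmul_zero]
    | ha s t hs ht =>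
      have h : ∀ c : Aᵐᵒᵖ, c • (s + t) = c • s + c • t := fun c => map_add (lift _ _ _ _) s t
      rw [h, hs, ht, add_zero]

end Right

instance [Module A M] [SMulCommClass A Aᵐᵒᵖ M] [Module Aᵐᵒᵖ N] [SMulCommClass A Aᵐᵒᵖ N] :
    SMulCommClass A Aᵐᵒᵖ (BalTensor A M N) where
  smul_comm a b t := by
    induction t using induction_on with
    | ht m n => simp only [smul_tmul_left, smul_tmul_right]
    | ha s t hs ht => simp only [smul_add, hs, ht]

/-- The associativity map `(M ⊗_A N) ⊗_A Q → M ⊗_A (N ⊗_A Q)`. -/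
noncomputable def assoc {Q : Type*} [AddCommGroup Q] [Module A Q] [Module Aᵐᵒᵖ N]
    [SMulCommClass A Aᵐᵒᵖ N] :
    BalTensor A (BalTensor A M N) Q →+ BalTensor A M (BalTensor A N Q) :=
  lift
    (fun t q => lift (A := A) (fun m n => tmul A m (tmul A n q))
      (fun m m' n => by rw [add_tmul])
      (fun m n n' => by rw [add_tmul, tmul_add])
      (fun a m n => by rw [smul_tmul, smul_tmul_left]) t)
    (fun s t q => by rw [map_add])
    (fun t q q' => by
      induction t using induction_on with
      | ht m n => simp only [lift_tmul, tmul_add]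
      | ha s t hs ht => simp only [map_add, hs, ht]; abel)
    (fun a t q => by
      induction t using induction_on with
      | ht m n => simp only [smul_tmul_right, lift_tmul, smul_tmul]
      | ha s t hs ht => simp only [smul_add, map_add, hs, ht])

@[simp]
theorem assoc_tmul {Q : Type*} [AddCommGroup Q] [Module A Q] [Module Aᵐᵒᵖ N]
    [SMulCommClass A Aᵐᵒᵖ N] (m : M) (n : N) (q : Q) :
    assoc (tmul A (tmul A m n) q) = tmul A m (tmul A n q) := by
  simp [assoc]

/-- For a left `A`-linear `f : N → A`, the map `M ⊗_A N → M`, `m ⊗ n ↦ m f(n)`. -/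
noncomputable def contractRight (f : N →ₗ[A] A) : BalTensor A M N →+ M :=
  lift (fun m n => op (f n) • m) (fun m m' n => by rw [smul_add])
    (fun m n n' => by rw [map_add, MulOpposite.op_add, add_smul])
    (fun a m n => by rw [map_smul, smul_eq_mul, MulOpposite.op_mul, mul_smul])

/-- For a right `A`-linear `f : M → A`, the map `M ⊗_A N → N`, `m ⊗ n ↦ f(m) n`. -/
noncomputable def contractLeft (f : M →ₗ[Aᵐᵒᵖ] A) : BalTensor A M N →+ N :=
  lift (fun m n => f m • n) (fun m m' n => by rw [map_add, add_smul])
    (fun m n n' => by rw [smul_add])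
    (fun a m n => by rw [map_smul, op_smul_eq_mul, mul_smul])

@[simp]
theorem contractRight_tmul (f : N →ₗ[A] A) (m : M) (n : N) :
    contractRight f (tmul A m n) = op (f n) • m := lift_tmul _ _ _ _ _ _

@[simp]
theorem contractLeft_tmul (f : M →ₗ[Aᵐᵒᵖ] A) (m : M) (n : N) :
    contractLeft f (tmul A m n) = f m • n := lift_tmul _ _ _ _ _ _

end BalTensor

end BalancedTensor

/-! ## Bocses and their Burt-Butler algebras -/

section Bocs

open BalTensor

/-- A bocs `(A, U)` over `K`: an `A`-`A`-bimodule `U` (on which `K` acts centrally) with a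
comultiplication `U → U ⊗_A U` and a counit `U → A`, both morphisms of bimodules, which are
coassociative and counital. -/
structure Bocs (K A U : Type*) [CommRing K] [Ring A] [Algebra K A] [AddCommGroup U] [Module A U]
    [Module Aᵐᵒᵖ U] [SMulCommClass A Aᵐᵒᵖ U] where
  central : ∀ (k : K) (x : U), algebraMap K A k • x = op (algebraMap K A k) • x
  comul : U →ₗ[A] BalTensor A U U
  comul_op : ∀ (a : A) (x : U), comul (op a • x) = op a • comul x
  counit : U →ₗ[A] A
  counit_op : ∀ (a : A) (x : U), counit (op a • x) = counit x * a
  /-- `(1 ⊗ ε) ∘ μ = 1`, through `U ⊗_A A ≅ U`. -/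
  counit_right : ∀ x : U, contractRight counit (comul x) = x
  /-- `(ε ⊗ 1) ∘ μ = 1`, through `A ⊗_A U ≅ U`. -/
  counit_left : ∀ x : U, contractLeft
    ({ toFun := counit, map_add' := counit.map_add, map_smul' := fun a y => counit_op a.unop y } :
      U →ₗ[Aᵐᵒᵖ] A) (comul x) = x
  coassoc : ∀ x : U,
    assoc (map ({ toFun := comul, map_add' := comul.map_add,
                  map_smul' := fun a y => comul_op a.unop y } : U →ₗ[Aᵐᵒᵖ] BalTensor A U U)
      (LinearMap.id : U →ₗ[A] U) (comul x)) =
    map (LinearMap.id : U →ₗ[Aᵐᵒᵖ] U) comul (comul x)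

variable {K A U : Type*} [CommRing K] [Ring A] [Algebra K A] [AddCommGroup U] [Module A U]
    [Module Aᵐᵒᵖ U] [SMulCommClass A Aᵐᵒᵖ U]

namespace Bocs

variable (B : Bocs K A U)

/-- The comultiplication as a right linear map. -/
noncomputable def comulR : U →ₗ[Aᵐᵒᵖ] BalTensor A U U :=
  { toFun := B.comul, map_add' := B.comul.map_add, map_smul' := fun a y => B.comul_op a.unop y }

/-- The counit as a right linear map. -/
def counitR : U →ₗ[Aᵐᵒᵖ] A :=
  { toFun := B.counit, map_add' := B.counit.map_add, map_smul' := fun a y => B.counit_op a.unop y }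

@[simp] theorem comulR_apply (x : U) : B.comulR x = B.comul x := rfl
@[simp] theorem counitR_apply (x : U) : B.counitR x = B.counit x := rfl

theorem counit_left' (x : U) : contractLeft B.counitR (B.comul x) = x := B.counit_left x
theorem coassoc' (x : U) : assoc (map B.comulR (LinearMap.id : U →ₗ[A] U) (B.comul x)) =
    map (LinearMap.id : U →ₗ[Aᵐᵒᵖ] U) B.comul (B.comul x) := B.coassoc x

/-- The map `u ↦ ∑ uᵢ¹ f(uᵢ²)` where `μ(u) = ∑ uᵢ¹ ⊗ uᵢ²`, for `f : U → A` left linear. -/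
noncomputable def twistRight (f : U →ₗ[A] A) : U →ₗ[A] U where
  toFun x := contractRight f (B.comul x)
  map_add' x y := by rw [map_add, map_add]
  map_smul' a x := by
    rw [map_smul, RingHom.id_apply]
    induction B.comul x using BalTensor.induction_on with
    | ht m n => rw [smul_tmul_left, contractRight_tmul, contractRight_tmul, ← smul_comm]
    | ha s t hs ht => simp only [smul_add, map_add, hs, ht]

/-- The map `u ↦ ∑ φ(uᵢ¹) uᵢ²` where `μ(u) = ∑ uᵢ¹ ⊗ uᵢ²`, for `φ : U → A` right linear. -/
noncomputable def twistLeft (f : U →ₗ[Aᵐᵒᵖ] A) : U →ₗ[Aᵐᵒᵖ] U where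
  toFun x := contractLeft f (B.comul x)
  map_add' x y := by rw [map_add, map_add]
  map_smul' a x := by
    rw [RingHom.id_apply, ← B.comulR_apply, map_smul, comulR_apply]
    induction B.comul x using BalTensor.induction_on with
    | ht m n => rw [smul_tmul_right, contractLeft_tmul, contractLeft_tmul, smul_comm]
    | ha s t hs ht => simp only [smul_add, map_add, hs, ht]

theorem twistRight_apply (f : U →ₗ[A] A) (x : U) :
    B.twistRight f x = contractRight f (B.comul x) := rfl

theorem twistLeft_apply (f : U →ₗ[Aᵐᵒᵖ] A) (x : U) :
    B.twistLeft f x = contractLeft f (B.comul x) := rfl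

theorem twistRight_twistRight (f g : U →ₗ[A] A) (x : U) :
    B.twistRight g (B.twistRight f x) = B.twistRight (g.comp (B.twistRight f)) x := by
  let h : BalTensor A U U →ₗ[A] A :=
    { toFun := fun t => g (contractRight f t)
      map_add' := fun s t => by rw [map_add, map_add]
      map_smul' := fun a t => by
        rw [RingHom.id_apply, ← map_smul]
        congr 1
        induction t using BalTensor.induction_on with
        | ht m n => rw [smul_tmul_left, contractRight_tmul, contractRight_tmul, ← smul_comm]
        | ha s t hs ht => simp only [smul_add, map_add, hs, ht] }
  have key := congrArg (contractRight (M := U) h) (B.coassoc' x)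
  have e₁ : contractRight h (map (LinearMap.id : U →ₗ[Aᵐᵒᵖ] U) B.comul (B.comul x)) =
      B.twistRight (g.comp (B.twistRight f)) x := by
    rw [twistRight_apply]
    induction B.comul x using BalTensor.induction_on with
    | ht m n => rw [map_tmul, contractRight_tmul, contractRight_tmul]; rfl
    | ha s t hs ht => simp only [map_add, hs, ht]
  have e₂ : contractRight h (assoc (map B.comulR (LinearMap.id : U →ₗ[A] U) (B.comul x))) =
      B.twistRight g (B.twistRight f x) := by
    rw [B.twistRight_apply f]
    induction B.comul x using BalTensor.induction_on with
    | ht m n =>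
      rw [map_tmul, contractRight_tmul, comulR_apply, LinearMap.id_apply, twistRight_apply,
        B.comul_op]
      induction B.comul m using BalTensor.induction_on with
      | ht y z =>
        rw [assoc_tmul, contractRight_tmul, smul_tmul_right, contractRight_tmul]
        change op (g (contractRight f (tmul A z n))) • y = _
        rw [contractRight_tmul]
      | ha s t hs ht => simp only [add_tmul, smul_add, map_add, hs, ht]
    | ha s t hs ht => simp only [map_add, hs, ht]
  rw [← e₂, key, e₁]

theorem twistLeft_twistLeft (f g : U →ₗ[Aᵐᵒᵖ] A) (x : U) :
    B.twistLeft g (B.twistLeft f x) = B.twistLeft (g.comp (B.twistLeft f)) x := by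
  have key := congrArg (fun t => contractLeft (N := U) g (contractLeft f t)) (B.coassoc' x)
  have e₁ : contractLeft g (contractLeft f
      (map (LinearMap.id : U →ₗ[Aᵐᵒᵖ] U) B.comul (B.comul x))) =
      B.twistLeft g (B.twistLeft f x) := by
    rw [B.twistLeft_apply f]
    induction B.comul x using BalTensor.induction_on with
    | ht m n =>
      rw [map_tmul, contractLeft_tmul, contractLeft_tmul, ← map_smul, twistLeft_apply]; rfl
    | ha s t hs ht => simp only [map_add, hs, ht]
  have e₂ : contractLeft g (contractLeft f
      (assoc (map B.comulR (LinearMap.id : U →ₗ[A] U) (B.comul x)))) =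
      B.twistLeft (g.comp (B.twistLeft f)) x := by
    rw [twistLeft_apply]
    induction B.comul x using BalTensor.induction_on with
    | ht m n =>
      rw [map_tmul, contractLeft_tmul, comulR_apply, LinearMap.id_apply, LinearMap.comp_apply,
        twistLeft_apply]
      induction B.comul m using BalTensor.induction_on with
      | ht y z =>
        rw [assoc_tmul, contractLeft_tmul, smul_tmul_left, contractLeft_tmul, contractLeft_tmul]
      | ha s t hs ht => simp only [add_tmul, add_smul, map_add, hs, ht]
    | ha s t hs ht => simp only [map_add, hs, ht]
  rw [← e₁, ← e₂, key]

/-- The right Burt-Butler algebra `Hom_A(_A U, _A A)` of a bocs. -/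
def RightAlg (_B : Bocs K A U) : Type _ := U →ₗ[A] A

/-- The left Burt-Butler algebra `Hom_A(U_A, A_A)` of a bocs. -/
def LeftAlg (_B : Bocs K A U) : Type _ := U →ₗ[Aᵐᵒᵖ] A

instance : AddCommGroup B.RightAlg := inferInstanceAs (AddCommGroup (U →ₗ[A] A))
instance : AddCommGroup B.LeftAlg := inferInstanceAs (AddCommGroup (U →ₗ[Aᵐᵒᵖ] A))

/-- The left linear map `U → A` underlying an element of the right algebra. -/
def RightAlg.hom {B : Bocs K A U} (f : B.RightAlg) : U →ₗ[A] A := f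

/-- The right linear map `U → A` underlying an element of the left algebra. -/
def LeftAlg.hom {B : Bocs K A U} (f : B.LeftAlg) : U →ₗ[Aᵐᵒᵖ] A := f

theorem RightAlg.ext {B : Bocs K A U} {f g : B.RightAlg} (h : ∀ x, f.hom x = g.hom x) : f = g :=
  LinearMap.ext h

theorem LeftAlg.ext {B : Bocs K A U} {f g : B.LeftAlg} (h : ∀ x, f.hom x = g.hom x) : f = g :=
  LinearMap.ext h

/-- The product `(fg)(u) = ∑ g(uᵢ¹ f(uᵢ²))`, with the counit as the identity. -/
noncomputable instance : Ring B.RightAlg where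
  __ := (inferInstance : AddCommGroup B.RightAlg)
  mul f g := g.hom.comp (B.twistRight f.hom)
  one := B.counit
  left_distrib f g h := rfl
  right_distrib f g h := RightAlg.ext fun x => by
    change h.hom (contractRight (f.hom + g.hom) (B.comul x)) =
      h.hom (contractRight f.hom (B.comul x)) + h.hom (contractRight g.hom (B.comul x))
    rw [← map_add]
    congr 1
    induction B.comul x using BalTensor.induction_on with
    | ht m n => simp [add_smul]
    | ha s t hs ht => rw [map_add, hs, ht, map_add, map_add]; abel
  zero_mul f := RightAlg.ext fun x => by
    change f.hom (contractRight (0 : U →ₗ[A] A) (B.comul x)) = 0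
    rw [← f.hom.map_zero]
    congr 1
    induction B.comul x using BalTensor.induction_on with
    | ht m n => simp
    | ha s t hs ht => rw [map_add, hs, ht, add_zero]
  mul_zero f := rfl
  mul_assoc f g h := RightAlg.ext fun x =>
    congrArg h.hom (B.twistRight_twistRight f.hom g.hom x).symm
  one_mul f := RightAlg.ext fun x => congrArg f.hom (B.counit_right x)
  mul_one f := RightAlg.ext fun x => by
    change B.counit (contractRight f.hom (B.comul x)) = f.hom x
    have : ∀ t : BalTensor A U U,
        B.counit (contractRight f.hom t) = f.hom (contractLeft B.counitR t) := fun t => by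
      induction t using BalTensor.induction_on with
      | ht m n => simp [B.counit_op]
      | ha s t hs ht => simp only [map_add, hs, ht]
    rw [this, B.counit_left']

/-- The product `(ψφ)(u) = ∑ ψ(φ(uᵢ¹) uᵢ²)`, with the counit as the identity. -/
noncomputable instance : Ring B.LeftAlg where
  __ := (inferInstance : AddCommGroup B.LeftAlg)
  mul f g := f.hom.comp (B.twistLeft g.hom)
  one := B.counitR
  right_distrib f g h := rfl
  left_distrib h f g := LeftAlg.ext fun x => by
    change h.hom (contractLeft (f.hom + g.hom) (B.comul x)) =
      h.hom (contractLeft f.hom (B.comul x)) + h.hom (contractLeft g.hom (B.comul x))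
    rw [← map_add]
    congr 1
    induction B.comul x using BalTensor.induction_on with
    | ht m n => simp [add_smul]
    | ha s t hs ht => rw [map_add, hs, ht, map_add, map_add]; abel
  mul_zero f := LeftAlg.ext fun x => by
    change f.hom (contractLeft (0 : U →ₗ[Aᵐᵒᵖ] A) (B.comul x)) = 0
    rw [← f.hom.map_zero]
    congr 1
    induction B.comul x using BalTensor.induction_on with
    | ht m n => simp
    | ha s t hs ht => rw [map_add, hs, ht, add_zero]
  zero_mul f := rfl
  mul_assoc f g h := LeftAlg.ext fun x =>
    congrArg f.hom (B.twistLeft_twistLeft h.hom g.hom x)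
  mul_one f := LeftAlg.ext fun x => congrArg f.hom (B.counit_left x)
  one_mul f := LeftAlg.ext fun x => by
    change B.counit (contractLeft f.hom (B.comul x)) = f.hom x
    have : ∀ t : BalTensor A U U,
        B.counit (contractLeft f.hom t) = f.hom (contractRight B.counit t) := fun t => by
      induction t using BalTensor.induction_on with
      | ht m n => simp
      | ha s t hs ht => simp only [map_add, hs, ht]
    rw [this, B.counit_right]

theorem RightAlg.mul_hom {B : Bocs K A U} (f g : B.RightAlg) (x : U) :
    (f * g).hom x = g.hom (contractRight f.hom (B.comul x)) := rfl

theorem LeftAlg.mul_hom {B : Bocs K A U} (f g : B.LeftAlg) (x : U) :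
    (f * g).hom x = f.hom (contractLeft g.hom (B.comul x)) := rfl

theorem contractRight_mul (f : U →ₗ[A] A) (z : A) (x : U)
    (hf : ∀ y, f y = B.counit y * z) : contractRight f (B.comul x) = op z • x := by
  conv_rhs => rw [← B.counit_right x]
  induction B.comul x using BalTensor.induction_on with
  | ht m n => rw [contractRight_tmul, contractRight_tmul, hf, MulOpposite.op_mul, mul_smul]
  | ha s t hs ht => rw [map_add, map_add, hs, ht, smul_add]

theorem contractLeft_mul (f : U →ₗ[Aᵐᵒᵖ] A) (z : A) (x : U)
    (hf : ∀ y, f y = z * B.counit y) : contractLeft f (B.comul x) = z • x := by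
  conv_rhs => rw [← B.counit_left' x]
  induction B.comul x using BalTensor.induction_on with
  | ht m n => rw [contractLeft_tmul, contractLeft_tmul, hf, mul_smul, counitR_apply]
  | ha s t hs ht => rw [map_add, map_add, hs, ht, smul_add]

/-- The left linear map `u ↦ ε(u) z`. -/
def counitMul (z : A) : U →ₗ[A] A where
  toFun x := B.counit x * z
  map_add' x y := by rw [map_add, add_mul]
  map_smul' a x := by rw [map_smul, RingHom.id_apply, smul_eq_mul, smul_eq_mul, mul_assoc]

/-- The right linear map `u ↦ z ε(u)`. -/
def mulCounit (z : A) : U →ₗ[Aᵐᵒᵖ] A where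
  toFun x := z * B.counit x
  map_add' x y := by rw [map_add, mul_add]
  map_smul' a x := by
    rw [RingHom.id_apply, ← B.counitR_apply, map_smul, counitR_apply]
    exact (mul_assoc _ _ _).symm

/-- The ring morphism `A → R`, `z ↦ [u ↦ ε(u) z]`, to the right algebra. -/
noncomputable def toRight : A →+* B.RightAlg where
  toFun z := B.counitMul z
  map_one' := RightAlg.ext fun x => mul_one _
  map_zero' := RightAlg.ext fun x => mul_zero _
  map_add' y z := RightAlg.ext fun x => mul_add _ _ _
  map_mul' y z := RightAlg.ext fun x => by
    change B.counit x * (y * z) = B.counit (contractRight (B.counitMul y) (B.comul x)) * z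
    rw [B.contractRight_mul _ y x (fun _ => rfl), B.counit_op, mul_assoc]

/-- The ring morphism `A → L`, `z ↦ [u ↦ z ε(u)]`, to the left algebra. -/
noncomputable def toLeft : A →+* B.LeftAlg where
  toFun z := B.mulCounit z
  map_one' := LeftAlg.ext fun x => one_mul _
  map_zero' := LeftAlg.ext fun x => zero_mul _
  map_add' y z := LeftAlg.ext fun x => add_mul _ _ _
  map_mul' y z := LeftAlg.ext fun x => by
    change y * z * B.counit x = y * B.counit (contractLeft (B.mulCounit z) (B.comul x))
    rw [B.contractLeft_mul _ z x (fun _ => rfl), map_smul, smul_eq_mul, mul_assoc]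

theorem toRight_hom (z : A) (x : U) : (B.toRight z).hom x = B.counit x * z := rfl
theorem toLeft_hom (z : A) (x : U) : (B.toLeft z).hom x = z * B.counit x := rfl

noncomputable instance : Algebra K B.RightAlg :=
  (B.toRight.comp (algebraMap K A)).toAlgebra' fun k f => RightAlg.ext fun x => by
    rw [RightAlg.mul_hom, RightAlg.mul_hom, RingHom.comp_apply,
      B.contractRight_mul _ (algebraMap K A k) x (fun _ => rfl), ← B.central, map_smul, toRight_hom]
    have : ∀ t : BalTensor A U U,
        B.counit (contractRight f.hom t) = f.hom (contractLeft B.counitR t) := fun t => by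
      induction t using BalTensor.induction_on with
      | ht m n => simp [B.counit_op]
      | ha s t hs ht => simp only [map_add, hs, ht]
    rw [this, B.counit_left', smul_eq_mul, Algebra.commutes]

noncomputable instance : Algebra K B.LeftAlg :=
  (B.toLeft.comp (algebraMap K A)).toAlgebra' fun k f => LeftAlg.ext fun x => by
    rw [LeftAlg.mul_hom, LeftAlg.mul_hom, RingHom.comp_apply,
      B.contractLeft_mul (B.toLeft (algebraMap K A k)).hom (algebraMap K A k) x (fun _ => rfl),
      B.central, map_smul, toLeft_hom]
    have : ∀ t : BalTensor A U U,
        B.counit (contractLeft f.hom t) = f.hom (contractRight B.counit t) := fun t => by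
      induction t using BalTensor.induction_on with
      | ht m n => simp
      | ha s t hs ht => simp only [map_add, hs, ht]
    rw [this, B.counit_right, op_smul_eq_mul, Algebra.commutes]

end Bocs

end Bocs

/-! ## The bocs of a finite poset -/

section Poset

open BalTensor

variable (K : Type u) [Field K] (P : Type v) [PartialOrder P]

/-- The degree zero part `A = T₀` of the path algebra of the quiver with vertices `P ∪ {0}`, arrows
`α_i : i → 0` of degree zero (`i ∈ P`) and arrows `v_ij : j → i` of degree one (`i < j` in `P`).
Its `K`-basis consists of the paths of degree zero, which are the trivial paths `e_x` for
`x ∈ P ∪ {0}` and the arrows `α_i`; here `Option P` is `P ∪ {0}` with `none` in the role of `0`.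
The pair `(c, x)` stands for `∑ c_x e_x + ∑ x_i α_i`. -/
def BaseAlg : Type _ := (Option P → K) × (P → K)

namespace BaseAlg

instance : AddCommGroup (BaseAlg K P) := inferInstanceAs (AddCommGroup ((Option P → K) × (P → K)))
instance : Module K (BaseAlg K P) := inferInstanceAs (Module K ((Option P → K) × (P → K)))

variable {K P}

/-- The coefficient of `e_x`. -/
def e (a : BaseAlg K P) (x : Option P) : K := a.1 x

/-- The coefficient of `α_i`. -/
def α (a : BaseAlg K P) (i : P) : K := a.2 i

/-- The element with given coefficients. -/
def mk (c : Option P → K) (x : P → K) : BaseAlg K P := (c, x)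

@[simp] theorem mk_e (c : Option P → K) (x : P → K) (y) : (mk c x).e y = c y := rfl
@[simp] theorem mk_α (c : Option P → K) (x : P → K) (y) : (mk c x).α y = x y := rfl

@[ext]
theorem ext {a b : BaseAlg K P} (h : ∀ x, a.e x = b.e x) (h' : ∀ i, a.α i = b.α i) : a = b :=
  Prod.ext (funext h) (funext h')

@[simp] theorem add_e (a b : BaseAlg K P) (x) : (a + b).e x = a.e x + b.e x := rfl
@[simp] theorem add_α (a b : BaseAlg K P) (x) : (a + b).α x = a.α x + b.α x := rfl
@[simp] theorem zero_e (x) : (0 : BaseAlg K P).e x = 0 := rfl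
@[simp] theorem zero_α (x) : (0 : BaseAlg K P).α x = 0 := rfl
@[simp] theorem sub_e (a b : BaseAlg K P) (x) : (a - b).e x = a.e x - b.e x := rfl
@[simp] theorem sub_α (a b : BaseAlg K P) (x) : (a - b).α x = a.α x - b.α x := rfl
@[simp] theorem neg_e (a : BaseAlg K P) (x) : (-a).e x = -a.e x := rfl
@[simp] theorem neg_α (a : BaseAlg K P) (x) : (-a).α x = -a.α x := rfl
@[simp] theorem smul_e (k : K) (a : BaseAlg K P) (x) : (k • a).e x = k * a.e x := rfl
@[simp] theorem smul_α (k : K) (a : BaseAlg K P) (x) : (k • a).α x = k * a.α x := rfl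

/-- Multiplication of paths: arrows are composed from right to left, so `α_i = e_0 α_i e_i`. -/
instance : Mul (BaseAlg K P) :=
  ⟨fun a b => mk (fun x => a.e x * b.e x) (fun i => a.e none * b.α i + a.α i * b.e (some i))⟩

/-- The identity is the sum of the trivial paths. -/
instance : One (BaseAlg K P) := ⟨mk (fun _ => 1) (fun _ => 0)⟩

@[simp] theorem mul_e (a b : BaseAlg K P) (x) : (a * b).e x = a.e x * b.e x := rfl
@[simp] theorem mul_α (a b : BaseAlg K P) (i) :
    (a * b).α i = a.e none * b.α i + a.α i * b.e (some i) := rfl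
@[simp] theorem one_e (x) : (1 : BaseAlg K P).e x = 1 := rfl
@[simp] theorem one_α (x) : (1 : BaseAlg K P).α x = 0 := rfl

instance : Ring (BaseAlg K P) where
  __ := (inferInstance : AddCommGroup (BaseAlg K P))
  left_distrib a b c := by ext <;> simp <;> ring
  right_distrib a b c := by ext <;> simp <;> ring
  zero_mul a := by ext <;> simp
  mul_zero a := by ext <;> simp
  mul_assoc a b c := by ext <;> simp <;> ring
  one_mul a := by ext <;> simp
  mul_one a := by ext <;> simp

instance : Algebra K (BaseAlg K P) :=
  Algebra.ofModule (fun k a b => by ext <;> simp <;> ring) (fun k a b => by ext <;> simp <;> ring)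

@[simp] theorem algebraMap_e (k : K) (x) : (algebraMap K (BaseAlg K P) k).e x = k := by
  rw [Algebra.algebraMap_eq_smul_one]; simp
@[simp] theorem algebraMap_α (k : K) (x) : (algebraMap K (BaseAlg K P) k).α x = 0 := by
  rw [Algebra.algebraMap_eq_smul_one]; simp

open Classical in
/-- The trivial path `e_0` at the vertex `0`. -/
noncomputable def e₀ : BaseAlg K P := mk (fun x => if x = none then 1 else 0) (fun _ => 0)

theorem one_sub_e₀_idem : IsIdempotentElem (1 - e₀ : BaseAlg K P) := by
  apply IsIdempotentElem.one_sub
  ext x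
  · by_cases h : x = none <;> simp [e₀, h]
  · simp [e₀]

end BaseAlg

/-- The pairs `(i, j)` with `i < j` in `P`. -/
abbrev Rel : Type _ := {p : P × P // p.1 < p.2}

/-- The degree one part `V = T₁` of the path algebra. Its basis consists of the paths of degree one,
which are `v_ij` and `α_i v_ij` for `i < j`. The pair `(c, d)` stands for
`∑ c_ij v_ij + ∑ d_ij α_i v_ij`. -/
def VMod : Type _ := (Rel P → K) × (Rel P → K)

namespace VMod

instance : AddCommGroup (VMod K P) := inferInstanceAs (AddCommGroup ((Rel P → K) × (Rel P → K)))

variable {K P}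

/-- The coefficient of `v_ij`. -/
def c (w : VMod K P) (r : Rel P) : K := w.1 r

/-- The coefficient of `α_i v_ij`. -/
def d (w : VMod K P) (r : Rel P) : K := w.2 r

/-- The element with given coefficients. -/
def mk (c d : Rel P → K) : VMod K P := (c, d)

@[simp] theorem mk_c (c d : Rel P → K) (r) : (mk c d).c r = c r := rfl
@[simp] theorem mk_d (c d : Rel P → K) (r) : (mk c d).d r = d r := rfl

@[ext]
theorem ext {a b : VMod K P} (h : ∀ x, a.c x = b.c x) (h' : ∀ i, a.d i = b.d i) : a = b :=
  Prod.ext (funext h) (funext h')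

@[simp] theorem add_c (a b : VMod K P) (x) : (a + b).c x = a.c x + b.c x := rfl
@[simp] theorem add_d (a b : VMod K P) (x) : (a + b).d x = a.d x + b.d x := rfl
@[simp] theorem neg_c (a : VMod K P) (x) : (-a).c x = -a.c x := rfl
@[simp] theorem neg_d (a : VMod K P) (x) : (-a).d x = -a.d x := rfl
@[simp] theorem zero_c (x) : (0 : VMod K P).c x = 0 := rfl
@[simp] theorem zero_d (x) : (0 : VMod K P).d x = 0 := rfl

/-- Left multiplication by paths of degree zero: `e_i v_ij = v_ij` and `v_ij ↦ α_i v_ij`. -/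
instance : SMul (BaseAlg K P) (VMod K P) :=
  ⟨fun a w => mk (fun r => a.e (some r.1.1) * w.c r)
    (fun r => a.e none * w.d r + a.α r.1.1 * w.c r)⟩

/-- Right multiplication by paths of degree zero: `v_ij e_j = v_ij`, while `v_ij α_k = 0`. -/
instance : SMul (BaseAlg K P)ᵐᵒᵖ (VMod K P) :=
  ⟨fun a w => mk (fun r => w.c r * a.unop.e (some r.1.2))
    (fun r => w.d r * a.unop.e (some r.1.2))⟩

@[simp] theorem smul_c (a : BaseAlg K P) (w : VMod K P) (r) :
    (a • w).c r = a.e (some r.1.1) * w.c r := rfl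
@[simp] theorem smul_d (a : BaseAlg K P) (w : VMod K P) (r) :
    (a • w).d r = a.e none * w.d r + a.α r.1.1 * w.c r := rfl
@[simp] theorem op_smul_c (a : (BaseAlg K P)ᵐᵒᵖ) (w : VMod K P) (r) :
    (a • w).c r = w.c r * a.unop.e (some r.1.2) := rfl
@[simp] theorem op_smul_d (a : (BaseAlg K P)ᵐᵒᵖ) (w : VMod K P) (r) :
    (a • w).d r = w.d r * a.unop.e (some r.1.2) := rfl

instance : Module (BaseAlg K P) (VMod K P) where
  one_smul w := by ext <;> simp
  mul_smul a b w := by ext <;> simp <;> ring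
  smul_zero a := by ext <;> simp
  smul_add a v w := by ext <;> simp <;> ring
  add_smul a b w := by ext <;> simp <;> ring
  zero_smul w := by ext <;> simp

instance : Module (BaseAlg K P)ᵐᵒᵖ (VMod K P) where
  one_smul w := by ext <;> simp
  mul_smul a b w := by ext <;> simp <;> ring
  smul_zero a := by ext <;> simp
  smul_add a v w := by ext <;> simp <;> ring
  add_smul a b w := by ext <;> simp <;> ring
  zero_smul w := by ext <;> simp

instance : SMulCommClass (BaseAlg K P) (BaseAlg K P)ᵐᵒᵖ (VMod K P) where
  smul_comm a b w := by ext <;> simp <;> ring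

open Classical in
/-- The arrow `v_ij`, which is taken to be zero unless `i < j`. -/
noncomputable def v (i j : P) : VMod K P :=
  mk (fun r => if r.1 = (i, j) then 1 else 0) (fun _ => 0)

end VMod

variable {K P}

/-- The differential in degree zero: `δ(e_x) = 0` and `δ(α_j) = -∑_{i < j} α_i v_ij`. -/
def d₀ : BaseAlg K P →+ VMod K P :=
  AddMonoidHom.mk' (fun a => VMod.mk (fun _ => 0) (fun r => -a.α r.1.2)) (fun a b => by
    ext r
    · exact (add_zero (0 : K)).symm
    · exact neg_add _ _)

@[simp] theorem d₀_c (a : BaseAlg K P) (r) : (d₀ a).c r = 0 := rfl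
@[simp] theorem d₀_d (a : BaseAlg K P) (r) : (d₀ a).d r = -a.α r.1.2 := rfl

open Classical in
/-- The element `c_ij e_i + d_ij α_i` of `A e_i`, where `c_ij` and `d_ij` are the coefficients of
`v_ij` and `α_i v_ij` in `w`, so that `w = ∑_{i < j} (coeff w i j) v_ij`; it is zero unless
`i < j`. -/
noncomputable def coeff (i j : P) : VMod K P →+ BaseAlg K P :=
  AddMonoidHom.mk' (fun w => BaseAlg.mk
    (fun x => if h : i < j then if x = some i then w.c ⟨(i, j), h⟩ else 0 else 0)
    (fun k => if h : i < j then if k = i then w.d ⟨(i, j), h⟩ else 0 else 0)) (fun a b => by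
      ext x
      · by_cases h : i < j <;> by_cases h' : x = some i <;> simp [h, h']
      · by_cases h : i < j <;> by_cases h' : x = i <;> simp [h, h'])

open Classical in
@[simp] theorem coeff_e (i j : P) (w : VMod K P) (x) : (coeff i j w).e x =
    if h : i < j then if x = some i then w.c ⟨(i, j), h⟩ else 0 else 0 := rfl
open Classical in
@[simp] theorem coeff_α (i j : P) (w : VMod K P) (k) : (coeff i j w).α k =
    if h : i < j then if k = i then w.d ⟨(i, j), h⟩ else 0 else 0 := rfl

/-- `δ(v_ij) = ∑_{i < k < j} v_ik v_kj` in `T₂ = V ⊗_A V`. -/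
noncomputable def dv [Fintype P] (i j : P) : BalTensor (BaseAlg K P) (VMod K P) (VMod K P) :=
  ∑ k : P, tmul _ (VMod.v i k) (VMod.v k j)

/-- The differential in degree one, with values in `T₂ = V ⊗_A V`, determined by its values on the
arrows `v_ij` and by the Leibniz rule `δ(b v_ij) = δ(b) v_ij + b δ(v_ij)` for `b ∈ A e_i`. -/
noncomputable def d₁ [Fintype P] : VMod K P →+ BalTensor (BaseAlg K P) (VMod K P) (VMod K P) :=
  AddMonoidHom.mk' (fun w => ∑ i : P, ∑ j : P,
      (tmul _ (d₀ (coeff i j w)) (VMod.v i j) + coeff i j w • dv i j)) (fun a b => by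
    simp only [map_add, add_tmul, add_smul, ← Finset.sum_add_distrib]
    exact Finset.sum_congr rfl fun i _ => Finset.sum_congr rfl fun j _ => by abel)

variable (K P)

/-- The bimodule `U = ω A ⊕ V`; the pair `(b, v)` stands for `ω b + v`. -/
def UMod : Type _ := BaseAlg K P × VMod K P

namespace UMod

instance : AddCommGroup (UMod K P) := inferInstanceAs (AddCommGroup (BaseAlg K P × VMod K P))

variable {K P}

/-- The element `b` of `ω b + v`. -/
def fst (x : UMod K P) : BaseAlg K P := x.1

/-- The element `v` of `ω b + v`. -/
def snd (x : UMod K P) : VMod K P := x.2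

/-- The element `ω b + v`. -/
def mk (b : BaseAlg K P) (v : VMod K P) : UMod K P := (b, v)

@[simp] theorem mk_fst (b : BaseAlg K P) (v : VMod K P) : (mk b v).fst = b := rfl
@[simp] theorem mk_snd (b : BaseAlg K P) (v : VMod K P) : (mk b v).snd = v := rfl

@[ext]
theorem ext {x y : UMod K P} (h : x.fst = y.fst) (h' : x.snd = y.snd) : x = y := Prod.ext h h'

/-- `a (ω b + v) = ω a b + δ(a) b + a v`. -/
instance : SMul (BaseAlg K P) (UMod K P) := ⟨fun a x => mk (a * x.fst) (op x.fst • d₀ a + a • x.snd)⟩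

/-- `(ω b + v) a = ω b a + v a`. -/
instance : SMul (BaseAlg K P)ᵐᵒᵖ (UMod K P) := ⟨fun a x => mk (x.fst * a.unop) (a • x.snd)⟩

@[simp] theorem add_fst (x y : UMod K P) : (x + y).fst = x.fst + y.fst := rfl
@[simp] theorem add_snd (x y : UMod K P) : (x + y).snd = x.snd + y.snd := rfl
@[simp] theorem zero_fst : (0 : UMod K P).fst = 0 := rfl
@[simp] theorem zero_snd : (0 : UMod K P).snd = 0 := rfl
@[simp] theorem smul_fst (a : BaseAlg K P) (x : UMod K P) : (a • x).fst = a * x.fst := rfl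
@[simp] theorem smul_snd (a : BaseAlg K P) (x : UMod K P) :
    (a • x).snd = op x.fst • d₀ a + a • x.snd := rfl
@[simp] theorem op_smul_fst (a : (BaseAlg K P)ᵐᵒᵖ) (x : UMod K P) :
    (a • x).fst = x.fst * a.unop := rfl
@[simp] theorem op_smul_snd (a : (BaseAlg K P)ᵐᵒᵖ) (x : UMod K P) : (a • x).snd = a • x.snd := rfl

/-- The Leibniz rule in degree zero. -/
theorem d₀_mul (a b : BaseAlg K P) : d₀ (a * b) = op b • d₀ a + a • d₀ b := by
  ext
  · simp
  · simp

theorem d₀_one : d₀ (1 : BaseAlg K P) = 0 := by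
  ext <;> simp

instance : Module (BaseAlg K P) (UMod K P) where
  one_smul x := by ext1 <;> simp [d₀_one]
  mul_smul a b x := by
    ext1
    · simp [mul_assoc]
    · simp [d₀_mul, mul_smul, add_assoc, smul_comm]
  smul_zero a := by ext1 <;> simp
  smul_add a x y := by
    ext1
    · simp [mul_add]
    · simp only [smul_snd, add_fst, add_snd, MulOpposite.op_add, add_smul, smul_add]; abel
  add_smul a b x := by
    ext1
    · simp [add_mul]
    · simp only [smul_snd, add_snd, map_add, add_smul, smul_add]; abel
  zero_smul x := by ext1 <;> simp

instance : Module (BaseAlg K P)ᵐᵒᵖ (UMod K P) where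
  one_smul x := by ext1 <;> simp
  mul_smul a b x := by ext1 <;> simp [mul_assoc, mul_smul]
  smul_zero a := by ext1 <;> simp
  smul_add a x y := by ext1 <;> simp [add_mul]
  add_smul a b x := by ext1 <;> simp [mul_add, add_smul]
  zero_smul x := by ext1 <;> simp

instance : SMulCommClass (BaseAlg K P) (BaseAlg K P)ᵐᵒᵖ (UMod K P) where
  smul_comm a b x := by
    ext1
    · simp [mul_assoc]
    · simp [smul_add, mul_smul, smul_comm]

/-- The element `ω`. -/
def ω : UMod K P := mk 1 0

/-- The inclusion `V → U`, as a left linear map. -/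
def inl : VMod K P →ₗ[BaseAlg K P] UMod K P where
  toFun v := mk 0 v
  map_add' v w := by ext1 <;> simp
  map_smul' a v := by ext1 <;> simp

/-- The inclusion `V → U`, as a right linear map. -/
def inr : VMod K P →ₗ[(BaseAlg K P)ᵐᵒᵖ] UMod K P where
  toFun v := mk 0 v
  map_add' v w := by ext1 <;> simp
  map_smul' a v := by ext1 <;> simp

@[simp] theorem inl_fst (w : VMod K P) : (inl w).fst = 0 := rfl
@[simp] theorem inl_snd (w : VMod K P) : (inl w).snd = w := rfl
@[simp] theorem inr_eq (w : VMod K P) : inr w = inl w := rfl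
@[simp] theorem ω_fst : (ω : UMod K P).fst = 1 := rfl
@[simp] theorem ω_snd : (ω : UMod K P).snd = 0 := rfl

/-- `μ(ω b + v) = ω ⊗ ω b + δ(v) + ω ⊗ v + v ⊗ ω`. -/
noncomputable def comul [Fintype P] : UMod K P →+ BalTensor (BaseAlg K P) (UMod K P) (UMod K P) :=
  AddMonoidHom.mk' (fun x => tmul _ ω (op x.fst • ω) + map inr inl (d₁ x.snd) +
      tmul _ ω (inl x.snd) + tmul _ (inl x.snd) ω) (fun x y => by
    simp only [add_fst, add_snd, MulOpposite.op_add, add_smul, map_add, add_tmul, tmul_add]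
    abel)

end UMod

/-! The following facts verify the laws of a bocs. -/

open UMod

variable {K P}

theorem VMod.central (k : K) (w : VMod K P) :
    algebraMap K (BaseAlg K P) k • w = op (algebraMap K (BaseAlg K P) k) • w := by
  ext <;> simp [mul_comm]

theorem d₀_algebraMap (k : K) : d₀ (algebraMap K (BaseAlg K P) k) = 0 := by
  ext <;> simp

theorem UMod.central (k : K) (x : UMod K P) :
    algebraMap K (BaseAlg K P) k • x = op (algebraMap K (BaseAlg K P) k) • x := by
  ext1
  · simp [Algebra.commutes]
  · simp [d₀_algebraMap, VMod.central]

theorem coeff_smul (i j : P) (a : BaseAlg K P) (w : VMod K P) :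
    coeff i j (a • w) = a * coeff i j w := by
  ext x
  · by_cases h : i < j <;> by_cases h' : x = some i <;> simp [h, h']
  · by_cases h : i < j <;> by_cases h' : x = i <;> simp [h, h']

theorem coeff_op_smul (i j : P) (a : BaseAlg K P) (w : VMod K P) :
    coeff i j (op a • w) = algebraMap K _ (a.e (some j)) * coeff i j w := by
  ext x
  · by_cases h : i < j <;> by_cases h' : x = some i <;> simp [h, h', mul_comm]
  · by_cases h : i < j <;> by_cases h' : x = i <;> simp [h, h', mul_comm]

theorem op_smul_v (i j : P) (a : BaseAlg K P) :
    op a • (VMod.v i j : VMod K P) = algebraMap K (BaseAlg K P) (a.e (some j)) • VMod.v i j := by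
  ext r
  · by_cases h : r.1 = (i, j) <;> simp [VMod.v, h]
  · simp [VMod.v]

theorem v_eq_zero {i j : P} (h : ¬ i < j) : (VMod.v i j : VMod K P) = 0 := by
  ext r
  · have : r.1 ≠ (i, j) := fun h' => h (by have := r.2; rw [h'] at this; exact this)
    simp [VMod.v, this]
  · simp [VMod.v]

theorem tmul_d₀ (w : VMod K P) (a : BaseAlg K P) : tmul (BaseAlg K P) w (d₀ a) = 0 := by
  have h : w = op (1 - BaseAlg.e₀ : BaseAlg K P) • w := by
    ext r <;> simp [BaseAlg.e₀]
  have h' : (1 - BaseAlg.e₀ : BaseAlg K P) • d₀ a = 0 := by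
    ext r <;> simp [BaseAlg.e₀]
  rw [h, smul_tmul, h', tmul_zero]

section Laws

variable [Fintype P]

theorem VMod.sum_c {ι : Type*} (s : Finset ι) (f : ι → VMod K P) (r) :
    (∑ i ∈ s, f i).c r = ∑ i ∈ s, (f i).c r :=
  map_sum (AddMonoidHom.mk' (fun w : VMod K P => w.c r) (fun _ _ => rfl)) f s

theorem VMod.sum_d {ι : Type*} (s : Finset ι) (f : ι → VMod K P) (r) :
    (∑ i ∈ s, f i).d r = ∑ i ∈ s, (f i).d r :=
  map_sum (AddMonoidHom.mk' (fun w : VMod K P => w.d r) (fun _ _ => rfl)) f s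

theorem sum_coeff (w : VMod K P) : ∑ i : P, ∑ j : P, coeff i j w • VMod.v i j = w := by
  classical
  ext r
  · simp only [VMod.sum_c]
    obtain ⟨⟨i, j⟩, h⟩ := r
    rw [Finset.sum_eq_single i, Finset.sum_eq_single j]
    · have h : i < j := h
      simp [VMod.v, h]
    · intro b _ hb
      simp [VMod.v, hb.symm]
    · simp
    · intro b _ hb
      refine Finset.sum_eq_zero fun c _ => ?_
      simp [VMod.v, hb.symm]
    · simp
  · simp only [VMod.sum_d]
    obtain ⟨⟨i, j⟩, h⟩ := r
    rw [Finset.sum_eq_single i, Finset.sum_eq_single j]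
    · have h : i < j := h
      simp [VMod.v, h]
    · intro b _ hb
      simp [VMod.v, hb.symm]
    · simp
    · intro b _ hb
      refine Finset.sum_eq_zero fun c _ => ?_
      simp [VMod.v, hb.symm]
    · simp

theorem d₁_apply (w : VMod K P) : d₁ w = ∑ i : P, ∑ j : P,
      (tmul _ (d₀ (coeff i j w)) (VMod.v i j) + coeff i j w • dv i j) := rfl

/-- The Leibniz rule `δ(a w) = δ(a) w + a δ(w)`. -/
theorem d₁_smul (a : BaseAlg K P) (w : VMod K P) :
    d₁ (a • w) = tmul _ (d₀ a) w + a • d₁ w := by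
  have h : tmul (BaseAlg K P) (d₀ a) w =
      ∑ i : P, ∑ j : P, tmul (BaseAlg K P) (d₀ a) (coeff i j w • VMod.v i j) := by
    simp only [← tmul_sum, sum_coeff]
  rw [h]
  simp only [d₁_apply, Finset.smul_sum, ← Finset.sum_add_distrib]
  refine Finset.sum_congr rfl fun i _ => Finset.sum_congr rfl fun j _ => ?_
  rw [coeff_smul, d₀_mul, add_tmul, smul_tmul, mul_smul, smul_add, smul_tmul_left, add_assoc]

theorem op_smul_dv (i j : P) (a : BaseAlg K P) :
    op a • (dv i j : BalTensor (BaseAlg K P) (VMod K P) (VMod K P)) =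
      algebraMap K (BaseAlg K P) (a.e (some j)) • dv i j := by
  simp only [dv, Finset.smul_sum, smul_tmul_right, smul_tmul_left]
  refine Finset.sum_congr rfl fun k _ => ?_
  rw [op_smul_v, ← smul_tmul, VMod.central]

/-- The Leibniz rule `δ(w a) = δ(w) a - w δ(a)`, where the last term is zero. -/
theorem d₁_op_smul (a : BaseAlg K P) (w : VMod K P) : d₁ (op a • w) = op a • d₁ w := by
  simp only [d₁_apply, Finset.smul_sum]
  refine Finset.sum_congr rfl fun i _ => Finset.sum_congr rfl fun j _ => ?_
  rw [coeff_op_smul, d₀_mul, d₀_algebraMap, smul_zero, zero_add, smul_add,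
    smul_tmul_right, op_smul_v, ← smul_tmul, VMod.central]
  congr 1
  rw [← smul_comm, op_smul_dv, ← mul_smul, Algebra.commutes]

theorem d₁_d₀ (a : BaseAlg K P) : d₁ (d₀ a) = 0 := by
  classical
  let q : P → P → K → VMod K P := fun i k x =>
    BaseAlg.mk (fun _ => 0) (fun l => if l = i then x else 0) • VMod.v i k
  have q0 : ∀ i k, q i k 0 = 0 := fun i k => by
    ext r <;> simp [q]
  have qn : ∀ i k, ¬ i < k → ∀ x, q i k x = 0 := fun i k h x => by
    simp only [q, v_eq_zero h, smul_zero]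
  have qneg : ∀ i k x, q i k (-x) = - q i k x := fun i k x => by
    ext r
    · simp [q]
    · simp only [q, VMod.smul_d, BaseAlg.mk_e, BaseAlg.mk_α, VMod.neg_d]
      split_ifs <;> simp
  have h1 : ∀ i j, d₀ (coeff i j (d₀ a)) = ∑ h : P, q h i (if i < j then a.α j else 0) := by
    intro i j
    ext r
    · simp [q, VMod.sum_c]
    · obtain ⟨⟨k, l⟩, hr⟩ := r
      rw [VMod.sum_d, Finset.sum_eq_single k]
      · by_cases h : i < j <;> by_cases h' : l = i <;> simp [q, VMod.v, h, h']
      · intro b _ hb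
        simp [q, VMod.v, hb.symm]
      · simp
  have h2 : ∀ i j k, coeff i j (d₀ a) • (VMod.v i k : VMod K P) =
      q i k (-(if i < j then a.α j else 0)) := by
    intro i j k
    ext r
    · by_cases h : i < j <;> simp [q, h]
    · by_cases h : i < j <;> simp [q, h]
  simp only [d₁_apply, Finset.sum_add_distrib, dv, Finset.smul_sum, smul_tmul_left, h1, h2,
    sum_tmul]
  have swap : ∀ G : P → P → P → BalTensor (BaseAlg K P) (VMod K P) (VMod K P),
      ∑ i, ∑ j, ∑ k, G i j k = ∑ k, ∑ j, ∑ i, G i j k := fun G => by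
    rw [Finset.sum_comm, Finset.sum_congr rfl fun j _ => Finset.sum_comm, Finset.sum_comm]
  rw [swap fun i j k => tmul (BaseAlg K P) (q i k (-(if i < j then a.α j else 0))) (VMod.v k j)]
  simp only [← Finset.sum_add_distrib]
  refine Finset.sum_eq_zero fun i _ => Finset.sum_eq_zero fun j _ =>
    Finset.sum_eq_zero fun h _ => ?_
  by_cases h1 : i < j
  · by_cases h2 : h < i
    · rw [if_pos h1, if_pos (h2.trans h1), qneg, neg_tmul, add_neg_cancel]
    · rw [qn _ _ h2, qn _ _ h2, zero_tmul, add_zero]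
  · rw [v_eq_zero h1, tmul_zero, tmul_zero, add_zero]

theorem comul_apply (x : UMod K P) : UMod.comul x = tmul (BaseAlg K P) ω (op x.fst • ω) +
    map inr inl (d₁ x.snd) + tmul _ ω (inl x.snd) + tmul _ (inl x.snd) ω := rfl

theorem map_inr_inl_smul (a : BaseAlg K P) (t : BalTensor (BaseAlg K P) (VMod K P) (VMod K P)) :
    map (inr (K := K) (P := P)) inl (a • t) = a • map inr inl t := by
  induction t using BalTensor.induction_on with
  | ht m n => simp only [smul_tmul_left, map_tmul, inr_eq, map_smul]
  | ha s t hs ht => simp only [smul_add, map_add, hs, ht]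

theorem map_inr_inl_op_smul (a : BaseAlg K P)
    (t : BalTensor (BaseAlg K P) (VMod K P) (VMod K P)) :
    map (inr (K := K) (P := P)) inl (op a • t) = op a • map inr inl t := by
  induction t using BalTensor.induction_on with
  | ht m n =>
    simp only [smul_tmul_right, map_tmul]
    rw [← inr_eq n, ← inr_eq (op a • n), map_smul]
  | ha s t hs ht => simp only [smul_add, map_add, hs, ht]

theorem smul_ω (a : BaseAlg K P) : a • (ω : UMod K P) = op a • ω + inl (d₀ a) := by
  ext1 <;> simp

theorem inl_op_smul (a : BaseAlg K P) (w : VMod K P) : inl (op a • w) = op a • inl w :=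
  map_smul inr (op a) w

theorem tmul_inl_d₀ (w : VMod K P) (a : BaseAlg K P) :
    tmul (BaseAlg K P) (inl w) (inl (d₀ a)) = 0 := by
  rw [← inr_eq, ← map_tmul, tmul_d₀, map_zero]

theorem comul_smul (a : BaseAlg K P) (x : UMod K P) :
    UMod.comul (a • x) = a • UMod.comul x := by
  have e₁ : tmul (BaseAlg K P) (a • ω) (op x.fst • (ω : UMod K P)) =
      tmul (BaseAlg K P) ω (op (a * x.fst) • ω) + tmul _ ω (inl (op x.fst • d₀ a)) +
        tmul _ (inl (op x.fst • d₀ a)) ω := by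
    rw [smul_ω, add_tmul, smul_tmul, smul_comm, smul_ω, smul_add, tmul_add, ← mul_smul,
      ← MulOpposite.op_mul, inl_op_smul, smul_tmul, smul_ω, tmul_add, tmul_inl_d₀,
      add_zero]
  have e₂ : tmul (BaseAlg K P) (a • ω) (inl x.snd) =
      tmul _ ω (inl (a • x.snd)) + tmul _ (inl (d₀ a)) (inl x.snd) := by
    rw [smul_ω, add_tmul, smul_tmul, map_smul]
  rw [comul_apply, comul_apply]
  simp only [smul_add, smul_tmul_left, e₁, e₂, smul_fst, smul_snd, map_add, d₁_op_smul, d₁_d₀,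
    smul_zero, zero_add, d₁_smul, map_inr_inl_smul, map_tmul, inr_eq, tmul_add,
    add_tmul, map_smul]
  abel

theorem comul_op_smul (a : BaseAlg K P) (x : UMod K P) :
    UMod.comul (op a • x) = op a • UMod.comul x := by
  have e₁ : tmul (BaseAlg K P) (inl x.snd) (op a • (ω : UMod K P)) = tmul _ (op a • inl x.snd) ω := by
    rw [smul_tmul, smul_ω, tmul_add, tmul_inl_d₀, add_zero]
  rw [comul_apply, comul_apply]
  simp only [smul_add, smul_tmul_right, op_smul_fst, op_smul_snd, MulOpposite.unop_op,
    d₁_op_smul, map_inr_inl_op_smul, inl_op_smul, e₁, MulOpposite.op_mul, mul_smul]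

theorem dv_eq_zero {i j : P} (h : ¬ i < j) :
    (dv i j : BalTensor (BaseAlg K P) (VMod K P) (VMod K P)) = 0 := by
  refine Finset.sum_eq_zero fun k _ => ?_
  by_cases h1 : i < k
  · rw [v_eq_zero (fun h2 => h (h1.trans h2)), tmul_zero]
  · rw [v_eq_zero h1, zero_tmul]

theorem d₁_v (i j : P) : d₁ (VMod.v i j : VMod K P) = dv i j := by
  classical
  by_cases h : i < j
  · let E : BaseAlg K P := BaseAlg.mk (fun x => if x = some i then 1 else 0) (fun _ => 0)
    have hc : ∀ k l, ¬ (k = i ∧ l = j) → coeff k l (VMod.v i j : VMod K P) = 0 := by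
      intro k l hkl
      have : ((k, l) : P × P) ≠ (i, j) := fun h => hkl (by simpa using h)
      ext x <;> simp [hkl, VMod.v]
    have hc' : coeff i j (VMod.v i j : VMod K P) = E := by
      ext x <;> simp [h, VMod.v, E]
    have hE : ∀ k, E • (VMod.v i k : VMod K P) = VMod.v i k := by
      intro k
      ext r
      · by_cases hr : r.1 = (i, k) <;> simp [VMod.v, E, hr]
      · simp [VMod.v, E]
    have hE' : d₀ E = 0 := by ext <;> simp [E]
    rw [d₁_apply, Finset.sum_eq_single i, Finset.sum_eq_single j]
    · rw [hc', hE', zero_tmul, zero_add]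
      simp only [dv, Finset.smul_sum, smul_tmul_left, hE]
    · intro l _ hl
      rw [hc i l (fun h => hl h.2), map_zero, zero_tmul, zero_smul, add_zero]
    · simp
    · intro k _ hk
      refine Finset.sum_eq_zero fun l _ => ?_
      rw [hc k l (fun h => hk h.1), map_zero, zero_tmul, zero_smul, add_zero]
    · simp
  · rw [v_eq_zero h, map_zero, dv_eq_zero h]

end Laws

/-- The counit `ε(ω b + v) = b`. -/
def UMod.counit : UMod K P →ₗ[BaseAlg K P] BaseAlg K P where
  toFun x := x.fst
  map_add' _ _ := rfl
  map_smul' _ _ := rfl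

theorem UMod.counit_apply (x : UMod K P) : UMod.counit x = x.fst := rfl

variable [Fintype P]

/-- The comultiplication as a left linear map. -/
noncomputable def UMod.comulL :
    UMod K P →ₗ[BaseAlg K P] BalTensor (BaseAlg K P) (UMod K P) (UMod K P) where
  toFun := UMod.comul
  map_add' := map_add _
  map_smul' := comul_smul

/-- The comultiplication as a right linear map. -/
noncomputable def UMod.comulR :
    UMod K P →ₗ[(BaseAlg K P)ᵐᵒᵖ] BalTensor (BaseAlg K P) (UMod K P) (UMod K P) where
  toFun := UMod.comul
  map_add' := map_add _
  map_smul' a x := comul_op_smul a.unop x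

theorem comul_ω : UMod.comul (ω : UMod K P) = tmul (BaseAlg K P) ω ω := by
  rw [comul_apply]
  simp [tmul_zero, zero_tmul]

theorem comul_inl_v (i j : P) : UMod.comul (inl (VMod.v i j : VMod K P)) =
    ∑ k : P, tmul (BaseAlg K P) (inl (VMod.v i k)) (inl (VMod.v k j)) +
      tmul _ ω (inl (VMod.v i j)) + tmul _ (inl (VMod.v i j)) ω := by
  rw [comul_apply]
  simp [d₁_v, dv, tmul_zero]

theorem comul_coassoc (x : UMod K P) :
    assoc (map comulR (LinearMap.id : UMod K P →ₗ[BaseAlg K P] UMod K P) (comul x)) =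
      map (LinearMap.id : UMod K P →ₗ[(BaseAlg K P)ᵐᵒᵖ] UMod K P) comulL (comul x) := by
  have hL : ∀ x : UMod K P, comulL x = comul x := fun _ => rfl
  have hR : ∀ x : UMod K P, comulR x = comul x := fun _ => rfl
  let p : BalTensor (BaseAlg K P) (UMod K P) (UMod K P) → Prop := fun t =>
    assoc (map comulR (LinearMap.id : UMod K P →ₗ[BaseAlg K P] UMod K P) t) =
      map (LinearMap.id : UMod K P →ₗ[(BaseAlg K P)ᵐᵒᵖ] UMod K P) comulL t
  have padd : ∀ s t, p s → p t → p (s + t) := fun s t hs ht => by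
    simp only [p, map_add] at *
    rw [hs, ht]
  have psmul : ∀ (a : BaseAlg K P) t, p t → p (a • t) := fun a t h => by
    have h₁ : ∀ t, assoc (map comulR (LinearMap.id : UMod K P →ₗ[BaseAlg K P] UMod K P) (a • t)) =
        a • assoc (map comulR (LinearMap.id : UMod K P →ₗ[BaseAlg K P] UMod K P) t) := fun t => by
      induction t using BalTensor.induction_on with
      | ht m n =>
        rw [smul_tmul_left, map_tmul, map_tmul, hR, hR, comul_smul]
        induction comul m using BalTensor.induction_on with
        | ht y z => simp only [smul_tmul_left, assoc_tmul]
        | ha s t hs ht => simp only [smul_add, add_tmul, map_add, hs, ht]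
      | ha s t hs ht => simp only [smul_add, map_add, hs, ht]
    have h₂ : ∀ t, map (LinearMap.id : UMod K P →ₗ[(BaseAlg K P)ᵐᵒᵖ] UMod K P) comulL (a • t) =
        a • map (LinearMap.id : UMod K P →ₗ[(BaseAlg K P)ᵐᵒᵖ] UMod K P) comulL t := fun t => by
      induction t using BalTensor.induction_on with
      | ht m n => simp only [smul_tmul_left, map_tmul, LinearMap.id_apply]
      | ha s t hs ht => simp only [smul_add, map_add, hs, ht]
    simp only [p] at *
    rw [h₁, h₂, h]
  have pop : ∀ (a : BaseAlg K P) t, p t → p (op a • t) := fun a t h => by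
    have h₁ : ∀ t, assoc (map comulR (LinearMap.id : UMod K P →ₗ[BaseAlg K P] UMod K P)
          (op a • t)) =
        op a • assoc (map comulR (LinearMap.id : UMod K P →ₗ[BaseAlg K P] UMod K P) t) := fun t => by
      induction t using BalTensor.induction_on with
      | ht m n =>
        rw [smul_tmul_right, map_tmul, map_tmul]
        induction (comulR m : BalTensor (BaseAlg K P) (UMod K P) (UMod K P))
          using BalTensor.induction_on with
        | ht y z => simp only [smul_tmul_right, assoc_tmul, LinearMap.id_apply]
        | ha s t hs ht => simp only [smul_add, add_tmul, map_add, hs, ht]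
      | ha s t hs ht => simp only [smul_add, map_add, hs, ht]
    have h₂ : ∀ t, map (LinearMap.id : UMod K P →ₗ[(BaseAlg K P)ᵐᵒᵖ] UMod K P) comulL (op a • t) =
        op a • map (LinearMap.id : UMod K P →ₗ[(BaseAlg K P)ᵐᵒᵖ] UMod K P) comulL t := fun t => by
      induction t using BalTensor.induction_on with
      | ht m n =>
        rw [smul_tmul_right, map_tmul, map_tmul, smul_tmul_right, hL, hL, comul_op_smul]
      | ha s t hs ht => simp only [smul_add, map_add, hs, ht]
    simp only [p] at *
    rw [h₁, h₂, h]
  have pω : p (comul ω) := by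
    simp only [p, comul_ω, map_tmul, hR, hL, LinearMap.id_apply, assoc_tmul]
  have pv : ∀ i j : P, p (comul (inl (VMod.v i j))) := fun i j => by
    simp only [p, comul_inl_v, map_add, map_sum, map_tmul, hR, hL, LinearMap.id_apply, comul_ω,
      add_tmul, tmul_add, sum_tmul, tmul_sum, assoc_tmul, Finset.sum_add_distrib]
    rw [Finset.sum_comm]
    abel
  have hx : x = op x.fst • ω + inl x.snd := by ext1 <;> simp
  have hv : ∀ w : VMod K P, p (comul (inl w)) := fun w => by
    have p0 : p 0 := by simp only [p, map_zero]
    have psum : ∀ (f : P → BalTensor (BaseAlg K P) (UMod K P) (UMod K P)), (∀ i, p (f i)) →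
        p (∑ i, f i) := fun f hf => Finset.sum_induction f p padd p0 fun i _ => hf i
    rw [← sum_coeff w]
    simp only [map_sum, map_smul, comul_smul]
    exact psum _ fun i => psum _ fun j => psmul _ _ (pv i j)
  rw [hx]
  change p _
  rw [map_add, comul_op_smul]
  exact padd _ _ (pop _ _ pω) (hv _)

variable (K P)

/-- The bocs of the finite poset `P`: the bocs of the ditalgebra given by the path algebra above
with the differential `δ(α_j) = -∑_{i < j} α_i v_ij`, `δ(v_ij) = ∑_{i < k < j} v_ik v_kj`. -/
noncomputable def posetBocs : Bocs K (BaseAlg K P) (UMod K P) where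
  central := UMod.central
  comul := UMod.comulL
  comul_op := comul_op_smul
  counit := UMod.counit
  counit_op _ _ := rfl
  counit_right x := by
    change contractRight UMod.counit (comul x) = x
    have h : ∀ t : BalTensor (BaseAlg K P) (VMod K P) (VMod K P),
        contractRight UMod.counit (map inr inl t) = (0 : UMod K P) := fun t => by
      induction t using BalTensor.induction_on with
      | ht m n => simp [counit_apply]
      | ha s t hs ht => rw [map_add, map_add, hs, ht, add_zero]
    rw [comul_apply, map_add, map_add, map_add, h]
    ext1 <;> simp [counit_apply]
  counit_left x := by
    have h : ∀ (f : UMod K P →ₗ[(BaseAlg K P)ᵐᵒᵖ] BaseAlg K P) (_ : ∀ y, f y = y.fst),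
        contractLeft f (comul x) = x := fun f hf => by
      have h' : ∀ t : BalTensor (BaseAlg K P) (VMod K P) (VMod K P),
          contractLeft f (map inr inl t) = (0 : UMod K P) := fun t => by
        induction t using BalTensor.induction_on with
        | ht m n => simp [hf]
        | ha s t hs ht => rw [map_add, map_add, hs, ht, add_zero]
      rw [comul_apply, map_add, map_add, map_add, h']
      ext1 <;> simp [hf]
    exact h _ fun _ => rfl
  coassoc := comul_coassoc

/-- The incidence algebra of `P`: the matrices `M` such that `M j i ≠ 0` implies `i ≤ j`. -/
def incidence [DecidableEq P] : Subalgebra K (Matrix P P K) where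
  carrier := {M | ∀ j i, M j i ≠ 0 → i ≤ j}
  mul_mem' {M N} hM hN j i h := by
    rw [Matrix.mul_apply] at h
    obtain ⟨k, -, hk⟩ := Finset.exists_ne_zero_of_sum_ne_zero h
    exact (hN k i (right_ne_zero_of_mul hk)).trans (hM j k (left_ne_zero_of_mul hk))
  add_mem' {M N} hM hN j i h := by
    by_contra hij
    refine h ?_
    rw [Matrix.add_apply, not_not.mp (fun h => hij (hM j i h)),
      not_not.mp (fun h => hij (hN j i h)), add_zero]
  algebraMap_mem' k j i h := by
    by_contra hij
    refine h ?_
    rw [Matrix.algebraMap_matrix_apply, if_neg (fun h => hij h.ge)]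

/-- The idempotent `1 - e₀` of the right algebra. -/
theorem rightIdem : IsIdempotentElem (1 - (posetBocs K P).toRight BaseAlg.e₀) := by
  rw [← map_one (posetBocs K P).toRight, ← map_sub]
  exact BaseAlg.one_sub_e₀_idem.map _

/-- The idempotent `1 - e₀` of the left algebra. -/
theorem leftIdem : IsIdempotentElem (1 - (posetBocs K P).toLeft BaseAlg.e₀) := by
  rw [← map_one (posetBocs K P).toLeft, ← map_sub]
  exact BaseAlg.one_sub_e₀_idem.map _

end Poset

/-! ## Idempotent restriction, induction and co-induction -/

section Modules

/-- The corner algebra `e Λ e`, with `k ∈ K` acting by `k e`. -/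
instance {K Λ : Type*} [CommRing K] [Ring Λ] [Algebra K Λ] {e : Λ} (he : IsIdempotentElem e) :
    Algebra K he.Corner :=
  RingHom.toAlgebra'
    { toFun := fun k => ⟨algebraMap K Λ k * e, (Subsemigroup.mem_corner_iff he).mpr
        ⟨by rw [← mul_assoc, ← Algebra.commutes, mul_assoc, he.eq], by rw [mul_assoc, he.eq]⟩⟩
      map_one' := Subtype.ext (by
        change algebraMap K Λ 1 * e = e
        rw [map_one, one_mul])
      map_zero' := Subtype.ext (by
        change algebraMap K Λ 0 * e = 0
        rw [map_zero, zero_mul])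
      map_add' := fun k l => Subtype.ext (by
        change algebraMap K Λ (k + l) * e = algebraMap K Λ k * e + algebraMap K Λ l * e
        rw [map_add, add_mul])
      map_mul' := fun k l => Subtype.ext (by
        change algebraMap K Λ (k * l) * e = algebraMap K Λ k * e * (algebraMap K Λ l * e)
        rw [map_mul, Algebra.commutes l e, mul_assoc _ e, ← mul_assoc e e, he.eq,
          ← Algebra.commutes l e, mul_assoc]) }
    (fun k x => Subtype.ext (by
      have hx := (Subsemigroup.mem_corner_iff he).mp x.2
      change algebraMap K Λ k * e * x.1 = x.1 * (algebraMap K Λ k * e)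
      rw [mul_assoc, hx.1, Algebra.commutes, Algebra.commutes, ← mul_assoc, hx.2]))

variable {Λ : Type*} [Ring Λ] {e : Λ}

/-- The subgroup `e M` of a left `Λ`-module `M`. -/
def cornerSubgroup (e : Λ) (M : Type*) [AddCommGroup M] [Module Λ M] : AddSubgroup M :=
  (DistribSMul.toAddMonoidHom M e).range

/-- The idempotent restriction `e M` of a left `Λ`-module `M`, as a module over a ring `B` that is
identified with `e Λ e` by `θ`. -/
def Res {B : Type*} [Ring B] {he : IsIdempotentElem e} (_θ : B →+* he.Corner)
    (M : Type*) [AddCommGroup M] [Module Λ M] : Type _ :=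
  cornerSubgroup e M

namespace Res

variable {B : Type*} [Ring B] {he : IsIdempotentElem e} (θ : B →+* he.Corner)
  (M : Type*) [AddCommGroup M] [Module Λ M]

instance : AddCommGroup (Res θ M) := inferInstanceAs (AddCommGroup (cornerSubgroup e M))

theorem smul_mem (x : he.Corner) (m : M) : x.1 • m ∈ cornerSubgroup e M :=
  ⟨x.1 • m, by
    change e • x.1 • m = x.1 • m
    rw [← mul_smul, ((Subsemigroup.mem_corner_iff he).mp x.2).1]⟩

/-- The element `b ∈ B` acts on `e M` as the element `θ b` of `e Λ e ⊆ Λ`. -/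
instance : Module B (Res θ M) where
  smul b m := ⟨(θ b).1 • m.1, smul_mem M (θ b) m.1⟩
  one_smul m := Subtype.ext (by
    obtain ⟨_, n, rfl⟩ := m
    change (θ 1).1 • e • n = e • n
    rw [map_one]
    change e • e • n = e • n
    rw [← mul_smul, he.eq])
  mul_smul a b m := Subtype.ext (by
    change (θ (a * b)).1 • m.1 = (θ a).1 • (θ b).1 • m.1
    rw [map_mul, ← mul_smul]; rfl)
  smul_zero a := Subtype.ext (smul_zero (θ a).1)
  smul_add a m n := Subtype.ext (smul_add (θ a).1 m.1 n.1)
  add_smul a b m := Subtype.ext (by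
    change (θ (a + b)).1 • m.1 = (θ a).1 • m.1 + (θ b).1 • m.1
    rw [map_add, ← add_smul]; rfl)
  zero_smul m := Subtype.ext (by
    change (θ 0).1 • m.1 = 0
    rw [map_zero]
    exact zero_smul Λ m.1)

end Res

variable {A : Type*} [Ring A]

/-- The induced module `Λ ⊗_A N` along a ring morphism `f : A → Λ`: the quotient of the left
`Λ`-module `Λ ⊗_ℤ N` by the relations `(x f(a)) ⊗ n = x ⊗ (a n)`. -/
abbrev Induction (f : A →+* Λ) (N : Type*) [AddCommGroup N] [Module A N] : Type _ :=
  (Λ ⊗[ℤ] N) ⧸ Submodule.span Λ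
    {t : Λ ⊗[ℤ] N | ∃ (x : Λ) (a : A) (n : N), t = (x * f a) ⊗ₜ[ℤ] n - x ⊗ₜ[ℤ] (a • n)}

/-- A left `Λ`-module `M` is induced along `f : A → Λ` if `M ≅ Λ ⊗_A N` for some left
`A`-module `N`. -/
def IsInduced (f : A →+* Λ) (M : Type w) [AddCommGroup M] [Module Λ M] : Prop :=
  ∃ (N : Type w) (_ : AddCommGroup N) (_ : Module A N), Nonempty (M ≃ₗ[Λ] Induction f N)

/-- A left `Λ`-module `M` is co-induced along `f : A → Λ` if `M ≅ Hom_A(Λ, N)` for some left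
`A`-module `N`, where `Λ` acts on `Hom_A(Λ, N)` by `(s g)(x) = g(x s)`. -/
def IsCoinduced (f : A →+* Λ) (M : Type w) [AddCommGroup M] [Module Λ M] : Prop :=
  ∃ (N : Type w) (_ : AddCommGroup N) (_ : Module A N),
    Nonempty (M ≃ₗ[Λ] (ModuleCat.coextendScalars f).obj (ModuleCat.of A N))

/-- A module over a `K`-algebra is finite dimensional over `K`. -/
def IsFinDim (K : Type*) [Field K] (Λ : Type*) [Ring Λ] [Algebra K Λ] (M : Type*)
    [AddCommGroup M] [Module Λ M] : Prop :=
  letI : Module K M := Module.compHom M (algebraMap K Λ)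
  FiniteDimensional K M

/-- `M ≅ Λ ⊗_A N` for some finite dimensional left `A`-module `N`. -/
def IsFinInduced (K : Type*) [Field K] [Algebra K A] (f : A →+* Λ) (M : Type w) [AddCommGroup M]
    [Module Λ M] : Prop :=
  ∃ (N : Type w) (_ : AddCommGroup N) (_ : Module A N),
    IsFinDim K A N ∧ Nonempty (M ≃ₗ[Λ] Induction f N)

/-- `M ≅ Hom_A(Λ, N)` for some finite dimensional left `A`-module `N`. -/
def IsFinCoinduced (K : Type*) [Field K] [Algebra K A] (f : A →+* Λ) (M : Type w)
    [AddCommGroup M] [Module Λ M] : Prop :=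
  ∃ (N : Type w) (_ : AddCommGroup N) (_ : Module A N),
    IsFinDim K A N ∧ Nonempty (M ≃ₗ[Λ] (ModuleCat.coextendScalars f).obj (ModuleCat.of A N))

end Modules

end PosetBocs

/-!
Every element of `KP` acts on both sides of the bocs. Writing `v_jj` for `ω e_j`, the
comultiplication sends `v_ij` to `∑_{i ≤ k ≤ j} v_ik ⊗ v_kj`, which is the rule of matrix
multiplication. Hence a matrix `b` in `KP` gives a left linear map `v_ij ↦ b_ji e_i` in `R` and a
right linear map `v_ij ↦ b_ji e_j`, `α_i v_ij ↦ 0` in `L`, and these assignments, `rightEmb` and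
`leftEmb`, are multiplicative and send `1` to `1 - e₀`. They identify `KP` with the corners
(`rightEquiv`, `leftEquiv`). Another choice of the identification twists the restriction of a module
by an automorphism of `KP`, which affects neither projectivity nor injectivity, so it suffices to
treat these two. Below `p_ij` is the matrix unit that maps `e_i M` to `e_j M`, for `i ≤ j`.

The right algebra is `R = e₀ A ⊕ KP` with `(1 - e₀) R e₀ = 0` (`rightAlg_eq`), so the projection
`R → KP` is a ring morphism. By the universal property of `R ⊗_A N`, a surjection onto
`(1 - e₀)(R ⊗_A N)` splits as soon as it splits over the semisimple subalgebra spanned by the `e_i`,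
which is automatic (`projective_of_induced`). Conversely, a projective `KP`-module is
`⨁ KP e_i ⊗ N_i`, where `N_i` is a complement of the radical in `e_i M`
(`exists_generators_of_projective`). If `(1 - e₀) M` has this form, let `N` be the subspace of `M`
with `e_i N = N_i` and `e₀ N = e₀ M`. It is an `A`-submodule, and `R ⊗_A N → M` is bijective
(`exists_induced_of_projective`).

The left algebra is generated over `A` by the `p_ij`, the element `e₀` and, for `i < j`, the element
`r_ij` dual to `α_i v_ij` (`leftAlg_eq_sum`). The differential `δ(α_j) = -∑ α_i v_ij` yields
`r_ij α_i = p_ij` and `r_ij α_j = -e_j` (`leftDual_mul_arrow`). Only the `p_ij` are needed for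
`L (1 - e₀)`, so that `(1 - e₀) Hom_A(L, N)` is described by the values at the `p_ij`, and a linear
extension of `x ↦ g(x)(1)` provides the extension of a morphism `g` into it
(`injective_of_coinduced`). Conversely, an injective `KP`-module is
`∏ Hom_K(e_j KP, M_j / C_j)`, where `C_j` is a complement of the socle in `M_j = e_j M`
(`exists_cogenerators_of_injective`). If `(1 - e₀) M` has this form, let `D` be the `A`-submodule
`∑ C_i + ∑ α_i C_i` of `M`. Then `m ↦ (x ↦ x m + D)` is an isomorphism `M ≅ Hom_A(L, M / D)`
(`exists_coinduced_of_injective`): modulo `D`, the component of `m` in `(1 - e₀) M` is detected by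
the `p_ij`, and that in `e₀ M` by `e₀` and the `r_ij`, since
`r_ij ∑ α_l d_l = p_ij d_i - d_j ≡ p_ij d_i` for `d_l ∈ C_l`.

The module `N` is a submodule or a quotient of `M` in these constructions, and so it is finite
dimensional if `M` is.
-/

namespace PosetBocs

/-! ### Modules over the incidence algebra -/

section IncidenceModules

variable {K : Type u} [Field K] {P : Type v} [Fintype P] [DecidableEq P] [PartialOrder P]

open Classical in
/-- The matrix unit of `KP` with entry `1` at `(j, i)`, which is taken to be zero unless `i ≤ j`.
It is the basis element of `KP` that maps the component `e_i M` of a left module to `e_j M`. -/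
noncomputable def unit (K : Type u) [Field K] (i j : P) : incidence K P :=
  ⟨fun a b => if a = j ∧ b = i ∧ i ≤ j then 1 else 0, fun a b h => by
    by_cases h' : a = j ∧ b = i ∧ i ≤ j
    · rw [h'.1, h'.2.1]; exact h'.2.2
    · simp [h'] at h⟩

open Classical in
theorem unit_apply (i j a b : P) :
    (unit K i j).1 a b = if a = j ∧ b = i ∧ i ≤ j then 1 else 0 := rfl

theorem unit_eq_zero {i j : P} (h : ¬ i ≤ j) : unit K i j = 0 := by
  refine Subtype.ext (funext fun a => funext fun b => ?_)
  rw [unit_apply, if_neg (fun h' => h h'.2.2)]; rfl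

theorem incidence_apply_eq_zero (b : incidence K P) {i j : P} (h : ¬ i ≤ j) : b.1 j i = 0 :=
  not_not.mp fun h' => h (b.2 j i h')

theorem incidence_mul_apply (b c : incidence K P) (i j : P) :
    (b * c).1 j i = ∑ k, b.1 j k * c.1 k i := Matrix.mul_apply

open Classical in
theorem mul_unit_apply (b : incidence K P) (i j a c : P) :
    (b * unit K i j).1 a c = if c = i ∧ i ≤ j then b.1 a j else 0 := by
  rw [incidence_mul_apply, Finset.sum_eq_single j]
  · simp [unit_apply]
  · intro k _ hk; simp [unit_apply, hk]
  · simp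

theorem incidence_add_apply (b c : incidence K P) (i j : P) :
    (b + c).1 j i = b.1 j i + c.1 j i := rfl

theorem incidence_smul_apply (k : K) (b : incidence K P) (i j : P) :
    (k • b).1 j i = k * b.1 j i := rfl

theorem incidence_sum_apply {ι : Type*} (s : Finset ι) (f : ι → incidence K P) (i j : P) :
    (∑ x ∈ s, f x).1 j i = ∑ x ∈ s, (f x).1 j i :=
  map_sum (AddMonoidHom.mk' (fun b : incidence K P => b.1 j i) fun _ _ => rfl) f s

theorem incidence_ext {b c : incidence K P} (h : ∀ i j, b.1 j i = c.1 j i) : b = c :=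
  Subtype.ext (funext fun j => funext fun i => h i j)

theorem incidence_eq_sum (b : incidence K P) : b = ∑ i, ∑ j, b.1 j i • unit K i j := by
  refine incidence_ext fun i j => ?_
  simp only [incidence_sum_apply, incidence_smul_apply, unit_apply]
  rw [Finset.sum_eq_single i, Finset.sum_eq_single j]
  · by_cases h : i ≤ j
    · simp [h]
    · simp [h, incidence_apply_eq_zero b h]
  · intro k _ hk; simp [hk.symm]
  · simp
  · intro k _ hk; simp [hk.symm]
  · simp

theorem unit_mul_unit {i j k : P} (hki : k ≤ i) (hij : i ≤ j) :
    unit K i j * unit K k i = unit K k j := by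
  refine incidence_ext fun a b => ?_
  rw [mul_unit_apply, unit_apply, unit_apply]
  simp only [hki, hij, hki.trans hij, and_true]
  by_cases h : a = k <;> by_cases h' : b = j <;> simp [h, h']

theorem unit_mul_unit_of_ne {i j k l : P} (h : i ≠ l) : unit K i j * unit K k l = 0 := by
  refine incidence_ext fun a b => ?_
  rw [mul_unit_apply, unit_apply]
  simp [h.symm]

theorem unit_mul_self (i j : P) : unit K j j * unit K i j = unit K i j := by
  by_cases h : i ≤ j
  · exact unit_mul_unit h le_rfl
  · rw [unit_eq_zero h, mul_zero]

theorem mul_unit_self (i j : P) : unit K i j * unit K i i = unit K i j := by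
  by_cases h : i ≤ j
  · exact unit_mul_unit le_rfl h
  · rw [unit_eq_zero h, zero_mul]

theorem sum_unit : ∑ i : P, unit K i i = 1 := by
  refine incidence_ext fun a b => ?_
  rw [incidence_sum_apply, Finset.sum_eq_single a]
  · simp [unit_apply, Matrix.one_apply]
  · intro k _ hk; simp [unit_apply, hk.symm]
  · simp

theorem mul_unit (b : incidence K P) {i j : P} (h : i ≤ j) :
    b * unit K i j = ∑ k, b.1 k j • unit K i k := by
  refine incidence_ext fun a c => ?_
  rw [mul_unit_apply, incidence_sum_apply, Finset.sum_eq_single c]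
  · by_cases hc : j ≤ c
    · simp [incidence_smul_apply, unit_apply, h, h.trans hc]
    · simp [incidence_apply_eq_zero b hc]
  · intro k _ hk; simp [incidence_smul_apply, unit_apply, hk.symm]
  · simp

theorem unit_mul (b : incidence K P) {i j : P} (h : i ≤ j) :
    unit K i j * b = ∑ k, b.1 i k • unit K k j := by
  refine incidence_ext fun a c => ?_
  rw [incidence_mul_apply, incidence_sum_apply, Finset.sum_eq_single i, Finset.sum_eq_single a]
  · by_cases ha : a ≤ i
    · simp [incidence_smul_apply, unit_apply, h, ha.trans h]
    · simp [incidence_apply_eq_zero b ha]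
  · intro k _ hk; simp [incidence_smul_apply, unit_apply, hk.symm]
  · simp
  · intro k _ hk; simp [unit_apply, hk]
  · simp

variable (K P) in
/-- The `KP`-module of column vectors `P → K`. -/
def ColumnModule : Type _ := P → K

namespace ColumnModule

instance : AddCommGroup (ColumnModule K P) := inferInstanceAs (AddCommGroup (P → K))

instance : Module (incidence K P) (ColumnModule K P) where
  smul b f := b.1.mulVec f
  one_smul f := Matrix.one_mulVec f
  mul_smul b c f := (Matrix.mulVec_mulVec f b.1 c.1).symm
  smul_zero b := Matrix.mulVec_zero b.1
  smul_add b f g := Matrix.mulVec_add b.1 f g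
  add_smul b c f := Matrix.add_mulVec b.1 c.1 f
  zero_smul f := Matrix.zero_mulVec f

/-- The coordinate at `i`. -/
def coord (f : ColumnModule K P) (i : P) : K := f i

@[ext]
theorem ext {f g : ColumnModule K P} (h : ∀ i, f.coord i = g.coord i) : f = g := funext h

@[simp] theorem add_coord (f g : ColumnModule K P) (i) :
    (f + g).coord i = f.coord i + g.coord i := rfl

@[simp] theorem zero_coord (i) : (0 : ColumnModule K P).coord i = 0 := rfl

theorem smul_coord (b : incidence K P) (f : ColumnModule K P) (i) :
    (b • f).coord i = ∑ k, b.1 i k * f.coord k := rfl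

theorem sum_coord {ι : Type*} (s : Finset ι) (f : ι → ColumnModule K P) (i) :
    (∑ x ∈ s, f x).coord i = ∑ x ∈ s, (f x).coord i :=
  map_sum (AddMonoidHom.mk' (fun f : ColumnModule K P => f.coord i) fun _ _ => rfl) f s

/-- The vector with entry `x` at `i` and zeros elsewhere. -/
def single (i : P) (x : K) : ColumnModule K P := Pi.single i x

theorem single_coord (i : P) (x : K) (j : P) : (single i x).coord j = if j = i then x else 0 := by
  simp [single, coord, Pi.single_apply]

open Classical in
theorem unit_smul_coord (i j : P) (f : ColumnModule K P) (a : P) :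
    (unit K i j • f).coord a = if a = j ∧ i ≤ j then f.coord i else 0 := by
  rw [smul_coord, Finset.sum_eq_single i]
  · simp [unit_apply]
  · intro k _ hk; simp [unit_apply, hk]
  · simp

variable (K) in
/-- The vectors supported on the elements above `i`. -/
def above (i : P) : Submodule (incidence K P) (ColumnModule K P) where
  carrier := {f | ∀ k, ¬ i ≤ k → f.coord k = 0}
  add_mem' {f g} hf hg k hk := by rw [add_coord, hf k hk, hg k hk, add_zero]
  zero_mem' k _ := rfl
  smul_mem' b f hf k hk := by
    rw [smul_coord]
    refine Finset.sum_eq_zero fun l _ => ?_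
    by_cases hl : l ≤ k
    · rw [hf l fun h => hk (h.trans hl), mul_zero]
    · rw [incidence_apply_eq_zero b hl, zero_mul]

variable (K) in
/-- The vectors vanishing strictly below `j`. -/
def notBelow (j : P) : Submodule (incidence K P) (ColumnModule K P) where
  carrier := {f | ∀ k, k < j → f.coord k = 0}
  add_mem' {f g} hf hg k hk := by rw [add_coord, hf k hk, hg k hk, add_zero]
  zero_mem' k _ := rfl
  smul_mem' b f hf k hk := by
    rw [smul_coord]
    refine Finset.sum_eq_zero fun l _ => ?_
    by_cases hl : l ≤ k
    · rw [hf l (hl.trans_lt hk), mul_zero]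
    · rw [incidence_apply_eq_zero b hl, zero_mul]

end ColumnModule

/-- The character `b ↦ b_ii` of `KP`. -/
def diagHom (K : Type u) [Field K] (i : P) : incidence K P →+* K where
  toFun b := b.1 i i
  map_one' := by simp
  map_zero' := rfl
  map_add' b c := rfl
  map_mul' b c := by
    rw [incidence_mul_apply, Finset.sum_eq_single i]
    · intro k _ hk
      by_cases h : k ≤ i
      · rw [incidence_apply_eq_zero c (fun h' => hk (le_antisymm h h')), mul_zero]
      · rw [incidence_apply_eq_zero b h, zero_mul]
    · simp

/-- The simple `KP`-module at `i`. -/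
def SimpleModule (K : Type u) [Field K] (_i : P) : Type u := K

instance (i : P) : AddCommGroup (SimpleModule K i) := inferInstanceAs (AddCommGroup K)

noncomputable instance (i : P) : Module (incidence K P) (SimpleModule K i) :=
  letI : Module K (SimpleModule K i) := inferInstanceAs (Module K K)
  Module.compHom _ (diagHom K i)

theorem SimpleModule.smul_eq (i : P) (b : incidence K P) (x : K) :
    (b • (show SimpleModule K i from x) : SimpleModule K i) = (b.1 i i * x : K) := rfl

variable (M : Type w) [AddCommGroup M] [Module K M] [Module (incidence K P) M]
  [IsScalarTower K (incidence K P) M]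

variable (K) in
/-- The component `e_i M` of a `KP`-module. -/
noncomputable def component (i : P) : Submodule K M :=
  LinearMap.range (Algebra.lsmul K K M (unit K i i))

variable {M}

theorem mem_component {i : P} {m : M} : m ∈ component K M i ↔ unit K i i • m = m := by
  constructor
  · rintro ⟨n, rfl⟩
    rw [Algebra.lsmul_coe, ← mul_smul, unit_mul_self]
  · intro h
    exact ⟨m, h⟩

theorem unit_smul_mem_component (i j : P) (m : M) : unit K i j • m ∈ component K M j := by
  rw [mem_component, ← mul_smul, unit_mul_self]

theorem unit_smul_smul {i j k : P} (hki : k ≤ i) (hij : i ≤ j) (m : M) :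
    unit K i j • unit K k i • m = unit K k j • m := by
  rw [← mul_smul, unit_mul_unit hki hij]

theorem unit_smul_smul_of_ne {i j k l : P} (h : i ≠ l) (m : M) :
    unit K i j • unit K k l • m = 0 := by
  rw [← mul_smul, unit_mul_unit_of_ne h, zero_smul]

theorem unit_smul_of_ne {i j k : P} (h : i ≠ k) {m : M} (hm : m ∈ component K M k) :
    unit K i j • m = 0 := by
  rw [← mem_component.mp hm, unit_smul_smul_of_ne h]

theorem unit_smul_eq_zero {i j : P} (h : ¬ i ≤ j) (m : M) : unit K i j • m = 0 := by
  rw [unit_eq_zero h, zero_smul]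

theorem sum_unit_smul (m : M) : ∑ i : P, unit K i i • m = m := by
  rw [← Finset.sum_smul, sum_unit, one_smul]

theorem exists_complement_within (S E : Submodule K M) (h : S ≤ E) :
    ∃ N : Submodule K M, S ⊔ N = E ∧ S ⊓ N = ⊥ := by
  obtain ⟨Q, hQ⟩ := Submodule.exists_isCompl S
  refine ⟨Q ⊓ E, ?_, ?_⟩
  · rw [← sup_inf_assoc_of_le Q h, hQ.sup_eq_top, top_inf_eq]
  · rw [← inf_assoc, hQ.inf_eq_bot, bot_inf_eq]

/-- A submodule of `M`, stable under the matrix units, that contains complements of the radicals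
`∑_{k < i} p_ki M` in the components `e_i M` is everything. -/
theorem eq_top_of_generates (N : P → Submodule K M) (T : Submodule K M)
    (hN : ∀ i, (⨆ k : {k // k < i}, LinearMap.range (Algebra.lsmul K K M (unit K k.1 i))) ⊔ N i =
      component K M i)
    (hT : ∀ i j : P, ∀ m ∈ T, unit K i j • m ∈ T) (hNT : ∀ i, N i ≤ T) : T = ⊤ := by
  have key : ∀ i : P, component K M i ≤ T := by
    intro i
    induction i using WellFoundedLT.induction with
    | ind i ih =>
      rw [← hN i]
      refine sup_le (iSup_le ?_) (hNT i)
      rintro ⟨k, hk⟩ _ ⟨m, rfl⟩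
      change unit K k i • m ∈ T
      rw [← unit_smul_smul (le_refl k) hk.le]
      exact hT _ _ _ (ih k hk (unit_smul_mem_component k k m))
  rw [eq_top_iff]
  intro m _
  rw [← sum_unit_smul (K := K) (P := P) m]
  exact Submodule.sum_mem _ fun i _ => key i (unit_smul_mem_component i i m)

/-- A projective `KP`-module is `⨁ KP e_i ⊗ N_i`, where `N_i` is any complement of the radical in
`e_i M`. The sum spans by induction along `P`. For independence, a functional on `e_i M` that kills
the radical is a morphism to the simple module at `i`, and it lifts to a morphism to the column
vectors supported above `i`; the value at a relation with `i` maximal shows that its term at `i`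
vanishes. -/
theorem exists_generators_of_projective [Module.Projective (incidence K P) M] :
    ∃ N : P → Submodule K M, (∀ i, N i ≤ component K M i) ∧
      (∀ m : M, ∃ n : P → P → M, (∀ i j, n i j ∈ N i) ∧ m = ∑ i, ∑ j, unit K i j • n i j) ∧
      ∀ n : P → P → M, (∀ i j, n i j ∈ N i) → (∀ i j, ¬ i ≤ j → n i j = 0) →
        ∑ i, ∑ j, unit K i j • n i j = 0 → ∀ i j, n i j = 0 := by
  classical
  let rad : P → Submodule K M := fun i =>
    ⨆ k : {k // k < i}, LinearMap.range (Algebra.lsmul K K M (unit K k.1 i))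
  have hrad : ∀ i, rad i ≤ component K M i := by
    intro i
    refine iSup_le ?_
    rintro k _ ⟨m, rfl⟩
    exact unit_smul_mem_component _ _ _
  choose N hN hN' using fun i => exists_complement_within (rad i) (component K M i) (hrad i)
  have hNE : ∀ i, N i ≤ component K M i := fun i => hN i ▸ le_sup_right
  refine ⟨N, hNE, ?_, ?_⟩
  · let s : Set M := {m | ∃ i j, ∃ n ∈ N i, m = unit K i j • n}
    have hT : Submodule.span K s = ⊤ := by
      refine eq_top_of_generates N _ hN ?_ ?_
      · intro i j m hm
        induction hm using Submodule.span_induction with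
        | mem x hx =>
          obtain ⟨a, b, n, hn, rfl⟩ := hx
          by_cases hib : i = b
          · subst hib
            by_cases hai : a ≤ i
            · by_cases hij : i ≤ j
              · rw [unit_smul_smul hai hij]
                exact Submodule.subset_span ⟨a, j, n, hn, rfl⟩
              · rw [unit_smul_eq_zero hij]; exact zero_mem _
            · rw [unit_smul_eq_zero hai, smul_zero]; exact zero_mem _
          · rw [unit_smul_smul_of_ne hib]; exact zero_mem _
        | zero => rw [smul_zero]; exact zero_mem _
        | add x y _ _ hx hy => rw [smul_add]; exact add_mem hx hy
        | smul k x _ hx => rw [smul_comm]; exact Submodule.smul_mem _ _ hx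
      · intro i n hn
        exact Submodule.subset_span ⟨i, i, n, hn, (mem_component.mp (hNE i hn)).symm⟩
    intro m
    have hm : m ∈ Submodule.span K s := hT ▸ Submodule.mem_top
    induction hm using Submodule.span_induction with
    | mem x hx =>
      obtain ⟨a, b, n, hn, rfl⟩ := hx
      refine ⟨Pi.single a (Pi.single b n), fun i j => ?_, ?_⟩
      · by_cases hi : i = a
        · subst hi
          by_cases hj : j = b
          · subst hj; simpa using hn
          · simp [hj]
        · simp [hi]
      · rw [Finset.sum_eq_single a, Finset.sum_eq_single b]
        · simp
        · intro j _ hj; simp [hj]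
        · simp
        · intro i _ hi; simp [hi]
        · simp
    | zero => exact ⟨0, fun i j => zero_mem _, by simp⟩
    | add x y _ _ hx hy =>
      obtain ⟨n, hn, rfl⟩ := hx
      obtain ⟨n', hn', rfl⟩ := hy
      exact ⟨n + n', fun i j => add_mem (hn i j) (hn' i j), by
        simp [smul_add, Finset.sum_add_distrib]⟩
    | smul k x _ hx =>
      obtain ⟨n, hn, rfl⟩ := hx
      exact ⟨k • n, fun i j => Submodule.smul_mem _ _ (hn i j), by
        simp only [Finset.smul_sum, Pi.smul_apply]
        exact Finset.sum_congr rfl fun i _ => Finset.sum_congr rfl fun j _ =>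
          smul_comm k (unit K i j) (n i j)⟩
  · intro n hn hle hsum i₀ j
    by_contra hne
    obtain ⟨i, hi, hmax⟩ : ∃ i, n i j ≠ 0 ∧ ∀ k, i < k → n k j = 0 := by
      obtain ⟨i, hi⟩ := (Set.toFinite {i | n i j ≠ 0}).exists_maximal ⟨i₀, hne⟩
      exact ⟨i, hi.1, fun k hk => by
        by_contra h
        exact (hi.2 h hk.le).not_gt hk⟩
    have hij : i ≤ j := by
      by_contra h
      exact hi (hle i j h)
    have hnot : n i j ∉ rad i := fun h => hi ((Submodule.mem_bot K).mp (hN' i ▸ ⟨h, hn i j⟩))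
    obtain ⟨l, hl, hlrad⟩ := Submodule.exists_le_ker_of_notMem hnot
    -- The morphism from `M` to the simple module at `i` given by `l`.
    let g : M →ₗ[incidence K P] SimpleModule K i :=
      { toFun := fun m => (l (unit K i i • m) : K)
        map_add' := fun m m' => by rw [smul_add, map_add]; rfl
        map_smul' := fun b m => by
          rw [RingHom.id_apply, SimpleModule.smul_eq, ← mul_smul, unit_mul b le_rfl,
            Finset.sum_smul, map_sum, Finset.sum_eq_single i]
          · rw [smul_assoc, map_smul, smul_eq_mul]
          · intro k _ hk
            by_cases h : k ≤ i
            · rw [smul_assoc, map_smul]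
              have : unit K k i • m ∈ rad i :=
                Submodule.mem_iSup_of_mem (⟨k, lt_of_le_of_ne h hk⟩ : {k // k < i}) ⟨m, rfl⟩
              rw [show l (unit K k i • m) = 0 from hlrad this, smul_zero]
            · rw [unit_eq_zero h, smul_zero, zero_smul, map_zero]
          · simp }
    let q : ColumnModule.above K i →ₗ[incidence K P] SimpleModule K i :=
      { toFun := fun f => (f.1.coord i : K)
        map_add' := fun f f' => rfl
        map_smul' := fun b f => by
          rw [RingHom.id_apply, SimpleModule.smul_eq]
          change (b • f.1).coord i = _
          rw [ColumnModule.smul_coord, Finset.sum_eq_single i]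
          · intro k _ hk
            by_cases h : i ≤ k
            · rw [incidence_apply_eq_zero b (fun h' => hk (le_antisymm h' h)), zero_mul]
            · rw [f.2 k h, mul_zero]
          · simp }
    have hq : Function.Surjective q := fun x =>
      ⟨⟨ColumnModule.single i (show K from x), fun k hk => by
        rw [ColumnModule.single_coord, if_neg]
        rintro rfl
        exact hk le_rfl⟩, by
          change (ColumnModule.single i (show K from x)).coord i = _
          rw [ColumnModule.single_coord, if_pos rfl]⟩
    obtain ⟨φ, hφ⟩ := Module.projective_lifting_property q g hq
    have hφi : ∀ m, (φ m).1.coord i = l (unit K i i • m) := fun m => LinearMap.congr_fun hφ m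
    have h0 : (φ (unit K j j • ∑ a, ∑ b, unit K a b • n a b)).1.coord j = 0 := by
      rw [hsum, smul_zero, map_zero]; rfl
    have hj : unit K j j • ∑ a, ∑ b, unit K a b • n a b = ∑ a, unit K a j • n a j := by
      rw [Finset.smul_sum]
      refine Finset.sum_congr rfl fun a _ => ?_
      rw [Finset.smul_sum, Finset.sum_eq_single j]
      · rw [← mul_smul, unit_mul_self]
      · intro b _ hb; exact unit_smul_smul_of_ne hb.symm _
      · simp
    have hterm : ∀ a, (unit K a j • (φ (n a j)).1).coord j =
        if a ≤ j then (φ (n a j)).1.coord a else 0 := fun a => by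
      rw [ColumnModule.unit_smul_coord]; simp
    have h1 : (φ (∑ a, unit K a j • n a j)).1.coord j =
        ∑ a, (unit K a j • (φ (n a j)).1).coord j := by
      rw [map_sum, ← ColumnModule.sum_coord]
      simp
    rw [hj, h1, Finset.sum_eq_single i, hterm, if_pos hij, hφi,
      mem_component.mp (hNE i (hn i j))] at h0
    · exact hl h0
    · intro a _ ha
      by_cases hia : i ≤ a
      · rw [hmax a (lt_of_le_of_ne hia ha.symm), map_zero]
        simp
      · rw [hterm, (φ (n a j)).2 a hia, ite_self]
    · simp

/-- An injective `KP`-module is `∏ Hom_K(e_j KP, M_j / C_j)`, where `C_j` is any complement of the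
socle in `M_j = e_j M`. Injectivity of the canonical map holds since `M` is an essential extension
of its socle. For surjectivity, an element `n` of the socle of `e_j M` is a
morphism `f ↦ f_j n` on the column vectors vanishing below `j`, and an extension to all column
vectors provides preimages up to terms below `j`, which are removed by induction. -/
theorem exists_cogenerators_of_injective (hM : Module.Baer (incidence K P) M) :
    ∃ C : P → Submodule K M, (∀ i, C i ≤ component K M i) ∧
      (∀ m : M, (∀ i j, unit K i j • m ∈ C j) → m = 0) ∧
      ∀ n : P → P → M, (∀ i j, n i j ∈ component K M j) →
        ∃ m : M, ∀ i j, i ≤ j → unit K i j • m - n i j ∈ C j := by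
  classical
  let soc : P → Submodule K M := fun i =>
    component K M i ⊓ ⨅ k : {k // i < k}, LinearMap.ker (Algebra.lsmul K K M (unit K i k.1))
  have mem_soc : ∀ i m, m ∈ soc i ↔ m ∈ component K M i ∧ ∀ k, i < k → unit K i k • m = 0 := by
    intro i m
    simp [soc]
  choose C hC hC' using fun i => exists_complement_within (soc i) (component K M i) inf_le_left
  have hCE : ∀ i, C i ≤ component K M i := fun i => hC i ▸ le_sup_right
  refine ⟨C, hCE, ?_, ?_⟩
  · intro m hm
    have key : ∀ i : P, ∀ m : M, (∀ i j, unit K i j • m ∈ C j) → unit K i i • m = 0 := by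
      intro i
      induction i using WellFoundedGT.induction with
      | ind i ih =>
        intro m hm
        have h1 : unit K i i • m ∈ soc i ⊓ C i := by
          refine ⟨(mem_soc _ _).mpr ⟨unit_smul_mem_component _ _ _, fun k hk => ?_⟩, hm i i⟩
          rw [unit_smul_smul (le_refl i) hk.le, ← unit_smul_smul hk.le (le_refl k)]
          refine ih k hk _ fun a b => ?_
          by_cases ha : a = k
          · subst ha
            by_cases hab : a ≤ b
            · rw [unit_smul_smul hk.le hab]; exact hm _ _
            · rw [unit_smul_eq_zero hab]; exact zero_mem _
          · rw [unit_smul_smul_of_ne ha]; exact zero_mem _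
        rw [hC'] at h1
        exact (Submodule.mem_bot K).mp h1
    rw [← sum_unit_smul (K := K) (P := P) m, Finset.sum_eq_zero fun i _ => key i m hm]
  -- Preimages, up to terms below `j`, of elements of the socle.
  have hext : ∀ j, ∀ n ∈ soc j, ∃ φ : ColumnModule K P →ₗ[incidence K P] M,
      φ (ColumnModule.single j 1) = n ∧ ∀ k, ¬ k ≤ j → φ (ColumnModule.single k 1) = 0 := by
    intro j n hn
    obtain ⟨hnE, hn0⟩ := (mem_soc j n).mp hn
    have hbn : ∀ b : incidence K P, b • n = b.1 j j • n := fun b => by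
      conv_lhs => rw [← mem_component.mp hnE, ← mul_smul, mul_unit b (le_refl j), Finset.sum_smul]
      rw [Finset.sum_eq_single j, smul_assoc, mem_component.mp hnE]
      · intro k _ hk
        by_cases h : j ≤ k
        · rw [smul_assoc, hn0 k (lt_of_le_of_ne h hk.symm), smul_zero]
        · rw [unit_eq_zero h, smul_zero, zero_smul]
      · simp
    let g : ColumnModule.notBelow K j →ₗ[incidence K P] M :=
      { toFun := fun f => f.1.coord j • n
        map_add' := fun f f' => add_smul _ _ _
        map_smul' := fun b f => by
          rw [RingHom.id_apply, smul_comm, hbn, smul_smul, mul_comm]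
          change (b • f.1).coord j • n = _
          rw [ColumnModule.smul_coord, Finset.sum_eq_single j, mul_comm]
          · intro k _ hk
            by_cases h : k ≤ j
            · rw [f.2 k (lt_of_le_of_ne h hk), mul_zero]
            · rw [incidence_apply_eq_zero b h, zero_mul]
          · simp }
    obtain ⟨φ, hφ⟩ := Module.Baer.extension_property hM (M := ColumnModule.notBelow K j)
      (N := ColumnModule K P) (ColumnModule.notBelow K j).subtype (Submodule.subtype_injective _) g
    have hφ' : ∀ f, ∀ hf : f ∈ ColumnModule.notBelow K j, φ f = f.coord j • n :=
      fun f hf => LinearMap.congr_fun hφ ⟨f, hf⟩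
    have hmem : ∀ k, ¬ k < j → ColumnModule.single k 1 ∈ ColumnModule.notBelow K j := by
      intro k hk l hl
      rw [ColumnModule.single_coord, if_neg]
      rintro rfl
      exact hk hl
    refine ⟨φ, ?_, fun k hk => ?_⟩
    · rw [hφ' _ (hmem j (lt_irrefl j)), ColumnModule.single_coord, if_pos rfl, one_smul]
    · rw [hφ' _ (hmem k fun h => hk h.le), ColumnModule.single_coord, if_neg, zero_smul]
      rintro rfl
      exact hk le_rfl
  have hsingle : ∀ i j : P, i ≤ j →
      unit K i j • (ColumnModule.single i 1 : ColumnModule K P) = ColumnModule.single j 1 := by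
    intro i j hij
    ext a
    simp [ColumnModule.unit_smul_coord, ColumnModule.single_coord, hij]
  -- Preimages of the elements of a single factor.
  have hone : ∀ i j, i ≤ j → ∀ n ∈ component K M j, ∃ m ∈ component K M i,
      unit K i j • m - n ∈ C j ∧ ∀ k, i ≤ k → k ≠ j → unit K i k • m ∈ C k := by
    intro i j
    induction j using WellFoundedLT.induction with
    | ind j ih =>
      intro hij n hn
      rw [← hC j] at hn
      obtain ⟨s, hs, c, hc, rfl⟩ := Submodule.mem_sup.mp hn
      obtain ⟨φ, hφj, hφ0⟩ := hext j s hs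
      let x := φ (ColumnModule.single i 1)
      have hx : ∀ k, i ≤ k → unit K i k • x = φ (ColumnModule.single k 1) := fun k hk => by
        rw [← map_smul, hsingle i k hk]
      have ih' : ∀ k, ∃ u ∈ component K M i,
          (i ≤ k → k < j → unit K i k • u - unit K i k • x ∈ C k) ∧
          ∀ l, i ≤ l → l ≠ k → unit K i l • u ∈ C l := by
        intro k
        by_cases hk : i ≤ k ∧ k < j
        · obtain ⟨u, hu, h1, h2⟩ := ih k hk.2 hk.1 _ (unit_smul_mem_component i k x)
          exact ⟨u, hu, fun _ _ => h1, h2⟩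
        · exact ⟨0, zero_mem _, fun h h' => absurd ⟨h, h'⟩ hk, fun l _ _ => by
            rw [smul_zero]; exact zero_mem _⟩
      choose u hu hu1 hu2 using ih'
      refine ⟨unit K i i • x - ∑ k with i ≤ k ∧ k < j, u k, sub_mem (unit_smul_mem_component _ _ _)
        (Submodule.sum_mem _ fun k _ => hu k), ?_, ?_⟩
      · rw [smul_sub, unit_smul_smul le_rfl hij, hx j hij, hφj, Finset.smul_sum]
        have : ∑ k with i ≤ k ∧ k < j, unit K i j • u k ∈ C j :=
          Submodule.sum_mem _ fun k hk => hu2 k j hij (Finset.mem_filter.mp hk).2.2.ne'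
        have e : s - ∑ k with i ≤ k ∧ k < j, unit K i j • u k - (s + c) =
          -(∑ k with i ≤ k ∧ k < j, unit K i j • u k + c) := by abel
        rw [e]
        exact neg_mem (add_mem this hc)
      · intro l hil hlj
        rw [smul_sub, unit_smul_smul le_rfl hil, Finset.smul_sum]
        by_cases hl : l < j
        · have hmem : l ∈ Finset.univ.filter fun k => i ≤ k ∧ k < j := by simp [hil, hl]
          rw [← Finset.add_sum_erase _ _ hmem]
          have : ∑ k ∈ (Finset.univ.filter fun k => i ≤ k ∧ k < j).erase l,
              unit K i l • u k ∈ C l :=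
            Submodule.sum_mem _ fun k hk => hu2 k l hil (Finset.ne_of_mem_erase hk).symm
          rw [← sub_sub]
          refine sub_mem ?_ this
          rw [← neg_sub]
          exact neg_mem (hu1 l hil hl)
        · rw [hx l hil, hφ0 l (fun h => hl (lt_of_le_of_ne h hlj)), zero_sub]
          refine neg_mem (Submodule.sum_mem _ fun k hk => hu2 k l hil ?_)
          rintro rfl
          exact hl (Finset.mem_filter.mp hk).2.2
  intro n hn
  have hone' : ∀ i j, ∃ m ∈ component K M i, (i ≤ j → unit K i j • m - n i j ∈ C j) ∧
      ∀ k, i ≤ k → k ≠ j → unit K i k • m ∈ C k := by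
    intro i j
    by_cases hij : i ≤ j
    · obtain ⟨m, hm, h1, h2⟩ := hone i j hij _ (hn i j)
      exact ⟨m, hm, fun _ => h1, h2⟩
    · exact ⟨0, zero_mem _, fun h => absurd h hij, fun k _ _ => by
        rw [smul_zero]; exact zero_mem _⟩
  choose m hm h1 h2 using hone'
  refine ⟨∑ i, ∑ j, m i j, fun a b hab => ?_⟩
  have e : unit K a b • ∑ i, ∑ j, m i j = ∑ j, unit K a b • m a j := by
    rw [Finset.smul_sum, Finset.sum_eq_single a, Finset.smul_sum]
    · intro i _ hi
      rw [Finset.smul_sum]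
      exact Finset.sum_eq_zero fun j _ => unit_smul_of_ne hi.symm (hm i j)
    · simp
  rw [e, ← Finset.add_sum_erase _ _ (Finset.mem_univ b), add_sub_right_comm]
  exact add_mem (h1 a b hab) (Submodule.sum_mem _ fun j hj =>
    h2 a j b hab (Finset.ne_of_mem_erase hj).symm)

end IncidenceModules

/-! ### The path algebra of degree zero -/

namespace BaseAlg

variable {K : Type u} [Field K] {P : Type v} [PartialOrder P]

open Classical in
/-- The trivial path `e_i` at a vertex `i ∈ P`. -/
noncomputable def idem (i : P) : BaseAlg K P :=
  mk (fun x => if x = some i then 1 else 0) (fun _ => 0)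

open Classical in
/-- The arrow `α_i`. -/
noncomputable def arrow (i : P) : BaseAlg K P :=
  mk (fun _ => 0) (fun k => if k = i then 1 else 0)

open Classical in
@[simp] theorem idem_e (i : P) (x) :
    (idem i : BaseAlg K P).e x = if x = some i then 1 else 0 := rfl
@[simp] theorem idem_α (i k : P) : (idem i : BaseAlg K P).α k = 0 := rfl
@[simp] theorem arrow_e (i : P) (x) : (arrow i : BaseAlg K P).e x = 0 := rfl
open Classical in
@[simp] theorem arrow_α (i k : P) :
    (arrow i : BaseAlg K P).α k = if k = i then 1 else 0 := rfl
open Classical in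
@[simp] theorem e₀_e (x) : (e₀ : BaseAlg K P).e x = if x = none then 1 else 0 := rfl
@[simp] theorem e₀_α (k) : (e₀ : BaseAlg K P).α k = 0 := rfl

theorem sum_e {ι : Type*} (s : Finset ι) (F : ι → BaseAlg K P) (x) :
    (∑ k ∈ s, F k).e x = ∑ k ∈ s, (F k).e x :=
  map_sum (AddMonoidHom.mk' (fun a : BaseAlg K P => a.e x) fun _ _ => rfl) F s

theorem sum_α {ι : Type*} (s : Finset ι) (F : ι → BaseAlg K P) (x) :
    (∑ k ∈ s, F k).α x = ∑ k ∈ s, (F k).α x :=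
  map_sum (AddMonoidHom.mk' (fun a : BaseAlg K P => a.α x) fun _ _ => rfl) F s

variable [Fintype P]

theorem sum_idem : ∑ i : P, (idem i : BaseAlg K P) = 1 - e₀ := by
  ext x
  · rw [sum_e]
    cases x with
    | none => simp
    | some l =>
      rw [Finset.sum_eq_single l]
      · simp
      · intro k _ hk; simp [hk.symm]
      · simp
  · rw [sum_α]; simp

theorem idem_mul (i : P) (a : BaseAlg K P) :
    idem i * a = algebraMap K _ (a.e (some i)) * idem i := by
  ext x
  · by_cases hx : x = some i <;> simp [hx]
  · simp

theorem e₀_mul (a : BaseAlg K P) : e₀ * a = algebraMap K _ (a.e none) * e₀ +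
    ∑ i, algebraMap K _ (a.α i) * (arrow i * idem i) := by
  ext x
  · rw [add_e, sum_e]
    cases x <;> simp
  · rw [add_α, sum_α, Finset.sum_eq_single x]
    · simp
    · intro k _ hk; simp [hk.symm]
    · simp

theorem e₀_mul_arrow (i : P) : (e₀ * arrow i : BaseAlg K P) = arrow i := by
  ext x <;> simp

theorem e₀_mul_e₀ : (e₀ * e₀ : BaseAlg K P) = e₀ := by
  have h := e₀_mul (e₀ : BaseAlg K P)
  simpa using h

theorem idem_mul_idem (i : P) : (idem i * idem i : BaseAlg K P) = idem i := by
  have h := idem_mul i (idem i : BaseAlg K P)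
  simpa using h

end BaseAlg

/-! ### The right algebra -/

section Coefficients

variable {K : Type u} [Field K] {P : Type v} [PartialOrder P]

open Classical in
/-- The coefficient of `v_ij` in `ω b + w`, where `v_jj` stands for `ω e_j`; it is zero unless
`i ≤ j`. -/
noncomputable def vCoeff (i j : P) (u : UMod K P) : K :=
  if h : i < j then u.snd.c ⟨(i, j), h⟩ else if i = j then u.fst.e (some j) else 0

open Classical in
/-- The coefficient of `α_i v_ij` in `ω b + w` written in terms of the left multiples of `ω` and
of the `v_ij`, where `v_jj` stands for `e_j ω`; it is zero unless `i ≤ j`. The summand `b_{α_j}`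
comes from `ω α_j = α_j ω + ∑_{i < j} α_i v_ij`. -/
noncomputable def αvCoeff (i j : P) (u : UMod K P) : K :=
  if h : i < j then u.snd.d ⟨(i, j), h⟩ + u.fst.α j else if i = j then u.fst.α j else 0

theorem vCoeff_add (i j : P) (u u' : UMod K P) :
    vCoeff i j (u + u') = vCoeff i j u + vCoeff i j u' := by
  unfold vCoeff
  split_ifs <;> simp

theorem αvCoeff_add (i j : P) (u u' : UMod K P) :
    αvCoeff i j (u + u') = αvCoeff i j u + αvCoeff i j u' := by
  unfold αvCoeff
  split_ifs
  · simp; ring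
  · simp
  · simp

theorem vCoeff_smul (i j : P) (a : BaseAlg K P) (u : UMod K P) :
    vCoeff i j (a • u) = a.e (some i) * vCoeff i j u := by
  unfold vCoeff
  split_ifs with h h'
  · simp
  · simp [h']
  · simp

theorem αvCoeff_smul (i j : P) (a : BaseAlg K P) (u : UMod K P) :
    αvCoeff i j (a • u) = a.e none * αvCoeff i j u + a.α i * vCoeff i j u := by
  unfold αvCoeff vCoeff
  split_ifs with h h'
  · simp; ring
  · simp [h']
  · simp

theorem vCoeff_op_smul (i j : P) (a : BaseAlg K P) (u : UMod K P) :
    vCoeff i j (op a • u) = vCoeff i j u * a.e (some j) := by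
  unfold vCoeff
  split_ifs <;> simp

theorem αvCoeff_op_smul (i j : P) {a : BaseAlg K P} (ha : ∀ k, a.α k = 0) (u : UMod K P) :
    αvCoeff i j (op a • u) = αvCoeff i j u * a.e (some j) := by
  unfold αvCoeff
  split_ifs <;> simp [ha]
  ring

open Classical in
theorem vCoeff_ω (i j : P) : vCoeff i j (UMod.ω : UMod K P) = if i = j then 1 else 0 := by
  unfold vCoeff
  by_cases h : i < j
  · simp [h, h.ne]
  · simp [h]

theorem αvCoeff_ω (i j : P) : αvCoeff i j (UMod.ω : UMod K P) = 0 := by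
  unfold αvCoeff
  simp

open Classical in
theorem vCoeff_v (i j k l : P) (h : k < l) :
    vCoeff i j (UMod.inl (VMod.v k l : VMod K P)) = if i = k ∧ j = l then 1 else 0 := by
  unfold vCoeff
  by_cases hij : i < j
  · simp [hij, VMod.v]
  · by_cases h' : i = k ∧ j = l
    · exact absurd (h'.1 ▸ h'.2 ▸ h) hij
    · simp [hij, h']

theorem αvCoeff_v (i j k l : P) : αvCoeff i j (UMod.inl (VMod.v k l : VMod K P)) = 0 := by
  unfold αvCoeff
  simp [VMod.v]

theorem UMod.eq_op_smul_ω_add (u : UMod K P) : u = op u.fst • UMod.ω + UMod.inl u.snd := by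
  ext1 <;> simp

end Coefficients

section Right

open BalTensor

variable {K : Type u} [Field K] {P : Type v} [Fintype P] [PartialOrder P]

/-- An element of the right algebra is determined by its values on `ω` and on the `v_ij`. -/
theorem rightAlg_ext {f g : (posetBocs K P).RightAlg} (hω : f.hom UMod.ω = g.hom UMod.ω)
    (hv : ∀ i j, i < j → f.hom (UMod.inl (VMod.v i j)) = g.hom (UMod.inl (VMod.v i j))) :
    f = g := by
  have hw : ∀ w, f.hom (UMod.inl w) = g.hom (UMod.inl w) := fun w => by
    rw [← sum_coeff w]
    simp only [map_sum, map_smul]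
    refine Finset.sum_congr rfl fun i _ => Finset.sum_congr rfl fun j _ => ?_
    by_cases h : i < j
    · rw [hv i j h]
    · rw [v_eq_zero h, map_zero, map_zero, map_zero]
  refine Bocs.RightAlg.ext fun u => ?_
  have hu : u = u.fst • UMod.ω - UMod.inl (d₀ u.fst) + UMod.inl u.snd := by
    rw [smul_ω, add_sub_cancel_right]
    exact UMod.eq_op_smul_ω_add u
  rw [hu]
  simp only [map_add, map_sub, map_smul, hω, hw]

theorem mul_toRight_hom (f : (posetBocs K P).RightAlg) (z : BaseAlg K P) (u : UMod K P) :
    (f * (posetBocs K P).toRight z).hom u = f.hom u * z := by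
  conv_rhs => rw [← mul_one f]
  rfl

theorem rightAlg_one_hom (u : UMod K P) : (1 : (posetBocs K P).RightAlg).hom u = u.fst := rfl

theorem rightAlg_add_hom (f g : (posetBocs K P).RightAlg) (u : UMod K P) :
    (f + g).hom u = f.hom u + g.hom u := rfl

theorem rightAlg_sub_hom (f g : (posetBocs K P).RightAlg) (u : UMod K P) :
    (f - g).hom u = f.hom u - g.hom u := rfl

theorem toRight_hom' (z : BaseAlg K P) (u : UMod K P) :
    ((posetBocs K P).toRight z).hom u = u.fst * z := rfl

theorem rightAlg_mul_ω (f g : (posetBocs K P).RightAlg) :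
    (f * g).hom UMod.ω = g.hom (op (f.hom UMod.ω) • UMod.ω) := by
  rw [Bocs.RightAlg.mul_hom]
  change g.hom (contractRight f.hom (UMod.comul UMod.ω)) = _
  rw [comul_ω, contractRight_tmul]

theorem rightAlg_mul_v (f g : (posetBocs K P).RightAlg) (i j : P) :
    (f * g).hom (UMod.inl (VMod.v i j)) =
      ∑ k, g.hom (op (f.hom (UMod.inl (VMod.v k j))) • UMod.inl (VMod.v i k)) +
        g.hom (op (f.hom (UMod.inl (VMod.v i j))) • UMod.ω) +
          g.hom (op (f.hom UMod.ω) • UMod.inl (VMod.v i j)) := by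
  rw [Bocs.RightAlg.mul_hom]
  change g.hom (contractRight f.hom (UMod.comul _)) = _
  rw [comul_inl_v]
  simp only [map_add, map_sum, contractRight_tmul]

variable [DecidableEq P]

/-- The embedding of `KP` into the right algebra: the matrix `b` is sent to the left linear map with
`ω ↦ ∑ b_jj e_j` and `v_ij ↦ b_ji e_i`. -/
noncomputable def rightEmb (b : incidence K P) : (posetBocs K P).RightAlg :=
  show UMod K P →ₗ[BaseAlg K P] BaseAlg K P from
  { toFun := fun u => BaseAlg.mk (fun x => x.elim 0 fun i => ∑ j, b.1 j i * vCoeff i j u)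
      (fun i => ∑ j, b.1 j i * αvCoeff i j u)
    map_add' := fun u u' => by
      ext x
      · cases x <;> simp [vCoeff_add, mul_add, Finset.sum_add_distrib]
      · simp [αvCoeff_add, mul_add, Finset.sum_add_distrib]
    map_smul' := fun a u => by
      ext x
      · cases x
        · simp
        · simp only [BaseAlg.mk_e, Option.elim, RingHom.id_apply, smul_eq_mul, BaseAlg.mul_e,
            vCoeff_smul, Finset.mul_sum]
          exact Finset.sum_congr rfl fun j _ => by ring
      · simp only [BaseAlg.mk_e, BaseAlg.mk_α, Option.elim, RingHom.id_apply, smul_eq_mul,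
          BaseAlg.mul_α, αvCoeff_smul, Finset.mul_sum, ← Finset.sum_add_distrib]
        exact Finset.sum_congr rfl fun j _ => by ring }

theorem rightEmb_e_none (b : incidence K P) (u : UMod K P) :
    ((rightEmb b).hom u).e none = 0 := rfl

theorem rightEmb_e_some (b : incidence K P) (u : UMod K P) (i : P) :
    ((rightEmb b).hom u).e (some i) = ∑ j, b.1 j i * vCoeff i j u := rfl

theorem rightEmb_α (b : incidence K P) (u : UMod K P) (i : P) :
    ((rightEmb b).hom u).α i = ∑ j, b.1 j i * αvCoeff i j u := rfl

theorem rightEmb_ω_e (b : incidence K P) (i : P) :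
    ((rightEmb b).hom UMod.ω).e (some i) = b.1 i i := by
  simp [rightEmb_e_some, vCoeff_ω]

theorem rightEmb_ω_α (b : incidence K P) (i : P) :
    ((rightEmb b).hom UMod.ω).α i = 0 := by
  simp [rightEmb_α, αvCoeff_ω]

theorem rightEmb_v_e (b : incidence K P) {i j : P} (h : i < j) (l : P) :
    ((rightEmb b).hom (UMod.inl (VMod.v i j))).e (some l) = if l = i then b.1 j i else 0 := by
  rw [rightEmb_e_some, Finset.sum_eq_single j]
  · by_cases hl : l = i <;> simp [vCoeff_v _ _ _ _ h, hl]
  · intro k _ hk; simp [vCoeff_v _ _ _ _ h, hk]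
  · simp

theorem rightEmb_v_α (b : incidence K P) (i j l : P) :
    ((rightEmb b).hom (UMod.inl (VMod.v i j))).α l = 0 := by
  simp [rightEmb_α, αvCoeff_v]

theorem rightEmb_add (b c : incidence K P) : rightEmb (b + c) = rightEmb b + rightEmb c := by
  refine rightAlg_ext ?_ fun i j h => ?_ <;> rw [rightAlg_add_hom]
  · ext x
    · cases x <;> simp [rightEmb_e_none, rightEmb_ω_e, incidence_add_apply]
    · simp [rightEmb_ω_α]
  · ext x
    · cases x with
      | none => simp [rightEmb_e_none]
      | some l =>
        by_cases hl : l = i <;> simp [rightEmb_v_e _ h, incidence_add_apply, hl]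
    · simp [rightEmb_v_α]

theorem rightEmb_op_smul_e (b : incidence K P) (a : BaseAlg K P) (u : UMod K P) (i : P) :
    ((rightEmb b).hom (op a • u)).e (some i) = ∑ j, b.1 j i * (vCoeff i j u * a.e (some j)) := by
  simp only [rightEmb_e_some, vCoeff_op_smul]

theorem rightEmb_op_smul_ω_e (b : incidence K P) (a : BaseAlg K P) (i : P) :
    ((rightEmb b).hom (op a • UMod.ω)).e (some i) = b.1 i i * a.e (some i) := by
  rw [rightEmb_op_smul_e]
  simp [vCoeff_ω]

theorem rightEmb_op_smul_v_e (b : incidence K P) (a : BaseAlg K P) {i j : P} (h : i < j) (l : P) :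
    ((rightEmb b).hom (op a • UMod.inl (VMod.v i j))).e (some l) =
      if l = i then b.1 j i * a.e (some j) else 0 := by
  rw [rightEmb_op_smul_e, Finset.sum_eq_single j]
  · by_cases hl : l = i <;> simp [vCoeff_v _ _ _ _ h, hl]
  · intro k _ hk; simp [vCoeff_v _ _ _ _ h, hk]
  · simp

theorem rightEmb_op_smul_α (b : incidence K P) {a : BaseAlg K P} (ha : ∀ k, a.α k = 0)
    {u : UMod K P} (hu : ∀ i j, αvCoeff i j u = 0) (l : P) :
    ((rightEmb b).hom (op a • u)).α l = 0 := by
  simp [rightEmb_α, αvCoeff_op_smul _ _ ha, hu]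

/-- An entry of a product of matrices in `KP` with the two extreme summands split off. -/
theorem incidence_mul_apply_of_lt (b c : incidence K P) {i j : P} (h : i < j) :
    (b * c).1 j i = (∑ k, if i ≠ k ∧ k ≠ j then b.1 j k * c.1 k i else 0) + b.1 j i * c.1 i i +
      b.1 j j * c.1 j i := by
  rw [incidence_mul_apply, ← Finset.add_sum_erase _ _ (Finset.mem_univ i),
    ← Finset.add_sum_erase _ _ (show j ∈ Finset.univ.erase i by simp [h.ne']),
    ← Finset.sum_filter]
  have : (Finset.univ.erase i).erase j = Finset.univ.filter fun k => i ≠ k ∧ k ≠ j := by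
    ext k; simp only [Finset.mem_erase, Finset.mem_univ, Finset.mem_filter]; tauto
  rw [this]
  ring

theorem incidence_mul_apply_self (b c : incidence K P) (i : P) :
    (b * c).1 i i = b.1 i i * c.1 i i := map_mul (diagHom K i) b c

theorem rightEmb_mul (b c : incidence K P) : rightEmb (b * c) = rightEmb b * rightEmb c := by
  classical
  refine rightAlg_ext ?_ fun i j h => ?_
  · rw [rightAlg_mul_ω]
    ext x
    · cases x with
      | none => simp [rightEmb_e_none]
      | some l =>
        rw [rightEmb_ω_e, rightEmb_op_smul_ω_e, rightEmb_ω_e, incidence_mul_apply_self, mul_comm]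
    · rw [rightEmb_ω_α, rightEmb_op_smul_α _ (rightEmb_ω_α b) αvCoeff_ω]
  · rw [rightAlg_mul_v]
    ext x
    · rw [BaseAlg.add_e, BaseAlg.add_e, BaseAlg.sum_e]
      cases x with
      | none => simp [rightEmb_e_none]
      | some l =>
        rw [rightEmb_v_e _ h, rightEmb_op_smul_ω_e, rightEmb_v_e _ h, rightEmb_op_smul_v_e _ _ h,
          rightEmb_ω_e]
        by_cases hl : l = i
        · subst hl
          rw [if_pos rfl, if_pos rfl, if_pos rfl, incidence_mul_apply_of_lt b c h,
            mul_comm (c.1 l l), mul_comm (c.1 j l)]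
          congr 2
          refine Finset.sum_congr rfl fun k _ => ?_
          by_cases hlk : l < k
          · rw [rightEmb_op_smul_v_e _ _ hlk, if_pos rfl]
            by_cases hkj : k < j
            · rw [rightEmb_v_e _ hkj, if_pos rfl, if_pos ⟨hlk.ne, hkj.ne⟩, mul_comm]
            · rw [v_eq_zero hkj, map_zero, map_zero, BaseAlg.zero_e, mul_zero]
              split_ifs with h1
              · rw [incidence_apply_eq_zero b fun h2 => hkj (lt_of_le_of_ne h2 h1.2), zero_mul]
              · rfl
          · rw [v_eq_zero hlk, map_zero, smul_zero, map_zero, BaseAlg.zero_e]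
            split_ifs with h1
            · rw [incidence_apply_eq_zero c fun h2 => hlk (lt_of_le_of_ne h2 h1.1), mul_zero]
            · rfl
        · rw [if_neg hl, if_neg hl, if_neg hl, mul_zero, add_zero, add_zero,
            Finset.sum_eq_zero fun k _ => ?_]
          by_cases hik : i < k
          · rw [rightEmb_op_smul_v_e _ _ hik, if_neg hl]
          · rw [v_eq_zero hik, map_zero, smul_zero, map_zero, BaseAlg.zero_e]
    · rw [BaseAlg.add_α, BaseAlg.add_α, BaseAlg.sum_α, rightEmb_v_α,
        rightEmb_op_smul_α _ (rightEmb_v_α b i j) αvCoeff_ω,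
        rightEmb_op_smul_α _ (rightEmb_ω_α b) (fun _ _ => αvCoeff_v _ _ _ _),
        Finset.sum_eq_zero fun k _ => rightEmb_op_smul_α _ (rightEmb_v_α b k j)
          (fun _ _ => αvCoeff_v _ _ _ _) _, add_zero, add_zero]

theorem rightEmb_one : rightEmb (1 : incidence K P) = 1 - (posetBocs K P).toRight BaseAlg.e₀ := by
  refine rightAlg_ext ?_ fun i j h => ?_ <;>
    rw [rightAlg_sub_hom, rightAlg_one_hom, toRight_hom']
  · ext x
    · cases x <;> simp [rightEmb_e_none, rightEmb_ω_e]
    · simp [rightEmb_ω_α]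
  · ext x
    · cases x with
      | none => simp [rightEmb_e_none]
      | some l => simp [rightEmb_v_e _ h, h.ne']
    · simp [rightEmb_v_α]

open Classical in
/-- The matrix with entries `f(v_ij)_i`, where `v_jj` stands for `ω e_j`. -/
noncomputable def rightMat (f : (posetBocs K P).RightAlg) : incidence K P :=
  ⟨fun j i => if i < j then (f.hom (UMod.inl (VMod.v i j))).e (some i) else
    if i = j then (f.hom UMod.ω).e (some i) else 0, fun j i h => by
      by_contra hij
      simp [show ¬ i < j from fun h => hij h.le, show ¬ i = j from fun h => hij h.le] at h⟩

theorem rightMat_of_lt (f : (posetBocs K P).RightAlg) {i j : P} (h : i < j) :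
    (rightMat f).1 j i = (f.hom (UMod.inl (VMod.v i j))).e (some i) := if_pos h

theorem rightMat_self (f : (posetBocs K P).RightAlg) (i : P) :
    (rightMat f).1 i i = (f.hom UMod.ω).e (some i) :=
  (if_neg (lt_irrefl i)).trans (if_pos rfl)

theorem rightMat_rightEmb (b : incidence K P) : rightMat (rightEmb b) = b := by
  refine incidence_ext fun i j => ?_
  by_cases h : i ≤ j
  · rcases h.lt_or_eq with h | rfl
    · rw [rightMat_of_lt _ h, rightEmb_v_e _ h, if_pos rfl]
    · rw [rightMat_self, rightEmb_ω_e]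
  · rw [incidence_apply_eq_zero _ h, incidence_apply_eq_zero _ h]

/-- `R = e₀ A ⊕ KP`. -/
theorem rightAlg_eq (f : (posetBocs K P).RightAlg) :
    f = (posetBocs K P).toRight (BaseAlg.e₀ * f.hom UMod.ω) + rightEmb (rightMat f) := by
  classical
  refine rightAlg_ext ?_ fun i j h => ?_ <;> rw [rightAlg_add_hom, toRight_hom']
  · ext x
    · cases x <;> simp [rightEmb_e_none, rightEmb_ω_e, rightMat_self]
    · simp [rightEmb_ω_α]
  · have hE : (BaseAlg.idem i : BaseAlg K P) • (UMod.inl (VMod.v i j : VMod K P)) =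
        UMod.inl (VMod.v i j) := by
      rw [← map_smul]
      congr 1
      ext r
      · by_cases hr : r.1 = (i, j) <;> simp [VMod.v, hr]
      · simp [VMod.v]
    rw [← hE, map_smul, map_smul, UMod.smul_fst, UMod.inl_fst, mul_zero, zero_mul, zero_add,
      smul_eq_mul, smul_eq_mul]
    ext x
    · cases x with
      | none => simp
      | some l =>
        by_cases hl : l = i <;> simp [hl, rightEmb_v_e _ h, rightMat_of_lt _ h]
    · simp [rightEmb_v_α]

end Right

/-! ### The left algebra -/

section Left

open BalTensor

variable {K : Type u} [Field K] {P : Type v} [Fintype P] [PartialOrder P]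

/-- An element of the left algebra is determined by its values on `ω`, on the `v_ij` and on the
`α_i v_ij`. -/
theorem leftAlg_ext {f g : (posetBocs K P).LeftAlg} (hω : f.hom UMod.ω = g.hom UMod.ω)
    (hv : ∀ i j : P, i < j → f.hom (UMod.inl (VMod.v i j)) = g.hom (UMod.inl (VMod.v i j)))
    (hα : ∀ i j : P, i < j →
      f.hom ((BaseAlg.arrow i : BaseAlg K P) • UMod.inl (VMod.v i j)) =
        g.hom ((BaseAlg.arrow i : BaseAlg K P) • UMod.inl (VMod.v i j))) :
    f = g := by
  have hw : ∀ w, f.hom (UMod.inl w) = g.hom (UMod.inl w) := fun w => by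
    rw [← sum_coeff w]
    simp only [map_sum]
    refine Finset.sum_congr rfl fun i _ => Finset.sum_congr rfl fun j _ => ?_
    by_cases h : i < j
    · have e : UMod.inl (coeff i j w • VMod.v i j) =
          op (algebraMap K (BaseAlg K P) ((coeff i j w).e (some i))) •
            (UMod.inl (VMod.v i j) : UMod K P) +
          op (algebraMap K (BaseAlg K P) ((coeff i j w).α i)) •
            (BaseAlg.arrow i : BaseAlg K P) • (UMod.inl (VMod.v i j) : UMod K P) := by
        ext1
        · simp
        · ext r
          · by_cases hr : r.1 = (i, j) <;> simp [h, VMod.v, hr]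
          · by_cases hr : r.1 = (i, j) <;> simp [h, VMod.v, hr]
      rw [e, map_add, map_add, map_smul f.hom, map_smul f.hom, map_smul g.hom,
        map_smul g.hom, hv i j h, hα i j h]
    · rw [v_eq_zero h, smul_zero, map_zero, map_zero, map_zero]
  refine Bocs.LeftAlg.ext fun u => ?_
  rw [UMod.eq_op_smul_ω_add u, map_add, map_add, map_smul, map_smul, hω, hw]

theorem toLeft_mul_hom (z : BaseAlg K P) (f : (posetBocs K P).LeftAlg) (u : UMod K P) :
    ((posetBocs K P).toLeft z * f).hom u = z * f.hom u := by
  conv_rhs => rw [← one_mul f]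
  rfl

theorem mul_toLeft_hom (f : (posetBocs K P).LeftAlg) (z : BaseAlg K P) (u : UMod K P) :
    (f * (posetBocs K P).toLeft z).hom u = f.hom (z • u) := by
  rw [Bocs.LeftAlg.mul_hom, Bocs.contractLeft_mul _ _ z u fun _ => rfl]

theorem leftAlg_one_hom (u : UMod K P) : (1 : (posetBocs K P).LeftAlg).hom u = u.fst := rfl

theorem leftAlg_add_hom (f g : (posetBocs K P).LeftAlg) (u : UMod K P) :
    (f + g).hom u = f.hom u + g.hom u := rfl

theorem leftAlg_sub_hom (f g : (posetBocs K P).LeftAlg) (u : UMod K P) :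
    (f - g).hom u = f.hom u - g.hom u := rfl

theorem leftAlg_zero_hom (u : UMod K P) : (0 : (posetBocs K P).LeftAlg).hom u = 0 := rfl

theorem leftAlg_sum_hom {ι : Type*} (s : Finset ι) (F : ι → (posetBocs K P).LeftAlg)
    (u : UMod K P) : (∑ k ∈ s, F k).hom u = ∑ k ∈ s, (F k).hom u :=
  map_sum (AddMonoidHom.mk' (fun f : (posetBocs K P).LeftAlg => f.hom u) fun _ _ => rfl) F s

theorem toLeft_hom' (z : BaseAlg K P) (u : UMod K P) :
    ((posetBocs K P).toLeft z).hom u = z * u.fst := rfl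

theorem leftAlg_mul_ω (f g : (posetBocs K P).LeftAlg) :
    (f * g).hom UMod.ω = f.hom (g.hom UMod.ω • UMod.ω) := by
  rw [Bocs.LeftAlg.mul_hom]
  change f.hom (contractLeft g.hom (UMod.comul UMod.ω)) = _
  rw [comul_ω, contractLeft_tmul]

theorem leftAlg_mul_v (f g : (posetBocs K P).LeftAlg) (i j : P) :
    (f * g).hom (UMod.inl (VMod.v i j)) =
      ∑ k, f.hom (g.hom (UMod.inl (VMod.v i k)) • UMod.inl (VMod.v k j)) +
        f.hom (g.hom UMod.ω • UMod.inl (VMod.v i j)) +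
          f.hom (g.hom (UMod.inl (VMod.v i j)) • UMod.ω) := by
  rw [Bocs.LeftAlg.mul_hom]
  change f.hom (contractLeft g.hom (UMod.comul _)) = _
  rw [comul_inl_v]
  simp only [map_add, map_sum, contractLeft_tmul]

variable [DecidableEq P]

/-- The embedding of `KP` into the left algebra: the matrix `b` is sent to the right linear map with
`ω ↦ ∑ b_jj e_j`, `v_ij ↦ b_ji e_j` and `α_i v_ij ↦ 0`. -/
noncomputable def leftEmb (b : incidence K P) : (posetBocs K P).LeftAlg :=
  show UMod K P →ₗ[(BaseAlg K P)ᵐᵒᵖ] BaseAlg K P from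
  { toFun := fun u => BaseAlg.mk (fun x => x.elim 0 fun j => ∑ i, b.1 j i * vCoeff i j u)
      (fun _ => 0)
    map_add' := fun u u' => by
      ext x
      · cases x <;> simp [vCoeff_add, mul_add, Finset.sum_add_distrib]
      · simp
    map_smul' := fun a u => by
      obtain ⟨a, rfl⟩ := MulOpposite.op_surjective a
      rw [RingHom.id_apply, op_smul_eq_mul]
      ext x
      · cases x
        · simp
        · simp only [BaseAlg.mk_e, Option.elim, BaseAlg.mul_e, vCoeff_op_smul, Finset.sum_mul]
          exact Finset.sum_congr rfl fun j _ => by ring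
      · simp }

theorem leftEmb_e_none (b : incidence K P) (u : UMod K P) :
    ((leftEmb b).hom u).e none = 0 := rfl

theorem leftEmb_e_some (b : incidence K P) (u : UMod K P) (j : P) :
    ((leftEmb b).hom u).e (some j) = ∑ i, b.1 j i * vCoeff i j u := rfl

theorem leftEmb_α (b : incidence K P) (u : UMod K P) (i : P) :
    ((leftEmb b).hom u).α i = 0 := rfl

theorem leftEmb_smul_ω_e (b : incidence K P) (a : BaseAlg K P) (j : P) :
    ((leftEmb b).hom (a • UMod.ω)).e (some j) = b.1 j j * a.e (some j) := by
  simp [leftEmb_e_some, vCoeff_ω, vCoeff_smul]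

open Classical in
theorem leftEmb_smul_v_e (b : incidence K P) (a : BaseAlg K P) {i j : P} (h : i < j) (l : P) :
    ((leftEmb b).hom (a • UMod.inl (VMod.v i j))).e (some l) =
      if l = j then b.1 j i * a.e (some i) else 0 := by
  rw [leftEmb_e_some, Finset.sum_eq_single i]
  · by_cases hl : l = j <;> simp [vCoeff_smul, vCoeff_v _ _ _ _ h, hl]
  · intro k _ hk; simp [vCoeff_smul, vCoeff_v _ _ _ _ h, hk]
  · simp

theorem leftEmb_ω_e (b : incidence K P) (j : P) :
    ((leftEmb b).hom UMod.ω).e (some j) = b.1 j j := by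
  rw [← one_smul (BaseAlg K P) UMod.ω, leftEmb_smul_ω_e, BaseAlg.one_e, mul_one]

open Classical in
theorem leftEmb_v_e (b : incidence K P) {i j : P} (h : i < j) (l : P) :
    ((leftEmb b).hom (UMod.inl (VMod.v i j))).e (some l) = if l = j then b.1 j i else 0 := by
  rw [← one_smul (BaseAlg K P) (UMod.inl _), leftEmb_smul_v_e _ _ h, BaseAlg.one_e, mul_one]

theorem leftEmb_arrow (b : incidence K P) (i : P) (u : UMod K P) :
    (leftEmb b).hom ((BaseAlg.arrow i : BaseAlg K P) • u) = 0 := by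
  ext x
  · cases x <;> simp [leftEmb_e_none, leftEmb_e_some, vCoeff_smul]
  · simp [leftEmb_α]

theorem leftEmb_add (b c : incidence K P) : leftEmb (b + c) = leftEmb b + leftEmb c := by
  refine Bocs.LeftAlg.ext fun u => ?_
  rw [leftAlg_add_hom]
  ext x
  · cases x <;>
      simp [leftEmb_e_none, leftEmb_e_some, incidence_add_apply, add_mul, Finset.sum_add_distrib]
  · simp [leftEmb_α]

theorem leftEmb_mul (b c : incidence K P) : leftEmb (b * c) = leftEmb b * leftEmb c := by
  classical
  refine leftAlg_ext ?_ (fun i j h => ?_) (fun i j h => ?_)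
  · rw [leftAlg_mul_ω]
    ext x
    · cases x with
      | none => simp [leftEmb_e_none]
      | some l =>
        rw [leftEmb_ω_e, leftEmb_smul_ω_e, leftEmb_ω_e, incidence_mul_apply_self]
    · rw [leftEmb_α, leftEmb_α]
  · rw [leftAlg_mul_v]
    ext x
    · rw [BaseAlg.add_e, BaseAlg.add_e, BaseAlg.sum_e]
      cases x with
      | none => simp [leftEmb_e_none]
      | some l =>
        rw [leftEmb_v_e _ h, leftEmb_smul_ω_e, leftEmb_v_e _ h, leftEmb_smul_v_e _ _ h,
          leftEmb_ω_e]
        by_cases hl : l = j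
        · subst hl
          rw [if_pos rfl, if_pos rfl, if_pos rfl, incidence_mul_apply_of_lt b c h]
          congr 2
          refine Finset.sum_congr rfl fun k _ => ?_
          by_cases hkl : k < l
          · rw [leftEmb_smul_v_e _ _ hkl, if_pos rfl]
            by_cases hik : i < k
            · rw [leftEmb_v_e _ hik, if_pos rfl, if_pos ⟨hik.ne, hkl.ne⟩]
            · rw [v_eq_zero hik, map_zero, map_zero, BaseAlg.zero_e, mul_zero]
              split_ifs with h1
              · rw [incidence_apply_eq_zero c fun h2 => hik (lt_of_le_of_ne h2 h1.1), mul_zero]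
              · rfl
          · rw [v_eq_zero hkl, map_zero, smul_zero, map_zero, BaseAlg.zero_e]
            split_ifs with h1
            · rw [incidence_apply_eq_zero b fun h2 => hkl (lt_of_le_of_ne h2 h1.2), zero_mul]
            · rfl
        · rw [if_neg hl, if_neg hl, if_neg hl, mul_zero, add_zero, add_zero,
            Finset.sum_eq_zero fun k _ => ?_]
          by_cases hkj : k < j
          · rw [leftEmb_smul_v_e _ _ hkj, if_neg hl]
          · rw [v_eq_zero hkj, map_zero, smul_zero, map_zero, BaseAlg.zero_e]
    · rw [BaseAlg.add_α, BaseAlg.add_α, BaseAlg.sum_α]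
      simp [leftEmb_α]
  · have h0 : leftEmb c * (posetBocs K P).toLeft (BaseAlg.arrow i) = 0 :=
      Bocs.LeftAlg.ext fun u => by rw [mul_toLeft_hom, leftEmb_arrow]; rfl
    rw [leftEmb_arrow, ← mul_toLeft_hom, mul_assoc, h0, mul_zero]
    rfl

theorem leftEmb_one : leftEmb (1 : incidence K P) = 1 - (posetBocs K P).toLeft BaseAlg.e₀ := by
  refine leftAlg_ext ?_ (fun i j h => ?_) (fun i j h => ?_) <;>
    rw [leftAlg_sub_hom, leftAlg_one_hom, toLeft_hom']
  · ext x
    · cases x <;> simp [leftEmb_e_none, leftEmb_ω_e]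
    · simp [leftEmb_α]
  · ext x
    · cases x with
      | none => simp [leftEmb_e_none]
      | some l => simp [leftEmb_v_e _ h, h.ne']
    · simp [leftEmb_α]
  · rw [leftEmb_arrow]; simp

open Classical in
/-- The matrix with entries `f(v_ij)_j`, where `v_jj` stands for `ω e_j`. -/
noncomputable def leftMat (f : (posetBocs K P).LeftAlg) : incidence K P :=
  ⟨fun j i => if i < j then (f.hom (UMod.inl (VMod.v i j))).e (some j) else
    if i = j then (f.hom UMod.ω).e (some j) else 0, fun j i h => by
      by_contra hij
      simp [show ¬ i < j from fun h => hij h.le, show ¬ i = j from fun h => hij h.le] at h⟩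

theorem leftMat_of_lt (f : (posetBocs K P).LeftAlg) {i j : P} (h : i < j) :
    (leftMat f).1 j i = (f.hom (UMod.inl (VMod.v i j))).e (some j) := if_pos h

theorem leftMat_self (f : (posetBocs K P).LeftAlg) (i : P) :
    (leftMat f).1 i i = (f.hom UMod.ω).e (some i) :=
  (if_neg (lt_irrefl i)).trans (if_pos rfl)

theorem leftMat_leftEmb (b : incidence K P) : leftMat (leftEmb b) = b := by
  refine incidence_ext fun i j => ?_
  by_cases h : i ≤ j
  · rcases h.lt_or_eq with h | rfl
    · rw [leftMat_of_lt _ h, leftEmb_v_e _ h, if_pos rfl]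
    · rw [leftMat_self, leftEmb_ω_e]
  · rw [incidence_apply_eq_zero _ h, incidence_apply_eq_zero _ h]

theorem v_op_smul_idem (i j : P) :
    op (BaseAlg.idem j : BaseAlg K P) • (UMod.inl (VMod.v i j) : UMod K P) =
      UMod.inl (VMod.v i j) := by
  rw [← inl_op_smul, op_smul_v]
  simp

theorem hom_v_eq_mul_idem (f : (posetBocs K P).LeftAlg) (i j : P) :
    f.hom (UMod.inl (VMod.v i j)) * BaseAlg.idem j = f.hom (UMod.inl (VMod.v i j)) := by
  rw [← op_smul_eq_mul, ← map_smul, v_op_smul_idem]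

/-- An element of the corner `(1 - e₀) L (1 - e₀)` comes from `KP`. -/
theorem leftEmb_leftMat {f : (posetBocs K P).LeftAlg} (hl : leftEmb 1 * f = f)
    (hr : f * leftEmb 1 = f) : leftEmb (leftMat f) = f := by
  have hl' : ∀ u, (1 - BaseAlg.e₀) * f.hom u = f.hom u := fun u => by
    conv_rhs => rw [← hl, leftEmb_one, ← map_one (posetBocs K P).toLeft, ← map_sub,
      toLeft_mul_hom]
  have hr' : ∀ u, f.hom ((1 - BaseAlg.e₀ : BaseAlg K P) • u) = f.hom u := fun u => by
    conv_rhs => rw [← hr, leftEmb_one, ← map_one (posetBocs K P).toLeft, ← map_sub,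
      mul_toLeft_hom]
  refine leftAlg_ext ?_ (fun i j h => ?_) (fun i j h => ?_)
  · rw [← hl']
    ext x
    · cases x <;> simp [leftEmb_e_none, leftEmb_ω_e, leftMat_self]
    · simp [leftEmb_α]
  · rw [← hl', ← hom_v_eq_mul_idem f]
    ext x
    · cases x with
      | none => simp [leftEmb_e_none]
      | some l =>
        by_cases hl : l = j <;> simp [leftEmb_v_e _ h, leftMat_of_lt _ h, hl]
    · simp [leftEmb_α]
  · rw [leftEmb_arrow, ← hr', ← mul_smul]
    have : (1 - BaseAlg.e₀ : BaseAlg K P) * BaseAlg.arrow i = 0 := by ext <;> simp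
    rw [this, zero_smul, map_zero]

/-- The element `v_ij` of `U`, where `v_jj` stands for `ω e_j`. -/
noncomputable def vElt (K : Type u) [Field K] (i j : P) : UMod K P :=
  if i = j then op (BaseAlg.idem j : BaseAlg K P) • UMod.ω else UMod.inl (VMod.v i j)

/-- The element `r_ij` of the left algebra, for `i < j`: the right linear map dual to `α_i v_ij`,
with value `e_j`. -/
noncomputable def leftDual (i j : P) (h : i < j) : (posetBocs K P).LeftAlg :=
  show UMod K P →ₗ[(BaseAlg K P)ᵐᵒᵖ] BaseAlg K P from
  { toFun := fun u => algebraMap K _ (u.snd.d ⟨(i, j), h⟩) * BaseAlg.idem j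
    map_add' := fun u u' => by rw [UMod.add_snd, VMod.add_d, map_add, add_mul]
    map_smul' := fun a u => by
      obtain ⟨a, rfl⟩ := MulOpposite.op_surjective a
      rw [RingHom.id_apply, op_smul_eq_mul]
      ext x
      · by_cases hx : x = some j <;> simp [hx]
      · simp }

theorem leftDual_hom (i j : P) (h : i < j) (u : UMod K P) :
    (leftDual i j h).hom u = algebraMap K _ (u.snd.d ⟨(i, j), h⟩) * BaseAlg.idem j := rfl

theorem toLeft_idem (i : P) : (posetBocs K P).toLeft (BaseAlg.idem i) = leftEmb (unit K i i) := by
  refine Bocs.LeftAlg.ext fun u => ?_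
  rw [toLeft_hom']
  ext x
  · cases x with
    | none => simp [leftEmb_e_none]
    | some l =>
      rw [leftEmb_e_some, Finset.sum_eq_single i]
      · by_cases hl : l = i <;> simp [unit_apply, vCoeff, hl]
      · intro k _ hk; simp [unit_apply, hk]
      · simp
  · simp [leftEmb_α]

/-- The relations between the `r_ij` and the arrows: `r_ij α_i = p_ij`, `r_ij α_j = -e_j` and
`r_ij α_l = 0` otherwise. The second one reflects the term `-α_i v_ij` of `δ(α_j)`. -/
theorem leftDual_mul_arrow (i j : P) (h : i < j) (l : P) :
    leftDual i j h * (posetBocs K P).toLeft (BaseAlg.arrow l) =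
      (if l = i then leftEmb (unit K i j) else 0) -
        (if l = j then leftEmb (unit K j j) else 0) := by
  have key : ∀ u : UMod K P, ((leftEmb (unit K i j)).hom u) =
      algebraMap K _ (u.snd.c ⟨(i, j), h⟩) * BaseAlg.idem j := fun u => by
    ext x
    · cases x with
      | none => simp [leftEmb_e_none]
      | some l =>
        rw [leftEmb_e_some, Finset.sum_eq_single i]
        · by_cases hl : l = j <;> simp [unit_apply, vCoeff, hl, h, h.le]
        · intro k _ hk; simp [unit_apply, hk]
        · simp
    · simp [leftEmb_α]
  refine Bocs.LeftAlg.ext fun u => ?_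
  have e : ((if l = i then leftEmb (unit K i j) else 0) -
        (if l = j then leftEmb (unit K j j) else 0) : (posetBocs K P).LeftAlg).hom u =
      (if l = i then (leftEmb (unit K i j)).hom u else 0) -
        (if l = j then (leftEmb (unit K j j)).hom u else 0) := by
    rw [leftAlg_sub_hom]
    split_ifs <;> rfl
  rw [e, mul_toLeft_hom, leftDual_hom, key, ← toLeft_idem, toLeft_hom']
  ext x
  · by_cases h1 : l = i
    · subst h1
      by_cases hx : x = some j <;> simp [hx, h.ne, h.ne']
    · by_cases h2 : l = j
      · subst h2
        by_cases hx : x = some l <;> simp [hx, h1, Ne.symm h1]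
      · by_cases hx : x = some j <;> simp [hx, h1, h2, Ne.symm h1, Ne.symm h2]
  · by_cases h1 : l = i
    · subst h1
      simp [h.ne]
    · by_cases h2 : l = j
      · subst h2
        simp [h1]
      · simp [h1, h2]

theorem leftEmb_unit_ω (i j : P) :
    (leftEmb (unit K i j)).hom UMod.ω = if i = j then BaseAlg.idem j else 0 := by
  ext x
  · cases x with
    | none => by_cases h : i = j <;> simp [leftEmb_e_none, h]
    | some l =>
      rw [leftEmb_ω_e, unit_apply]
      by_cases h : i = j
      · by_cases hl : l = j <;> simp [h, hl]
      · rw [if_neg h, if_neg, BaseAlg.zero_e]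
        rintro ⟨rfl, rfl, -⟩
        exact h rfl
  · rw [leftEmb_α]
    split_ifs <;> rfl

theorem leftEmb_unit_v (i j : P) {k l : P} (h : k < l) :
    (leftEmb (unit K i j)).hom (UMod.inl (VMod.v k l)) =
      if i = k ∧ j = l then BaseAlg.idem l else 0 := by
  ext x
  · cases x with
    | none => by_cases h' : i = k ∧ j = l <;> simp [leftEmb_e_none, h']
    | some m =>
      rw [leftEmb_v_e _ h, unit_apply]
      by_cases h' : i = k ∧ j = l
      · obtain ⟨rfl, rfl⟩ := h'
        by_cases hm : m = j <;> simp [hm, h.le]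
      · have h'' : ¬ (l = j ∧ k = i ∧ i ≤ j) := fun hh => h' ⟨hh.2.1.symm, hh.1.symm⟩
        rw [if_neg h', BaseAlg.zero_e, if_neg h'', ite_self]
  · rw [leftEmb_α]
    split_ifs <;> rfl

open Classical in
/-- The left algebra is generated, as a left `A`-module, by the `p_ij`, the `r_ij` and `e₀`. -/
theorem leftAlg_eq_sum (f : (posetBocs K P).LeftAlg) :
    f = ∑ i, ∑ j, (posetBocs K P).toLeft (f.hom (vElt K i j)) * leftEmb (unit K i j) +
      ∑ r : Rel P, (posetBocs K P).toLeft
        (f.hom ((BaseAlg.arrow r.1.1 : BaseAlg K P) • UMod.inl (VMod.v r.1.1 r.1.2))) *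
          leftDual r.1.1 r.1.2 r.2 +
      (posetBocs K P).toLeft (f.hom UMod.ω) * (posetBocs K P).toLeft BaseAlg.e₀ := by
  refine leftAlg_ext ?_ (fun k l h => ?_) (fun k l h => ?_) <;>
    simp only [leftAlg_add_hom, leftAlg_sum_hom, toLeft_mul_hom]
  · simp only [leftEmb_unit_ω]
    have h1 : ∀ i, ∑ j, f.hom (vElt K i j) * (if i = j then BaseAlg.idem j else 0) =
        f.hom UMod.ω * BaseAlg.idem i := fun i => by
      rw [Finset.sum_eq_single i]
      · rw [if_pos rfl, vElt, if_pos rfl, map_smul, op_smul_eq_mul, mul_assoc]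
        congr 1
        ext x
        · by_cases hx : x = some i <;> simp [hx]
        · simp
      · intro j _ hj; rw [if_neg hj.symm, mul_zero]
      · simp
    rw [Finset.sum_congr rfl fun i _ => h1 i, Finset.sum_eq_zero (s := Finset.univ (α := Rel P)),
      ← Finset.mul_sum, BaseAlg.sum_idem, toLeft_hom', add_zero, ← mul_add, UMod.ω_fst, mul_one,
      sub_add_cancel, mul_one]
    intro r _
    rw [leftDual_hom]
    simp
  · simp only [leftEmb_unit_v _ _ h]
    rw [Finset.sum_eq_single k, Finset.sum_eq_single l, if_pos ⟨rfl, rfl⟩, vElt, if_neg h.ne,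
      hom_v_eq_mul_idem, Finset.sum_eq_zero, toLeft_hom', UMod.inl_fst, mul_zero, mul_zero,
      add_zero, add_zero]
    · intro r _
      rw [leftDual_hom]
      simp [VMod.v]
    · intro j _ hj; rw [if_neg fun h => hj h.2, mul_zero]
    · simp
    · intro i _ hi
      exact Finset.sum_eq_zero fun j _ => by rw [if_neg fun h => hi h.1, mul_zero]
    · simp
  · simp only [leftEmb_arrow, mul_zero, Finset.sum_const_zero, zero_add]
    rw [Finset.sum_eq_single ⟨(k, l), h⟩, toLeft_hom', UMod.smul_fst, UMod.inl_fst, mul_zero,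
      mul_zero, mul_zero, add_zero, leftDual_hom]
    · have : (((BaseAlg.arrow k : BaseAlg K P) • UMod.inl (VMod.v k l) :
        UMod K P).snd.d ⟨(k, l), h⟩) = 1 := by
        simp [VMod.v]
      simp only
      rw [this, map_one, one_mul, ← op_smul_eq_mul, ← map_smul f.hom, ← smul_comm, v_op_smul_idem]
    · rintro ⟨⟨i, j⟩, hr⟩ _ hne
      have hne' : ¬ (i = k ∧ j = l) := by
        rintro ⟨rfl, rfl⟩
        exact hne rfl
      rw [leftDual_hom]
      have : (((BaseAlg.arrow k : BaseAlg K P) • UMod.inl (VMod.v k l) :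
          UMod K P).snd.d ⟨(i, j), hr⟩) = 0 := by
        simp [VMod.v]
        tauto
      simp only
      rw [this, map_zero, zero_mul, mul_zero]
    · simp

theorem leftDual_mul_leftEmb_one (i j : P) (h : i < j) :
    leftDual i j h * leftEmb (1 : incidence K P) = 0 := by
  refine Bocs.LeftAlg.ext fun u => ?_
  rw [leftEmb_one, ← map_one (posetBocs K P).toLeft, ← map_sub, mul_toLeft_hom, leftDual_hom,
    leftAlg_zero_hom]
  simp [-map_sub]

theorem toLeft_idem_mul_leftDual (i j : P) (h : i < j) :
    (posetBocs K P).toLeft (BaseAlg.idem j) * leftDual i j h = leftDual i j h := by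
  refine Bocs.LeftAlg.ext fun u => ?_
  rw [toLeft_mul_hom, leftDual_hom]
  ext x
  · by_cases hx : x = some j <;> simp [hx]
  · simp

theorem toLeft_e₀_mul_leftEmb (b : incidence K P) :
    (posetBocs K P).toLeft BaseAlg.e₀ * leftEmb b = 0 := by
  refine Bocs.LeftAlg.ext fun u => ?_
  rw [toLeft_mul_hom, leftAlg_zero_hom]
  ext x
  · cases x <;> simp [leftEmb_e_none]
  · simp [leftEmb_α]

theorem leftEmb_mul_toLeft_e₀ (b : incidence K P) :
    leftEmb b * (posetBocs K P).toLeft BaseAlg.e₀ = 0 := by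
  have h : (posetBocs K P).toLeft BaseAlg.e₀ = 1 - leftEmb 1 := by rw [leftEmb_one]; abel
  rw [h, mul_sub, mul_one, ← leftEmb_mul, mul_one, sub_self]

/-- `L (1 - e₀)` is generated, as a left `A`-module, by the `p_ij`. -/
theorem mul_leftEmb_one (f : (posetBocs K P).LeftAlg) : f * leftEmb 1 =
    ∑ i, ∑ j, (posetBocs K P).toLeft (f.hom (vElt K i j)) * leftEmb (unit K i j) := by
  conv_lhs => rw [leftAlg_eq_sum f]
  simp only [add_mul, Finset.sum_mul, mul_assoc, ← leftEmb_mul, mul_one,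
    leftDual_mul_leftEmb_one, toLeft_e₀_mul_leftEmb, mul_zero, Finset.sum_const_zero,
    add_zero]

theorem leftEmb_hom_vElt (b : incidence K P) (i j : P) :
    (leftEmb b).hom (vElt K i j) = algebraMap K _ (b.1 j i) * BaseAlg.idem j := by
  unfold vElt
  split_ifs with h
  · subst h
    rw [map_smul, op_smul_eq_mul]
    ext x
    · by_cases hx : x = some i
      · subst hx; simp [leftEmb_ω_e]
      · simp [hx]
    · simp [leftEmb_α]
  · by_cases hij : i < j
    · ext x
      · cases x with
        | none => simp [leftEmb_e_none]
        | some l => by_cases hl : l = j <;> simp [leftEmb_v_e _ hij, hl]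
      · simp [leftEmb_α]
    · rw [v_eq_zero hij, map_zero, map_zero,
        incidence_apply_eq_zero b fun h' => hij (lt_of_le_of_ne h' h), map_zero, zero_mul]

end Left

/-! ### The corner algebras -/

section Corners

variable {K : Type u} [Field K] {P : Type v} [Fintype P] [PartialOrder P] [DecidableEq P]

theorem rightEmb_smul (k : K) (b : incidence K P) :
    rightEmb (k • b) = algebraMap K (posetBocs K P).RightAlg k * rightEmb b := by
  rw [Algebra.commutes]
  refine Bocs.RightAlg.ext fun u => ?_
  change _ = (rightEmb b * (posetBocs K P).toRight (algebraMap K _ k)).hom u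
  rw [mul_toRight_hom]
  ext x
  · cases x
    · simp [rightEmb_e_none]
    · simp [rightEmb_e_some, incidence_smul_apply, Finset.sum_mul, mul_assoc, mul_comm k]
  · simp [rightEmb_α, incidence_smul_apply, Finset.sum_mul, rightEmb_e_none]
    exact Finset.sum_congr rfl fun j _ => by ring

theorem leftEmb_smul (k : K) (b : incidence K P) :
    leftEmb (k • b) = algebraMap K (posetBocs K P).LeftAlg k * leftEmb b := by
  refine Bocs.LeftAlg.ext fun u => ?_
  change _ = ((posetBocs K P).toLeft (algebraMap K _ k) * leftEmb b).hom u
  rw [toLeft_mul_hom]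
  ext x
  · cases x
    · simp [leftEmb_e_none]
    · simp [leftEmb_e_some, incidence_smul_apply, Finset.mul_sum, mul_assoc]
  · simp [leftEmb_α]

theorem rightEmb_zero : rightEmb (0 : incidence K P) = 0 := by
  rw [← zero_smul K (1 : incidence K P), rightEmb_smul, map_zero, zero_mul]

theorem leftEmb_zero : leftEmb (0 : incidence K P) = 0 := by
  rw [← zero_smul K (1 : incidence K P), leftEmb_smul, map_zero, zero_mul]

theorem rightEmb_algebraMap (k : K) : rightEmb (algebraMap K (incidence K P) k) =
    algebraMap K _ k * (1 - (posetBocs K P).toRight BaseAlg.e₀) := by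
  rw [Algebra.algebraMap_eq_smul_one, rightEmb_smul, rightEmb_one]

theorem leftEmb_algebraMap (k : K) : leftEmb (algebraMap K (incidence K P) k) =
    algebraMap K _ k * (1 - (posetBocs K P).toLeft BaseAlg.e₀) := by
  rw [Algebra.algebraMap_eq_smul_one, leftEmb_smul, leftEmb_one]

theorem rightEmb_one_mul_toRight_e₀ (a : BaseAlg K P) :
    rightEmb 1 * (posetBocs K P).toRight (BaseAlg.e₀ * a) = 0 := by
  rw [rightEmb_one, ← map_one (posetBocs K P).toRight, ← map_sub, ← map_mul]
  have : ((1 - BaseAlg.e₀) * (BaseAlg.e₀ * a) : BaseAlg K P) = 0 := by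
    rw [← mul_assoc]
    have : ((1 - BaseAlg.e₀) * BaseAlg.e₀ : BaseAlg K P) = 0 := by
      ext x
      · cases x <;> simp
      · simp
    rw [this, zero_mul]
  rw [this, map_zero]

theorem rightEmb_mul_toRight_e₀ (b : incidence K P) :
    rightEmb b * (posetBocs K P).toRight BaseAlg.e₀ = 0 := by
  have h := rightEmb_one_mul_toRight_e₀ (1 : BaseAlg K P)
  rw [mul_one] at h
  rw [← mul_one b, rightEmb_mul, mul_assoc, h, mul_zero]

/-- Left multiplication by `1 - e₀` is the projection of `R = e₀ A ⊕ KP` to `KP`. -/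
theorem rightEmb_one_mul (f : (posetBocs K P).RightAlg) :
    rightEmb 1 * f = rightEmb (rightMat f) := by
  conv_lhs => rw [rightAlg_eq f]
  rw [mul_add, rightEmb_one_mul_toRight_e₀, zero_add, ← rightEmb_mul, one_mul]

theorem rightEmb_injective :
    Function.Injective (rightEmb : incidence K P → (posetBocs K P).RightAlg) :=
  Function.LeftInverse.injective rightMat_rightEmb

theorem leftEmb_injective :
    Function.Injective (leftEmb : incidence K P → (posetBocs K P).LeftAlg) :=
  Function.LeftInverse.injective leftMat_leftEmb

variable (K P) in
/-- The projection `R → KP`, which is a ring morphism since `(1 - e₀) R e₀ = 0`. -/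
noncomputable def rightMatHom : (posetBocs K P).RightAlg →+* incidence K P where
  toFun := rightMat
  map_one' := rightEmb_injective (by rw [← rightEmb_one_mul, mul_one])
  map_zero' := rightEmb_injective (by rw [← rightEmb_one_mul, mul_zero, rightEmb_zero])
  map_add' f g := rightEmb_injective (by
    rw [rightEmb_add, ← rightEmb_one_mul, ← rightEmb_one_mul, ← rightEmb_one_mul, mul_add])
  map_mul' f g := rightEmb_injective (by
    rw [rightEmb_mul, ← mul_one (rightMat f), rightEmb_mul, mul_assoc, ← rightEmb_mul, one_mul,
      ← rightEmb_one_mul g, ← mul_assoc (rightEmb (rightMat f)), ← rightEmb_mul, mul_one,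
      ← rightEmb_one_mul, ← rightEmb_one_mul, mul_assoc])

variable (K P) in
/-- The isomorphism `KP ≅ (1 - e₀) R (1 - e₀)`. -/
noncomputable def rightEquiv : incidence K P ≃ₐ[K] (rightIdem K P).Corner :=
  AlgEquiv.ofBijective
    { toFun := fun b => ⟨rightEmb b, (Subsemigroup.mem_corner_iff (rightIdem K P)).mpr (by
        rw [← rightEmb_one, ← rightEmb_mul, ← rightEmb_mul, one_mul, mul_one]
        exact ⟨rfl, rfl⟩)⟩
      map_one' := Subtype.ext rightEmb_one
      map_mul' := fun b c => Subtype.ext (rightEmb_mul b c)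
      map_zero' := Subtype.ext rightEmb_zero
      map_add' := fun b c => Subtype.ext (rightEmb_add b c)
      commutes' := fun k => Subtype.ext (rightEmb_algebraMap k) }
    ⟨fun b c h => rightEmb_injective (congrArg Subtype.val h), fun x => ⟨rightMat x.1,
      Subtype.ext (by
        have hx := (Subsemigroup.mem_corner_iff (rightIdem K P)).mp x.2
        change rightEmb (rightMat x.1) = x.1
        rw [← rightEmb_one_mul, rightEmb_one, hx.1])⟩⟩

variable (K P) in
/-- The isomorphism `KP ≅ (1 - e₀) L (1 - e₀)`. -/
noncomputable def leftEquiv : incidence K P ≃ₐ[K] (leftIdem K P).Corner :=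
  AlgEquiv.ofBijective
    { toFun := fun b => ⟨leftEmb b, (Subsemigroup.mem_corner_iff (leftIdem K P)).mpr (by
        rw [← leftEmb_one, ← leftEmb_mul, ← leftEmb_mul, one_mul, mul_one]
        exact ⟨rfl, rfl⟩)⟩
      map_one' := Subtype.ext leftEmb_one
      map_mul' := fun b c => Subtype.ext (leftEmb_mul b c)
      map_zero' := Subtype.ext leftEmb_zero
      map_add' := fun b c => Subtype.ext (leftEmb_add b c)
      commutes' := fun k => Subtype.ext (leftEmb_algebraMap k) }
    ⟨fun b c h => leftEmb_injective (congrArg Subtype.val h), fun x => ⟨leftMat x.1,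
      Subtype.ext (by
        have hx := (Subsemigroup.mem_corner_iff (leftIdem K P)).mp x.2
        refine leftEmb_leftMat ?_ ?_ <;> rw [leftEmb_one]
        exacts [hx.1, hx.2])⟩⟩

end Corners

/-! ### Idempotent restriction -/

section Restriction

variable {Λ : Type*} [Ring Λ] {e : Λ} {B : Type*} [Ring B] {he : IsIdempotentElem e}

/-- The restrictions along two isomorphisms `B ≅ e Λ e` differ by an automorphism of `B`. -/
def Res.semilinearEquiv (θ θ' : B ≃+* he.Corner) (M : Type*) [AddCommGroup M] [Module Λ M]
    {σ τ : B →+* B} [RingHomInvPair σ τ] [RingHomInvPair τ σ] (hσ : ∀ b, θ' (σ b) = θ b) :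
    Res θ.toRingHom M ≃ₛₗ[σ] Res θ'.toRingHom M where
  toFun m := m
  invFun m := m
  map_add' _ _ := rfl
  map_smul' b m := Subtype.ext (by
    change (θ b).1 • m.1 = (θ' (σ b)).1 • m.1
    rw [hσ])
  left_inv _ := rfl
  right_inv _ := rfl

/-- Projectivity of the restriction does not depend on the isomorphism `B ≅ e Λ e`. -/
theorem Res.projective_of_projective (θ θ' : B ≃+* he.Corner) (M : Type*) [AddCommGroup M]
    [Module Λ M] (h : Module.Projective B (Res θ.toRingHom M)) :
    Module.Projective B (Res θ'.toRingHom M) :=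
  letI σ : B ≃+* B := θ.trans θ'.symm
  haveI := RingHomInvPair.of_ringEquiv σ
  haveI := RingHomInvPair.symm (RingHomClass.toRingHom σ) (RingHomClass.toRingHom σ.symm)
  Module.Projective.of_equiv (Res.semilinearEquiv θ θ' M
    (σ := RingHomClass.toRingHom σ) (τ := RingHomClass.toRingHom σ.symm)
    fun b => θ'.apply_symm_apply (θ b))

/-- Injectivity of the restriction does not depend on the isomorphism `B ≅ e Λ e`. -/
theorem Res.injective_of_injective {B : Type u} [Ring B] (θ θ' : B ≃+* he.Corner)
    (M : Type (max u w)) [AddCommGroup M]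
    [Module Λ M] (h : Module.Injective B (Res θ.toRingHom M)) :
    Module.Injective B (Res θ'.toRingHom M) :=
  letI σ : B ≃+* B := θ.trans θ'.symm
  haveI := RingHomInvPair.of_ringEquiv σ
  haveI := RingHomInvPair.symm (RingHomClass.toRingHom σ) (RingHomClass.toRingHom σ.symm)
  Module.Injective.of_ringEquiv σ (Res.semilinearEquiv θ θ' M
    (σ := RingHomClass.toRingHom σ) (τ := RingHomClass.toRingHom σ.symm)
    fun b => θ'.apply_symm_apply (θ b))

end Restriction

/-! ### Induced modules -/

section Induction

variable {A : Type*} [Ring A] {Λ : Type*} [Ring Λ] (f : A →+* Λ) {N : Type*} [AddCommGroup N]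
  [Module A N] {X : Type*} [AddCommGroup X] [Module Λ X]

namespace Induction

/-- The element `x ⊗ n` of `Λ ⊗_A N`. -/
noncomputable def tmul (x : Λ) (n : N) : Induction f N := Submodule.Quotient.mk (x ⊗ₜ[ℤ] n)

theorem tmul_add (x : Λ) (n n' : N) : tmul f x (n + n') = tmul f x n + tmul f x n' := by
  unfold tmul; rw [TensorProduct.tmul_add]; rfl

theorem add_tmul (x x' : Λ) (n : N) : tmul f (x + x') n = tmul f x n + tmul f x' n := by
  unfold tmul; rw [TensorProduct.add_tmul]; rfl

theorem tmul_zero (x : Λ) : tmul f x (0 : N) = 0 := by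
  unfold tmul; rw [TensorProduct.tmul_zero]; rfl

theorem sum_tmul {ι : Type*} (s : Finset ι) (x : ι → Λ) (n : N) :
    tmul f (∑ i ∈ s, x i) n = ∑ i ∈ s, tmul f (x i) n :=
  map_sum (AddMonoidHom.mk' (fun x => tmul f x n) fun x x' => add_tmul f x x' n) x s

theorem mul_tmul (x : Λ) (a : A) (n : N) : tmul f (x * f a) n = tmul f x (a • n) :=
  (Submodule.Quotient.eq _).mpr (Submodule.subset_span ⟨x, a, n, rfl⟩)

theorem smul_tmul (y x : Λ) (n : N) : y • tmul f x n = tmul f (y * x) n := rfl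

variable {f} in
@[elab_as_elim]
theorem induction_on {p : Induction f N → Prop} (t : Induction f N)
    (ht : ∀ x n, p (tmul f x n)) (ha : ∀ s t, p s → p t → p (s + t)) : p t := by
  induction t using Submodule.Quotient.induction_on with
  | H z =>
    induction z using TensorProduct.induction_on with
    | zero =>
      have := ht 0 0
      rwa [tmul_zero] at this
    | tmul x y => exact ht x y
    | add x y hx hy => exact ha _ _ hx hy

/-- The universal property of `Λ ⊗_A N`. -/
noncomputable def lift (g : N →+ X) (hg : ∀ a n, g (a • n) = f a • g n) :
    Induction f N →ₗ[Λ] X :=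
  letI φ : Λ ⊗[ℤ] N →+ X := TensorProduct.liftAddHom (R := ℤ)
    (AddMonoidHom.mk' (fun x : Λ => (DistribSMul.toAddMonoidHom X x).comp g)
      fun x y => AddMonoidHom.ext fun n => add_smul x y (g n))
    (fun r x n => by
      change (r • x) • g n = x • g (r • n)
      rw [map_zsmul, smul_assoc, smul_comm])
  have hφ : ∀ x n, φ (x ⊗ₜ[ℤ] n) = x • g n := fun _ _ => rfl
  Submodule.liftQ _
    { toFun := φ
      map_add' := φ.map_add
      map_smul' := fun y t => by
        rw [RingHom.id_apply]
        induction t using TensorProduct.induction_on with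
        | zero => rw [smul_zero, map_zero, smul_zero]
        | tmul x n => exact mul_smul y x (g n)
        | add s t hs ht => rw [smul_add, map_add, map_add, hs, ht, smul_add] } (by
    rw [Submodule.span_le]
    rintro _ ⟨x, a, n, rfl⟩
    have h0 : φ ((x * f a) ⊗ₜ[ℤ] n - x ⊗ₜ[ℤ] (a • n)) = 0 := by
      rw [map_sub, hφ, hφ, mul_smul, hg, sub_self]
    exact h0)

theorem lift_tmul (g : N →+ X) (hg : ∀ a n, g (a • n) = f a • g n) (x : Λ) (n : N) :
    lift f g hg (tmul f x n) = x • g n := rfl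

end Induction

end Induction

/-! ### Restriction of scalars to the ground field -/

section ScalarStructures

variable (K : Type*) [Field K] (B : Type*) [Ring B] [Algebra K B]

theorem isScalarTower_compHom (M : Type*) [AddCommGroup M] [Module B M] :
    letI : Module K M := Module.compHom M (algebraMap K B)
    IsScalarTower K B M :=
  letI : Module K M := Module.compHom M (algebraMap K B)
  ⟨fun k b m => by rw [Algebra.smul_def, mul_smul]; rfl⟩

variable {K B} {A : Type*} [Ring A] [Algebra K A] {M : Type*} [AddCommGroup M] [Module B M]
  {N : Type*} [AddCommGroup N] [Module A N]

theorem IsFinDim.of_injective (h : IsFinDim K B M) (g : N →+ M) (hg : Function.Injective g)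
    (hk : ∀ (k : K) n, g (algebraMap K A k • n) = algebraMap K B k • g n) : IsFinDim K A N :=
  letI : Module K M := Module.compHom M (algebraMap K B)
  letI : Module K N := Module.compHom N (algebraMap K A)
  haveI : Module.Finite K M := h
  Module.Finite.of_injective ({ g with map_smul' := hk } : N →ₗ[K] M) hg

theorem IsFinDim.of_surjective (h : IsFinDim K B M) (g : M →+ N) (hg : Function.Surjective g)
    (hk : ∀ (k : K) m, g (algebraMap K B k • m) = algebraMap K A k • g m) : IsFinDim K A N :=
  letI : Module K M := Module.compHom M (algebraMap K B)
  letI : Module K N := Module.compHom N (algebraMap K A)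
  haveI : Module.Finite K M := h
  Module.Finite.of_surjective ({ g with map_smul' := hk } : M →ₗ[K] N) hg

end ScalarStructures

/-! ### Induced modules and projectivity -/

section RightModules

variable {K : Type u} [Field K] {P : Type v} [Fintype P] [PartialOrder P] [DecidableEq P]

theorem toRight_idem (i : P) :
    (posetBocs K P).toRight (BaseAlg.idem i) = rightEmb (unit K i i) := by
  refine Bocs.RightAlg.ext fun u => ?_
  rw [toRight_hom']
  ext x
  · cases x with
    | none => simp [rightEmb_e_none]
    | some l =>
      rw [rightEmb_e_some, Finset.sum_eq_single i]
      · by_cases hl : l = i <;> simp [unit_apply, vCoeff, hl]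
      · intro k _ hk; simp [unit_apply, hk]
      · simp
  · rw [rightEmb_α, Finset.sum_eq_single i]
    · by_cases hx : x = i <;> simp [unit_apply, αvCoeff, hx]
    · intro k _ hk; simp [unit_apply, hk]
    · simp

theorem unit_mul_rightMat_toRight (i : P) (a : BaseAlg K P) :
    unit K i i * rightMat ((posetBocs K P).toRight a) = a.e (some i) • unit K i i := by
  refine rightEmb_injective ?_
  rw [rightEmb_mul, ← rightEmb_one_mul, ← mul_assoc, ← rightEmb_mul, mul_one, ← toRight_idem,
    ← map_mul, BaseAlg.idem_mul, map_mul, rightEmb_smul, ← toRight_idem]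
  rfl

theorem rightMat_toRight_mul_unit (i : P) (a : BaseAlg K P) :
    rightMat ((posetBocs K P).toRight a) * unit K i i = a.e (some i) • unit K i i := by
  have h : rightMat ((posetBocs K P).toRight a) = ∑ k, a.e (some k) • unit K k k := by
    rw [← one_mul (rightMat _), ← sum_unit, Finset.sum_mul]
    exact Finset.sum_congr rfl fun k _ => unit_mul_rightMat_toRight k a
  rw [h, Finset.sum_mul, Finset.sum_eq_single i]
  · rw [smul_mul_assoc, unit_mul_self]
  · intro k _ hk
    rw [smul_mul_assoc, unit_mul_unit_of_ne hk, smul_zero]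
  · simp

theorem rightEmb_sum {ι : Type*} (s : Finset ι) (F : ι → incidence K P) :
    rightEmb (∑ k ∈ s, F k) = ∑ k ∈ s, rightEmb (F k) := by
  classical
  induction s using Finset.induction_on with
  | empty => rw [Finset.sum_empty, Finset.sum_empty, rightEmb_zero]
  | insert a s ha ih => rw [Finset.sum_insert ha, Finset.sum_insert ha, rightEmb_add, ih]

variable (K P) (M : Type w) [AddCommGroup M] [Module (posetBocs K P).RightAlg M]

/-- The idempotent restriction of an `R`-module along the canonical isomorphism. -/
def RightRes : Type w := Res (rightEquiv K P).toRingEquiv.toRingHom M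

noncomputable instance : AddCommGroup (RightRes K P M) :=
  inferInstanceAs (AddCommGroup (Res (rightEquiv K P).toRingEquiv.toRingHom M))

noncomputable instance : Module (incidence K P) (RightRes K P M) :=
  inferInstanceAs (Module (incidence K P) (Res (rightEquiv K P).toRingEquiv.toRingHom M))

variable {K P M}

theorem RightRes.smul_val (b : incidence K P) (m : RightRes K P M) :
    (b • m).1 = rightEmb b • m.1 := rfl

theorem RightRes.one_smul_val (m : RightRes K P M) :
    rightEmb (1 : incidence K P) • m.1 = m.1 := congrArg Subtype.val (one_smul (incidence K P) m)

theorem RightRes.sum_val {ι : Type*} (s : Finset ι) (F : ι → RightRes K P M) :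
    (∑ k ∈ s, F k).1 = ∑ k ∈ s, (F k).1 :=
  map_sum (cornerSubgroup _ M).subtype F s

/-- The element `(1 - e₀) m` of the restriction. -/
noncomputable def RightRes.proj : M →+ RightRes K P M where
  toFun m := ⟨rightEmb (1 : incidence K P) • m, m, by rw [rightEmb_one]; rfl⟩
  map_zero' := Subtype.ext (smul_zero _)
  map_add' m m' := Subtype.ext (smul_add _ m m')

theorem RightRes.proj_val (m : M) : (RightRes.proj (K := K) (P := P) m).1 =
    rightEmb (1 : incidence K P) • m := rfl

theorem RightRes.proj_coe (m : RightRes K P M) : RightRes.proj (K := K) (P := P) m.1 = m :=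
  Subtype.ext (RightRes.one_smul_val m)

theorem RightRes.proj_smul (x : (posetBocs K P).RightAlg) (m : M) :
    RightRes.proj (K := K) (P := P) (x • m) =
      rightMat x • RightRes.proj (K := K) (P := P) m := Subtype.ext (by
  rw [RightRes.proj_val, RightRes.smul_val, RightRes.proj_val, ← mul_smul, ← mul_smul,
    rightEmb_one_mul, ← rightEmb_mul, mul_one])

theorem RightRes.proj_e₀_smul (m : M) :
    RightRes.proj (K := K) (P := P) ((posetBocs K P).toRight BaseAlg.e₀ • m) = 0 := Subtype.ext (by
  rw [RightRes.proj_val, ← mul_smul, rightEmb_mul_toRight_e₀, zero_smul]; rfl)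

/-- `(1 - e₀)(R ⊗_A N)` is a projective `KP`-module. A section of a surjection `q` onto it is
obtained from the universal property of `R ⊗_A N`, as a `KP`-module is an `R`-module
through the projection `R → KP`, and a `K`-linear section of `q` can be averaged over the `e_i`. -/
theorem projective_of_induced {N : Type*} [AddCommGroup N] [Module (BaseAlg K P) N]
    (e : M ≃ₗ[(posetBocs K P).RightAlg] Induction (posetBocs K P).toRight N) :
    Module.Projective (incidence K P) (RightRes K P M) := by
  refine Module.Projective.of_lifting_property'' fun q hq => ?_
  let : Module K (RightRes K P M) := Module.compHom _ (algebraMap K (incidence K P))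
  have : IsScalarTower K (incidence K P) (RightRes K P M) := isScalarTower_compHom K _ _
  let : Module (posetBocs K P).RightAlg (RightRes K P M →₀ incidence K P) :=
    Module.compHom _ (rightMatHom K P)
  obtain ⟨c, hc⟩ := (q.restrictScalars K).exists_rightInverse_of_surjective
    (LinearMap.range_eq_top.mpr hq)
  have hc' : ∀ r, q (c r) = r := fun r => LinearMap.congr_fun hc r
  let p : N →+ RightRes K P M := AddMonoidHom.mk'
    (fun n => RightRes.proj (K := K) (P := P) (e.symm (Induction.tmul _ 1 n))) fun n n' => by
      rw [Induction.tmul_add, map_add, map_add]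
  have hp : ∀ (a : BaseAlg K P) n, p (a • n) = rightMat ((posetBocs K P).toRight a) • p n :=
    fun a n => by
      change RightRes.proj (K := K) (P := P) (e.symm (Induction.tmul _ 1 (a • n))) = _
      rw [← Induction.mul_tmul, one_mul, ← mul_one ((posetBocs K P).toRight a),
        ← Induction.smul_tmul, map_smul, RightRes.proj_smul, mul_one]
      rfl
  let g : N →+ (RightRes K P M →₀ incidence K P) := AddMonoidHom.mk'
    (fun n => ∑ i : P, unit K i i • c (unit K i i • p n)) fun n n' => by
      simp only [map_add, smul_add, Finset.sum_add_distrib]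
  have hg : ∀ (a : BaseAlg K P) n, g (a • n) = (posetBocs K P).toRight a • g n := fun a n => by
    change ∑ i : P, unit K i i • c (unit K i i • p (a • n)) =
      rightMat ((posetBocs K P).toRight a) • ∑ i : P, unit K i i • c (unit K i i • p n)
    rw [Finset.smul_sum]
    refine Finset.sum_congr rfl fun i _ => ?_
    rw [hp, ← mul_smul, ← mul_smul, unit_mul_rightMat_toRight, rightMat_toRight_mul_unit,
      smul_assoc, smul_assoc, map_smul, smul_comm]
  let h := Induction.lift (N := N) (X := RightRes K P M →₀ incidence K P)
    (posetBocs K P).toRight g hg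
  have hqh : ∀ t, q (h t) = RightRes.proj (K := K) (P := P) (e.symm t) := fun t => by
    induction t using Induction.induction_on with
    | ha s t hs ht => simp only [map_add, hs, ht]
    | ht x n =>
      have h1 : q (g n) = p n := by
        change q (∑ i : P, unit K i i • c (unit K i i • p n)) = _
        rw [map_sum, ← sum_unit_smul (K := K) (P := P) (p n)]
        refine Finset.sum_congr rfl fun i _ => ?_
        rw [map_smul, hc', sum_unit_smul, ← mul_smul, unit_mul_self]
      rw [Induction.lift_tmul]
      change q (rightMat x • g n) = _
      rw [map_smul, h1, ← mul_one x, ← Induction.smul_tmul, map_smul, RightRes.proj_smul, mul_one]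
      rfl
  refine ⟨{ toFun := fun r => h (e r.1)
            map_add' := fun r s => by
              change h (e (r.1 + s.1)) = _
              rw [map_add, map_add]
            map_smul' := fun b r => by
              rw [RightRes.smul_val, map_smul, map_smul, RingHom.id_apply]
              change rightMat (rightEmb b) • h (e r.1) = b • h (e r.1)
              rw [rightMat_rightEmb] }, LinearMap.ext fun r => ?_⟩
  change q (h (e r.1)) = r
  rw [hqh, e.symm_apply_apply, RightRes.proj_coe]

/-- If `(1 - e₀) M = ⨁ KP e_i ⊗ N_i`, then `M ≅ R ⊗_A N`, where `N` is the `A`-submodule of `M`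
with `e_i N = N_i` and `e₀ N = e₀ M`. -/
theorem exists_induced_of_projective [Module.Projective (incidence K P) (RightRes K P M)] :
    letI : Module (BaseAlg K P) M := Module.compHom M (posetBocs K P).toRight
    ∃ N : Submodule (BaseAlg K P) M,
      Nonempty (M ≃ₗ[(posetBocs K P).RightAlg] Induction (posetBocs K P).toRight N) := by
  let : Module (BaseAlg K P) M := Module.compHom M (posetBocs K P).toRight
  let : Module K (RightRes K P M) := Module.compHom _ (algebraMap K (incidence K P))
  have : IsScalarTower K (incidence K P) (RightRes K P M) := isScalarTower_compHom K _ _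
  have hA : ∀ (a : BaseAlg K P) (m : M), a • m = (posetBocs K P).toRight a • m := fun _ _ => rfl
  obtain ⟨N, hNE, hgen, hind⟩ :=
    exists_generators_of_projective (K := K) (P := P) (M := RightRes K P M)
  let N' : Submodule (BaseAlg K P) M :=
    { carrier := {m | ∀ i, unit K i i • RightRes.proj (K := K) (P := P) m ∈ N i}
      add_mem' := fun {m m'} hm hm' i => by
        rw [map_add, smul_add]; exact add_mem (hm i) (hm' i)
      zero_mem' := fun i => by rw [map_zero, smul_zero]; exact zero_mem _
      smul_mem' := fun a m hm i => by
        rw [hA, RightRes.proj_smul, ← mul_smul, unit_mul_rightMat_toRight, smul_assoc]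
        exact Submodule.smul_mem _ _ (hm i) }
  have hN' : ∀ i, ∀ r ∈ N i, r.1 ∈ N' := fun i r hr k => by
    rw [RightRes.proj_coe]
    by_cases hk : k = i
    · subst hk
      rwa [mem_component.mp (hNE k hr)]
    · rw [unit_smul_of_ne hk (hNE i hr)]
      exact zero_mem _
  have hN0 : ∀ m : M, (posetBocs K P).toRight BaseAlg.e₀ • m ∈ N' := fun m i => by
    rw [RightRes.proj_e₀_smul, smul_zero]; exact zero_mem _
  let ι : N' →+ M := N'.subtype.toAddMonoidHom
  have hι : ∀ (a : BaseAlg K P) (n : N'), ι (a • n) = (posetBocs K P).toRight a • ι n :=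
    fun _ _ => rfl
  let Ψ := Induction.lift (posetBocs K P).toRight ι hι
  have hΨ : ∀ x n, Ψ (Induction.tmul (posetBocs K P).toRight x n) = x • n.1 := fun _ _ => rfl
  refine ⟨N', ⟨(LinearEquiv.ofBijective Ψ ⟨?_, ?_⟩).symm⟩⟩
  · -- Every element of `R ⊗_A N` has the form `1 ⊗ n₀ + ∑ p_ij ⊗ n_ij`.
    have hform : ∀ t : Induction (posetBocs K P).toRight N',
        ∃ (n₀ : N') (n : P → P → RightRes K P M)
        (hn : ∀ i j, n i j ∈ N i), (posetBocs K P).toRight BaseAlg.e₀ • n₀.1 = n₀.1 ∧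
        (∀ i j, ¬ i ≤ j → n i j = 0) ∧ t = Induction.tmul _ 1 n₀ +
          ∑ i, ∑ j, Induction.tmul _ (rightEmb (unit K i j)) ⟨(n i j).1, hN' i _ (hn i j)⟩ := by
      intro t
      induction t using Induction.induction_on with
      | ha s t hs ht =>
        obtain ⟨s₀, ns, hns, hs1, hs2, rfl⟩ := hs
        obtain ⟨t₀, nt, hnt, ht1, ht2, rfl⟩ := ht
        refine ⟨s₀ + t₀, ns + nt, fun i j => add_mem (hns i j) (hnt i j), ?_, fun i j h => ?_, ?_⟩
        · rw [Submodule.coe_add, smul_add, hs1, ht1]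
        · rw [Pi.add_apply, Pi.add_apply, hs2 i j h, ht2 i j h, add_zero]
        · rw [Induction.tmul_add, add_add_add_comm, ← Finset.sum_add_distrib]
          congr 1
          refine Finset.sum_congr rfl fun i _ => ?_
          rw [← Finset.sum_add_distrib]
          refine Finset.sum_congr rfl fun j _ => ?_
          rw [← Induction.tmul_add]
          rfl
      | ht x n =>
        refine ⟨(BaseAlg.e₀ * x.hom UMod.ω) • n,
          fun i j => (rightMat x).1 j i • unit K i i • RightRes.proj (K := K) (P := P) n.1,
          fun i j => Submodule.smul_mem _ _ (n.2 i), ?_, fun i j h => ?_, ?_⟩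
        · rw [Submodule.coe_smul, hA, ← mul_smul, ← map_mul, ← mul_assoc]
          congr 3
          ext x
          · cases x <;> simp
          · simp
        · change (rightMat x).1 j i • _ = (0 : RightRes K P M)
          rw [incidence_apply_eq_zero _ h, zero_smul]
        · conv_lhs => rw [rightAlg_eq x, Induction.add_tmul,
            ← one_mul ((posetBocs K P).toRight (BaseAlg.e₀ * x.hom UMod.ω)), Induction.mul_tmul]
          congr 1
          have hsum : rightEmb (rightMat x) = ∑ i, ∑ j, rightEmb (unit K i j) *
              (posetBocs K P).toRight (algebraMap K _ ((rightMat x).1 j i) * BaseAlg.idem i) := by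
            have h : ∀ i j, rightEmb ((rightMat x).1 j i • unit K i j) = rightEmb (unit K i j) *
                (posetBocs K P).toRight (algebraMap K _ ((rightMat x).1 j i) * BaseAlg.idem i) := by
              intro i j
              rw [map_mul, toRight_idem, ← mul_assoc]
              change _ = rightEmb (unit K i j) * algebraMap K _ _ * _
              rw [← Algebra.commutes, mul_assoc, ← rightEmb_mul, mul_unit_self, rightEmb_smul]
            conv_lhs => rw [incidence_eq_sum (rightMat x)]
            simp only [← h]
            rw [rightEmb_sum]
            exact Finset.sum_congr rfl fun i _ => rightEmb_sum _ _
          rw [hsum, Induction.sum_tmul]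
          refine Finset.sum_congr rfl fun i _ => ?_
          rw [Induction.sum_tmul]
          refine Finset.sum_congr rfl fun j _ => ?_
          rw [Induction.mul_tmul]
          congr 1
          refine Subtype.ext ?_
          have h : ((rightMat x).1 j i • unit K i i •
              RightRes.proj (K := K) (P := P) n.1 : RightRes K P M).1 =
              (algebraMap K (posetBocs K P).RightAlg ((rightMat x).1 j i) *
                rightEmb (unit K i i)) • n.1 := by
            change rightEmb (algebraMap K (incidence K P) ((rightMat x).1 j i)) •
              rightEmb (unit K i i) • rightEmb (1 : incidence K P) • n.1 = _
            rw [← mul_smul, ← mul_smul, ← rightEmb_mul, ← rightEmb_mul, mul_one,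
              ← Algebra.smul_def, rightEmb_smul]
          rw [Submodule.coe_smul, hA, map_mul, toRight_idem]
          exact h.symm
    rw [injective_iff_map_eq_zero]
    intro t ht
    obtain ⟨n₀, n, hn, h0, hle, rfl⟩ := hform t
    rw [map_add, hΨ, one_smul, map_sum] at ht
    have ht' : n₀.1 + ∑ i, ∑ j, rightEmb (unit K i j) • (n i j).1 = 0 := by
      rw [← ht]
      congr 1
      refine Finset.sum_congr rfl fun i _ => ?_
      rw [map_sum]
      rfl
    have hz : ∑ i, ∑ j, unit K i j • n i j = 0 := by
      have := congrArg (RightRes.proj (K := K) (P := P)) ht'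
      rw [map_add, ← h0, RightRes.proj_e₀_smul, zero_add, map_zero, map_sum] at this
      rw [← this]
      refine Finset.sum_congr rfl fun i _ => ?_
      rw [map_sum]
      exact Finset.sum_congr rfl fun j _ => (RightRes.proj_coe _).symm
    have hn0 := hind n hn hle hz
    have hn₀ : n₀ = 0 := Subtype.ext (by
      refine Eq.trans ?_ ht'
      rw [← add_zero n₀.1, add_assoc, zero_add]
      congr 1
      refine (Finset.sum_eq_zero fun i _ => Finset.sum_eq_zero fun j _ => ?_).symm
      rw [hn0 i j]
      exact smul_zero _)
    rw [hn₀, Induction.tmul_zero, zero_add]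
    refine Finset.sum_eq_zero fun i _ => Finset.sum_eq_zero fun j _ => ?_
    have h0 : (⟨(n i j).1, hN' i _ (hn i j)⟩ : N') = 0 :=
      Subtype.ext (by
        change (n i j).1 = 0
        rw [hn0 i j]
        rfl)
    rw [h0, Induction.tmul_zero]
  · intro m
    obtain ⟨n, hn, hm⟩ := hgen (RightRes.proj (K := K) (P := P) m)
    refine ⟨Induction.tmul _ 1 ⟨_, hN0 m⟩ +
      ∑ i, ∑ j, Induction.tmul _ (rightEmb (unit K i j)) ⟨(n i j).1, hN' i _ (hn i j)⟩, ?_⟩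
    rw [map_add, hΨ, one_smul, map_sum]
    have h1 : (RightRes.proj (K := K) (P := P) m).1 =
        ∑ i, ∑ j, rightEmb (unit K i j) • (n i j).1 := by
      rw [hm, RightRes.sum_val]
      refine Finset.sum_congr rfl fun i _ => ?_
      rw [RightRes.sum_val]
      rfl
    have h2 : m = (posetBocs K P).toRight BaseAlg.e₀ • m +
        (RightRes.proj (K := K) (P := P) m).1 := by
      rw [RightRes.proj_val, rightEmb_one, sub_smul, one_smul, add_sub_cancel]
    conv_rhs => rw [h2, h1]
    congr 1
    refine Finset.sum_congr rfl fun i _ => ?_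
    rw [map_sum]
    rfl

end RightModules

/-! ### Co-induced modules and injectivity -/

section Coinduction

variable {A : Type*} [Ring A] {Λ : Type*} [Ring Λ] (f : A →+* Λ) {N : Type*} [AddCommGroup N]
  [Module A N]

namespace Coinduction

variable {f}

/-- The value `g(x)` of an element `g` of `Hom_A(Λ, N)`. -/
noncomputable def eval (g : (ModuleCat.coextendScalars f).obj (ModuleCat.of A N)) (x : Λ) : N :=
  ModuleCat.CoextendScalars.equiv f (ModuleCat.of A N) g x

theorem eval_add (g : (ModuleCat.coextendScalars f).obj (ModuleCat.of A N)) (x y : Λ) :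
    eval g (x + y) = eval g x + eval g y :=
  (ModuleCat.CoextendScalars.equiv f (ModuleCat.of A N) g).map_add x y

theorem eval_mul (g : (ModuleCat.coextendScalars f).obj (ModuleCat.of A N)) (a : A) (x : Λ) :
    eval g (f a * x) = a • eval g x :=
  (ModuleCat.CoextendScalars.equiv f (ModuleCat.of A N) g).map_smul a x

theorem eval_sum (g : (ModuleCat.coextendScalars f).obj (ModuleCat.of A N)) {ι : Type*}
    (s : Finset ι) (x : ι → Λ) : eval g (∑ i ∈ s, x i) = ∑ i ∈ s, eval g (x i) :=
  map_sum (AddMonoidHom.mk' (eval g) (eval_add g)) x s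

theorem eval_sub (g : (ModuleCat.coextendScalars f).obj (ModuleCat.of A N)) (x y : Λ) :
    eval g (x - y) = eval g x - eval g y :=
  map_sub (AddMonoidHom.mk' (eval g) (eval_add g)) x y

theorem eval_smul (g : (ModuleCat.coextendScalars f).obj (ModuleCat.of A N)) (x y : Λ) :
    eval (y • g) x = eval g (x * y) := rfl

theorem add_eval (g h : (ModuleCat.coextendScalars f).obj (ModuleCat.of A N)) (x : Λ) :
    eval (g + h) x = eval g x + eval h x := rfl

theorem ext {g h : (ModuleCat.coextendScalars f).obj (ModuleCat.of A N)}
    (H : ∀ x, eval g x = eval h x) : g = h :=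
  ModuleCat.CoextendScalars.ext (LinearMap.ext H)

/-- The element of `Hom_A(Λ, N)` given by an additive map that commutes with `A`. -/
noncomputable def mk (g : Λ → N) (h₁ : ∀ x y, g (x + y) = g x + g y)
    (h₂ : ∀ a x, g (f a * x) = a • g x) :
    (ModuleCat.coextendScalars f).obj (ModuleCat.of A N) :=
  (ModuleCat.CoextendScalars.equiv f (ModuleCat.of A N)).symm
    { toFun := g
      map_add' := h₁
      map_smul' := h₂ }

theorem eval_mk (g : Λ → N) (h₁ h₂) (x : Λ) :
    eval (mk (f := f) g h₁ h₂) x = g x := rfl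

end Coinduction

end Coinduction

section LeftModules

variable {K : Type u} [Field K] {P : Type v} [Fintype P] [PartialOrder P] [DecidableEq P]

theorem leftEmb_sum {ι : Type*} (s : Finset ι) (F : ι → incidence K P) :
    leftEmb (∑ k ∈ s, F k) = ∑ k ∈ s, leftEmb (F k) := by
  classical
  induction s using Finset.induction_on with
  | empty => rw [Finset.sum_empty, Finset.sum_empty, leftEmb_zero]
  | insert a s ha ih => rw [Finset.sum_insert ha, Finset.sum_insert ha, leftEmb_add, ih]

variable (K P) (M : Type w) [AddCommGroup M] [Module (posetBocs K P).LeftAlg M]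

/-- The idempotent restriction of an `L`-module along the canonical isomorphism. -/
def LeftRes : Type w := Res (leftEquiv K P).toRingEquiv.toRingHom M

noncomputable instance : AddCommGroup (LeftRes K P M) :=
  inferInstanceAs (AddCommGroup (Res (leftEquiv K P).toRingEquiv.toRingHom M))

noncomputable instance : Module (incidence K P) (LeftRes K P M) :=
  inferInstanceAs (Module (incidence K P) (Res (leftEquiv K P).toRingEquiv.toRingHom M))

variable {K P M}

theorem LeftRes.smul_val (b : incidence K P) (m : LeftRes K P M) :
    (b • m).1 = leftEmb b • m.1 := rfl

theorem LeftRes.add_val (m n : LeftRes K P M) : (m + n).1 = m.1 + n.1 := rfl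

theorem LeftRes.one_smul_val (m : LeftRes K P M) :
    leftEmb (1 : incidence K P) • m.1 = m.1 := congrArg Subtype.val (one_smul (incidence K P) m)

/-- An element of `M` fixed by `1 - e₀`, as an element of the restriction. -/
def LeftRes.mk (m : M) (hm : leftEmb (1 : incidence K P) • m = m) : LeftRes K P M :=
  ⟨m, m, by rw [leftEmb_one] at hm; exact hm⟩

/-- The restriction `(1 - e₀) Hom_A(L, N)` is an injective `KP`-module. It consists of the
morphisms on `L (1 - e₀)`, which is generated over `A` by the `p_ij`, and these correspond to the
families `(g(p_ij))`; so a `K`-linear extension of `x ↦ g(x)(1)`, averaged over the `e_i`, defines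
an extension of `g`. -/
theorem injective_of_coinduced {N : Type*} [AddCommGroup N] [Module (BaseAlg K P) N]
    (e : M ≃ₗ[(posetBocs K P).LeftAlg]
      (ModuleCat.coextendScalars (posetBocs K P).toLeft).obj (ModuleCat.of (BaseAlg K P) N)) :
    Module.Injective (incidence K P) (LeftRes K P M) := by
  refine ⟨fun X Y _ _ _ _ f hf g => ?_⟩
  let _ : Module K X := Module.compHom _ (algebraMap K (incidence K P))
  have _ : IsScalarTower K (incidence K P) X := isScalarTower_compHom K _ _
  let _ : Module K Y := Module.compHom _ (algebraMap K (incidence K P))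
  have _ : IsScalarTower K (incidence K P) Y := isScalarTower_compHom K _ _
  let _ : Module K N := Module.compHom _ (algebraMap K (BaseAlg K P))
  have _ : IsScalarTower K (BaseAlg K P) N := isScalarTower_compHom K _ _
  have hsmul : ∀ (b : incidence K P) (x : X),
      Coinduction.eval (e (g (b • x)).1) 1 = Coinduction.eval (e (g x).1) (leftEmb b) :=
    fun b x => by
      rw [map_smul, LeftRes.smul_val, map_smul, Coinduction.eval_smul, one_mul]
  let hX : X →ₗ[K] N :=
    { toFun := fun x => Coinduction.eval (e (g x).1) 1
      map_add' := fun x y => by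
        rw [map_add, LeftRes.add_val, map_add, Coinduction.add_eval]
      map_smul' := fun k x => by
        rw [← one_smul (incidence K P) x, ← smul_assoc, hsmul, hsmul, RingHom.id_apply,
          leftEmb_smul]
        exact Coinduction.eval_mul _ _ _ }
  have hX_def : ∀ x, hX x = Coinduction.eval (e (g x).1) 1 := fun _ => rfl
  obtain ⟨r, hr⟩ := (f.restrictScalars K).exists_leftInverse_of_injective
    (LinearMap.ker_eq_bot.mpr hf)
  have hr' : ∀ x, r (f x) = x := fun x => LinearMap.congr_fun hr x
  let h : Y →ₗ[K] N :=
    { toFun := fun y => ∑ i : P, (BaseAlg.idem i : BaseAlg K P) • hX (r (unit K i i • y))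
      map_add' := fun y y' => by
        simp only [smul_add, map_add, Finset.sum_add_distrib]
      map_smul' := fun k y => by
        rw [RingHom.id_apply, Finset.smul_sum]
        refine Finset.sum_congr rfl fun i _ => ?_
        rw [smul_comm, map_smul, map_smul]
        change (BaseAlg.idem i : BaseAlg K P) • algebraMap K (BaseAlg K P) k • (_ : N) =
          algebraMap K (BaseAlg K P) k • (BaseAlg.idem i : BaseAlg K P) • (_ : N)
        rw [← mul_smul, ← mul_smul, Algebra.commutes] }
  have h_def : ∀ y, h y = ∑ i : P, (BaseAlg.idem i : BaseAlg K P) • hX (r (unit K i i • y)) :=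
    fun _ => rfl
  have hfx : ∀ x, h (f x) = hX x := fun x => by
    rw [h_def, hX_def, ← one_smul (incidence K P) x, hsmul, ← sum_unit, leftEmb_sum,
      Coinduction.eval_sum]
    refine Finset.sum_congr rfl fun i _ => ?_
    rw [sum_unit, one_smul, ← map_smul f, hr', hX_def, hsmul, ← Coinduction.eval_mul, toLeft_idem,
      ← leftEmb_mul, unit_mul_self]
  have hidem : ∀ i j y, (BaseAlg.idem j : BaseAlg K P) • h (unit K i j • y) = h (unit K i j • y) :=
    fun i j y => by
      rw [h_def, Finset.sum_eq_single j, ← mul_smul, BaseAlg.idem_mul_idem]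
      · intro k _ hk
        rw [← mul_smul (unit K k k), unit_mul_unit_of_ne hk, zero_smul, map_zero, map_zero,
          smul_zero]
      · simp
  let G : Y → (ModuleCat.coextendScalars (posetBocs K P).toLeft).obj
      (ModuleCat.of (BaseAlg K P) N) := fun y => Coinduction.mk
    (fun x => ∑ i, ∑ j, x.hom (vElt K i j) • h (unit K i j • y))
    (fun x x' => by simp only [leftAlg_add_hom, add_smul, Finset.sum_add_distrib])
    (fun a x => by simp only [toLeft_mul_hom, mul_smul, Finset.smul_sum])
  have G_def : ∀ y x, Coinduction.eval (G y) x =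
    ∑ i, ∑ j, x.hom (vElt K i j) • h (unit K i j • y) := fun _ _ => rfl
  have hGemb : ∀ y (c : incidence K P), Coinduction.eval (G y) (leftEmb c) = h (c • y) :=
    fun y c => by
      conv_rhs => rw [incidence_eq_sum c]
      rw [G_def, Finset.sum_smul, map_sum]
      refine Finset.sum_congr rfl fun i _ => ?_
      rw [Finset.sum_smul, map_sum]
      refine Finset.sum_congr rfl fun j _ => ?_
      rw [leftEmb_hom_vElt, mul_smul, hidem, smul_assoc, h.map_smul]
      rfl
  have hGsmul : ∀ (b : incidence K P) y, leftEmb b • G y = G (b • y) := fun b y =>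
    Coinduction.ext fun x => by
      rw [Coinduction.eval_smul, ← one_mul b, leftEmb_mul, ← mul_assoc, mul_leftEmb_one,
        G_def ((1 * b) • y)]
      simp only [Finset.sum_mul, Coinduction.eval_sum, mul_assoc, Coinduction.eval_mul,
        ← leftEmb_mul, hGemb, one_mul, mul_smul]
  have hGadd : ∀ y y', G (y + y') = G y + G y' := fun y y' => Coinduction.ext fun x => by
    rw [Coinduction.add_eval, G_def, G_def, G_def]
    simp only [smul_add, map_add, Finset.sum_add_distrib]
  refine ⟨{ toFun := fun y => LeftRes.mk (e.symm (G y)) (by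
              rw [← map_smul, hGsmul, one_smul])
            map_add' := fun y y' => Subtype.ext (by
              change e.symm (G (y + y')) = e.symm (G y) + e.symm (G y')
              rw [hGadd, map_add])
            map_smul' := fun b y => Subtype.ext (by
              change e.symm (G (b • y)) = leftEmb b • e.symm (G y)
              rw [← map_smul, hGsmul]) }, fun x => Subtype.ext ?_⟩
  change e.symm (G (f x)) = (g x).1
  rw [LinearEquiv.symm_apply_eq]
  refine Coinduction.ext fun z => ?_
  rw [← LeftRes.one_smul_val (g x), map_smul, Coinduction.eval_smul, mul_leftEmb_one, G_def]
  simp only [Coinduction.eval_sum, Coinduction.eval_mul, ← map_smul f, hfx, hX_def, hsmul]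

/-- The element `(1 - e₀) m` of the restriction. -/
noncomputable def LeftRes.proj : M →+ LeftRes K P M where
  toFun m := LeftRes.mk (leftEmb (1 : incidence K P) • m) (by
    rw [← mul_smul, ← leftEmb_mul, one_mul])
  map_zero' := Subtype.ext (smul_zero _)
  map_add' m m' := Subtype.ext (smul_add _ m m')

theorem LeftRes.smul_proj_val (b : incidence K P) (m : M) :
    (b • LeftRes.proj (K := K) (P := P) m).1 = leftEmb b • m := by
  change leftEmb b • leftEmb (1 : incidence K P) • m = _
  rw [← mul_smul, ← leftEmb_mul, mul_one]

theorem LeftRes.proj_coe (m : LeftRes K P M) : LeftRes.proj (K := K) (P := P) m.1 = m :=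
  Subtype.ext (LeftRes.one_smul_val m)

theorem LeftRes.unit_smul_proj_toLeft_smul (i : P) (a : BaseAlg K P) (m : M) :
    unit K i i • LeftRes.proj (K := K) (P := P) ((posetBocs K P).toLeft a • m) =
      (a.e (some i) • unit K i i) • LeftRes.proj (K := K) (P := P) m := Subtype.ext (by
  rw [LeftRes.smul_proj_val, LeftRes.smul_proj_val, ← mul_smul, leftEmb_smul, ← toLeft_idem,
    ← map_mul, BaseAlg.idem_mul, map_mul]
  rfl)

theorem LeftRes.toLeft_e₀_smul_val (m : LeftRes K P M) :
    (posetBocs K P).toLeft BaseAlg.e₀ • m.1 = 0 := by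
  rw [← LeftRes.one_smul_val m, ← mul_smul, toLeft_e₀_mul_leftEmb, zero_smul]

theorem LeftRes.leftDual_smul_val {i j : P} (h : i < j) (m : LeftRes K P M) :
    leftDual (K := K) i j h • m.1 = 0 := by
  rw [← LeftRes.one_smul_val m, ← mul_smul, leftDual_mul_leftEmb_one, zero_smul]

theorem LeftRes.algebraMap_smul_val (k : K) (m : LeftRes K P M) :
    (algebraMap K (incidence K P) k • m).1 =
      (posetBocs K P).toLeft (algebraMap K _ k) • m.1 := by
  rw [LeftRes.smul_val, Algebra.algebraMap_eq_smul_one, leftEmb_smul, mul_smul,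
    LeftRes.one_smul_val]
  rfl

/-- If the `C_i ⊆ e_i M` cogenerate the injective `KP`-module `(1 - e₀) M`, then
`M ≅ Hom_A(L, M / D)` for the `A`-submodule `D` of `M` generated by the `C_i`. -/
theorem exists_coinduced_of_injective (hM : Module.Baer (incidence K P) (LeftRes K P M)) :
    letI : Module (BaseAlg K P) M := Module.compHom M (posetBocs K P).toLeft
    ∃ D : Submodule (BaseAlg K P) M,
      Nonempty (M ≃ₗ[(posetBocs K P).LeftAlg]
        (ModuleCat.coextendScalars (posetBocs K P).toLeft).obj
          (ModuleCat.of (BaseAlg K P) (M ⧸ D))) := by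
  let _ : Module (BaseAlg K P) M := Module.compHom M (posetBocs K P).toLeft
  let _ : Module K (LeftRes K P M) := Module.compHom _ (algebraMap K (incidence K P))
  have _ : IsScalarTower K (incidence K P) (LeftRes K P M) := isScalarTower_compHom K _ _
  have hA : ∀ (a : BaseAlg K P) (m : M), a • m = (posetBocs K P).toLeft a • m := fun _ _ => rfl
  have hK : ∀ (k : K) (m : LeftRes K P M),
      (k • m).1 = (posetBocs K P).toLeft (algebraMap K _ k) • m.1 :=
    LeftRes.algebraMap_smul_val
  obtain ⟨C, hCE, hinj, hsurj⟩ :=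
    exists_cogenerators_of_injective (K := K) (P := P) (M := LeftRes K P M) hM
  let D : Submodule (BaseAlg K P) M :=
    { carrier := {m | (∀ i, unit K i i • LeftRes.proj (K := K) (P := P) m ∈ C i) ∧
        ∃ d : P → LeftRes K P M, (∀ i, d i ∈ C i) ∧ (posetBocs K P).toLeft BaseAlg.e₀ • m =
          ∑ i, (posetBocs K P).toLeft (BaseAlg.arrow i) • (d i).1}
      add_mem' := by
        rintro m m' ⟨h, d, hd, hm⟩ ⟨h', d', hd', hm'⟩
        refine ⟨fun i => ?_, d + d', fun i => add_mem (hd i) (hd' i), ?_⟩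
        · rw [map_add, smul_add]; exact add_mem (h i) (h' i)
        · rw [smul_add, hm, hm', ← Finset.sum_add_distrib]
          exact Finset.sum_congr rfl fun i _ => (smul_add _ _ _).symm
      zero_mem' := by
        refine ⟨fun i => ?_, 0, fun i => zero_mem _, ?_⟩
        · rw [map_zero, smul_zero]; exact zero_mem _
        · rw [smul_zero]
          exact (Finset.sum_eq_zero fun i _ => smul_zero _).symm
      smul_mem' := by
        rintro a m ⟨h, d, hd, hm⟩
        refine ⟨fun i => ?_, fun i => a.e none • d i +
          a.α i • unit K i i • LeftRes.proj (K := K) (P := P) m, fun i => ?_, ?_⟩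
        · rw [hA, LeftRes.unit_smul_proj_toLeft_smul, smul_assoc]
          exact Submodule.smul_mem _ _ (h i)
        · exact add_mem (Submodule.smul_mem _ _ (hd i)) (Submodule.smul_mem _ _ (h i))
        · rw [hA, ← mul_smul, ← map_mul, BaseAlg.e₀_mul, map_add, map_mul, add_smul, mul_smul, hm,
            map_sum, Finset.sum_smul, Finset.smul_sum, ← Finset.sum_add_distrib]
          refine Finset.sum_congr rfl fun i _ => ?_
          rw [LeftRes.add_val, smul_add, hK, hK, LeftRes.smul_proj_val, ← toLeft_idem]
          simp only [← mul_smul, ← map_mul]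
          rw [Algebra.commutes, ← mul_assoc, ← mul_assoc, Algebra.commutes] }
  have mem_D : ∀ m, m ∈ D ↔ (∀ i, unit K i i • LeftRes.proj (K := K) (P := P) m ∈ C i) ∧
      ∃ d : P → LeftRes K P M, (∀ i, d i ∈ C i) ∧ (posetBocs K P).toLeft BaseAlg.e₀ • m =
        ∑ i, (posetBocs K P).toLeft (BaseAlg.arrow i) • (d i).1 := fun _ => Iff.rfl
  have hCD : ∀ j, ∀ r ∈ C j, r.1 ∈ D := fun j r hr => by
    refine (mem_D _).mpr ⟨fun i => ?_, 0, fun i => zero_mem _, ?_⟩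
    · rw [LeftRes.proj_coe]
      by_cases hi : i = j
      · subst hi
        rwa [mem_component.mp (hCE i hr)]
      · rw [unit_smul_of_ne hi (hCE j hr)]
        exact zero_mem _
    · rw [LeftRes.toLeft_e₀_smul_val]
      exact (Finset.sum_eq_zero fun i _ => smul_zero _).symm
  have hDC : ∀ j, ∀ r ∈ component K (LeftRes K P M) j, r.1 ∈ D → r ∈ C j := fun j r hr h => by
    have := ((mem_D _).mp h).1 j
    rwa [LeftRes.proj_coe, mem_component.mp hr] at this
  let Φ : M →ₗ[(posetBocs K P).LeftAlg] (ModuleCat.coextendScalars (posetBocs K P).toLeft).obj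
      (ModuleCat.of (BaseAlg K P) (M ⧸ D)) :=
    { toFun := fun m => Coinduction.mk (fun x => D.mkQ (x • m))
        (fun x y => by rw [add_smul, map_add])
        (fun a x => by rw [mul_smul, ← hA, map_smul])
      map_add' := fun m m' => Coinduction.ext fun x => by
        rw [Coinduction.add_eval, Coinduction.eval_mk, Coinduction.eval_mk, Coinduction.eval_mk,
          smul_add, map_add]
      map_smul' := fun y m => Coinduction.ext fun x => by
        rw [RingHom.id_apply, Coinduction.eval_smul, Coinduction.eval_mk, Coinduction.eval_mk,
          mul_smul] }
  have hΦ : ∀ m x, Coinduction.eval (Φ m) x = D.mkQ (x • m) := fun _ _ => rfl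
  -- `r_ij` detects the coefficients of the arrows.
  have hdual : ∀ (d : P → LeftRes K P M), (∀ i, d i ∈ C i) → ∀ {i j} (h : i < j),
      leftDual (K := K) i j h • ∑ l, (posetBocs K P).toLeft (BaseAlg.arrow l) • (d l).1 =
        (unit K i j • d i).1 - (d j).1 := fun d hd i j h => by
    rw [Finset.smul_sum]
    simp only [← mul_smul, leftDual_mul_arrow, sub_smul, ite_smul, zero_smul,
      Finset.sum_sub_distrib, Finset.sum_ite_eq', Finset.mem_univ, if_true]
    have hj : unit K j j • d j = d j := mem_component.mp (hCE j (hd j))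
    congr 1
    exact congrArg Subtype.val hj
  refine ⟨D, ⟨LinearEquiv.ofBijective Φ ⟨?_, fun g => ?_⟩⟩⟩
  · rw [injective_iff_map_eq_zero]
    intro m hm
    have hmem : ∀ x : (posetBocs K P).LeftAlg, x • m ∈ D := fun x => by
      rw [← Submodule.Quotient.mk_eq_zero]
      change D.mkQ (x • m) = 0
      rw [← hΦ, hm]
      rfl
    have hρ : LeftRes.proj (K := K) (P := P) m = 0 := hinj _ fun i j =>
      hDC j _ (unit_smul_mem_component _ _ _) (by rw [LeftRes.smul_proj_val]; exact hmem _)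
    have hm0 : (posetBocs K P).toLeft BaseAlg.e₀ • m = m := by
      have h : leftEmb (1 : incidence K P) • m = 0 := congrArg Subtype.val hρ
      rw [leftEmb_one, sub_smul, one_smul, sub_eq_zero] at h
      exact h.symm
    have h1 := hmem 1
    rw [one_smul] at h1
    obtain ⟨-, d, hd, hmd⟩ := (mem_D m).mp h1
    rw [hm0] at hmd
    have hd0 : ∀ i, d i = 0 := fun i => hinj _ fun k j => by
      by_cases hk : k = i
      · subst hk
        by_cases hkj : k ≤ j
        · rcases hkj.lt_or_eq with h | rfl
          · have h2 := hmem (leftDual k j h)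
            rw [hmd, hdual d hd h] at h2
            refine hDC j _ (unit_smul_mem_component _ _ _) ?_
            have h3 := add_mem h2 (hCD j _ (hd j))
            rwa [sub_add_cancel] at h3
          · rw [mem_component.mp (hCE k (hd k))]
            exact hd k
        · rw [unit_eq_zero hkj, zero_smul]
          exact zero_mem _
      · rw [unit_smul_of_ne hk (hCE i (hd i))]
        exact zero_mem _
    rw [hmd]
    refine Finset.sum_eq_zero fun i _ => ?_
    rw [hd0 i]
    exact smul_zero _
  · -- Every element of `e_j (M / D)` is represented by an element of `e_j M`.
    have hrep : ∀ (j : P) (q : M ⧸ D), (BaseAlg.idem j : BaseAlg K P) • q = q →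
        ∃ r ∈ component K (LeftRes K P M) j, D.mkQ r.1 = q := fun j q hq => by
      obtain ⟨m, rfl⟩ := D.mkQ_surjective q
      refine ⟨unit K j j • LeftRes.proj (K := K) (P := P) m, unit_smul_mem_component _ _ _, ?_⟩
      rw [LeftRes.smul_proj_val, ← toLeft_idem, ← hA, map_smul, hq]
    have hC0 : ∀ j, ∀ r ∈ C j, D.mkQ r.1 = 0 := fun j r hr =>
      (Submodule.Quotient.mk_eq_zero D).mpr (hCD j r hr)
    -- The component of a preimage in `(1 - e₀) M` is determined by the values at the `p_ij`.
    choose n hn hng using fun i j => hrep j (Coinduction.eval g (leftEmb (unit K i j))) (by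
      rw [← Coinduction.eval_mul, toLeft_idem, ← leftEmb_mul, unit_mul_self])
    obtain ⟨m₁, hm₁⟩ := hsurj n hn
    have hm₁' : ∀ i j, D.mkQ (leftEmb (unit K i j) • m₁.1) =
        Coinduction.eval g (leftEmb (unit K i j)) := fun i j => by
      by_cases hij : i ≤ j
      · rw [← hng, ← sub_eq_zero, ← map_sub]
        exact hC0 j _ (hm₁ i j hij)
      · rw [unit_eq_zero hij, leftEmb_zero, zero_smul, map_zero,
          ← sub_self (0 : (posetBocs K P).LeftAlg), Coinduction.eval_sub, sub_self]
    -- The component in `e₀ M` is a representative of `g(e₀)`, corrected by arrows so as to have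
    -- the prescribed values at the `r_ij`.
    obtain ⟨q, hq⟩ := D.mkQ_surjective (Coinduction.eval g ((posetBocs K P).toLeft BaseAlg.e₀))
    let m₂ : M := (posetBocs K P).toLeft BaseAlg.e₀ • q
    have hm₂ : (posetBocs K P).toLeft BaseAlg.e₀ • m₂ = m₂ := by
      rw [← mul_smul, ← map_mul, BaseAlg.e₀_mul_e₀]
    have hm₂' : D.mkQ m₂ = Coinduction.eval g ((posetBocs K P).toLeft BaseAlg.e₀) := by
      change D.mkQ ((BaseAlg.e₀ : BaseAlg K P) • q) = _
      rw [map_smul, hq, ← Coinduction.eval_mul, ← map_mul, BaseAlg.e₀_mul_e₀]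
    have hn' : ∀ i j, ∃ r ∈ component K (LeftRes K P M) j, (i = j → r = 0) ∧ ∀ h : i < j,
        D.mkQ r.1 = Coinduction.eval g (leftDual i j h) - D.mkQ (leftDual (K := K) i j h • m₂) := by
      intro i j
      by_cases h : i < j
      · obtain ⟨r, hr, hr'⟩ := hrep j
          (Coinduction.eval g (leftDual i j h) - D.mkQ (leftDual (K := K) i j h • m₂)) (by
            rw [smul_sub, ← map_smul, hA, ← mul_smul, ← Coinduction.eval_mul,
              toLeft_idem_mul_leftDual])
        exact ⟨r, hr, fun hij => absurd hij h.ne, fun _ => hr'⟩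
      · exact ⟨0, zero_mem _, fun _ => rfl, fun h' => absurd h' h⟩
    choose n' hn'E hn'0 hn'g using hn'
    obtain ⟨m₃, hm₃⟩ := hsurj n' hn'E
    let c : P → LeftRes K P M := fun i => unit K i i • m₃
    have hc : ∀ i, c i ∈ C i := fun i => by
      have := hm₃ i i le_rfl
      rwa [hn'0 i i rfl, sub_zero] at this
    let m₄ : M := m₂ + ∑ l, (posetBocs K P).toLeft (BaseAlg.arrow l) • (c l).1
    have hm₄ : (posetBocs K P).toLeft BaseAlg.e₀ • m₄ = m₄ := by
      rw [smul_add, hm₂, Finset.smul_sum]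
      simp only [← mul_smul, ← map_mul, BaseAlg.e₀_mul_arrow]
      rfl
    have hm₄' : D.mkQ m₄ = Coinduction.eval g ((posetBocs K P).toLeft BaseAlg.e₀) := by
      rw [map_add, hm₂', map_sum, Finset.sum_eq_zero, add_zero]
      intro l _
      rw [← hA, map_smul, hC0 l _ (hc l), smul_zero]
    refine ⟨m₁.1 + m₄, Coinduction.ext fun x => ?_⟩
    rw [hΦ]
    have hp : ∀ i j, D.mkQ (leftEmb (unit K i j) • (m₁.1 + m₄)) =
        Coinduction.eval g (leftEmb (unit K i j)) := fun i j => by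
      rw [smul_add, ← hm₄, ← mul_smul, leftEmb_mul_toLeft_e₀, zero_smul, add_zero, hm₁']
    have hr : ∀ i j (h : i < j), D.mkQ (leftDual (K := K) i j h • (m₁.1 + m₄)) =
        Coinduction.eval g (leftDual i j h) := fun i j h => by
      have h1 : D.mkQ (unit K i j • c i).1 = D.mkQ (n' i j).1 := by
        rw [← sub_eq_zero, ← map_sub]
        change D.mkQ (unit K i j • unit K i i • m₃ - n' i j).1 = 0
        rw [← mul_smul, mul_unit_self]
        exact hC0 j _ (hm₃ i j h.le)
      rw [smul_add, LeftRes.leftDual_smul_val, zero_add, smul_add, hdual c hc h, map_add, map_sub,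
        hC0 j _ (hc j), sub_zero, h1, hn'g i j h, add_sub_cancel]
    have he : (BaseAlg.e₀ : BaseAlg K P) • (D.mkQ m₁.1 + D.mkQ m₄) =
        Coinduction.eval g ((posetBocs K P).toLeft BaseAlg.e₀) := by
      rw [← map_add, ← map_smul, hA, smul_add, LeftRes.toLeft_e₀_smul_val, zero_add, hm₄, hm₄']
    conv_lhs => rw [leftAlg_eq_sum x]
    conv_rhs => rw [leftAlg_eq_sum x]
    simp only [Coinduction.eval_add, Coinduction.eval_sum, Coinduction.eval_mul, add_smul,
      Finset.sum_smul, mul_smul, ← hA, map_add, map_sum, map_smul]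
    simp only [hp, hr, he]

end LeftModules

end PosetBocs

theorem theorem3p9 {K : Type u} [Field K] {P : Type v} [Fintype P] [DecidableEq P] [PartialOrder P] :
    (Nonempty (PosetBocs.incidence K P ≃ₐ[K] (PosetBocs.rightIdem K P).Corner) ∧
      ∀ (θ : PosetBocs.incidence K P ≃ₐ[K] (PosetBocs.rightIdem K P).Corner)
        (M : Type (max u v w)) [AddCommGroup M] [Module (PosetBocs.posetBocs K P).RightAlg M],
        (PosetBocs.IsInduced (PosetBocs.posetBocs K P).toRight M ↔
          Module.Projective (PosetBocs.incidence K P)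
            (PosetBocs.Res θ.toRingEquiv.toRingHom M)) ∧
        (PosetBocs.IsFinDim K (PosetBocs.posetBocs K P).RightAlg M →
          (PosetBocs.IsFinInduced K (PosetBocs.posetBocs K P).toRight M ↔
            Module.Projective (PosetBocs.incidence K P)
              (PosetBocs.Res θ.toRingEquiv.toRingHom M)))) ∧
    (Nonempty (PosetBocs.incidence K P ≃ₐ[K] (PosetBocs.leftIdem K P).Corner) ∧
      ∀ (θ : PosetBocs.incidence K P ≃ₐ[K] (PosetBocs.leftIdem K P).Corner)
        (M : Type (max u v w)) [AddCommGroup M] [Module (PosetBocs.posetBocs K P).LeftAlg M],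
        (PosetBocs.IsCoinduced (PosetBocs.posetBocs K P).toLeft M ↔
          Module.Injective (PosetBocs.incidence K P)
            (PosetBocs.Res θ.toRingEquiv.toRingHom M)) ∧
        (PosetBocs.IsFinDim K (PosetBocs.posetBocs K P).LeftAlg M →
          (PosetBocs.IsFinCoinduced K (PosetBocs.posetBocs K P).toLeft M ↔
            Module.Injective (PosetBocs.incidence K P)
              (PosetBocs.Res θ.toRingEquiv.toRingHom M)))) := by
  open PosetBocs in
  refine ⟨⟨⟨rightEquiv K P⟩, fun θ M _ _ => ?_⟩, ⟨leftEquiv K P⟩, fun θ M _ _ => ?_⟩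
  · have hθ : Module.Projective (incidence K P) (Res θ.toRingEquiv.toRingHom M) ↔
        Module.Projective (incidence K P) (RightRes K P M) :=
      ⟨Res.projective_of_projective θ.toRingEquiv (rightEquiv K P).toRingEquiv M,
        Res.projective_of_projective (rightEquiv K P).toRingEquiv θ.toRingEquiv M⟩
    have hproj : IsInduced (posetBocs K P).toRight M →
        Module.Projective (incidence K P) (RightRes K P M) := by
      rintro ⟨N, _, _, ⟨e⟩⟩
      exact projective_of_induced e
    rw [hθ]
    refine ⟨⟨hproj, fun h => ?_⟩, fun hM => ⟨?_, fun h => ?_⟩⟩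
    · obtain ⟨N, ⟨e⟩⟩ := exists_induced_of_projective (K := K) (P := P) (M := M)
      exact ⟨N, _, _, ⟨e⟩⟩
    · rintro ⟨N, _, _, -, e⟩
      exact hproj ⟨N, _, _, e⟩
    · obtain ⟨N, ⟨e⟩⟩ := exists_induced_of_projective (K := K) (P := P) (M := M)
      exact ⟨N, _, _, hM.of_injective N.toAddSubgroup.subtype Subtype.val_injective
        fun _ _ => rfl, ⟨e⟩⟩
  · have hθ : Module.Injective (incidence K P) (Res θ.toRingEquiv.toRingHom M) ↔
        Module.Injective (incidence K P) (LeftRes K P M) :=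
      ⟨Res.injective_of_injective θ.toRingEquiv (leftEquiv K P).toRingEquiv M,
        Res.injective_of_injective (leftEquiv K P).toRingEquiv θ.toRingEquiv M⟩
    have hinj : IsCoinduced (posetBocs K P).toLeft M →
        Module.Injective (incidence K P) (LeftRes K P M) := by
      rintro ⟨N, _, _, ⟨e⟩⟩
      exact injective_of_coinduced e
    rw [hθ]
    refine ⟨⟨hinj, fun h => ?_⟩, fun hM => ⟨?_, fun h => ?_⟩⟩
    · let _ : Module (BaseAlg K P) M := Module.compHom M (posetBocs K P).toLeft
      obtain ⟨D, ⟨e⟩⟩ := exists_coinduced_of_injective (K := K) (P := P) (M := M)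
        (Module.Baer.of_injective h)
      exact ⟨_, _, _, ⟨e⟩⟩
    · rintro ⟨N, _, _, -, e⟩
      exact hinj ⟨N, _, _, e⟩
    · let _ : Module (BaseAlg K P) M := Module.compHom M (posetBocs K P).toLeft
      obtain ⟨D, ⟨e⟩⟩ := exists_coinduced_of_injective (K := K) (P := P) (M := M)
        (Module.Baer.of_injective h)
      exact ⟨M ⧸ D, _, _, hM.of_surjective D.mkQ.toAddMonoidHom D.mkQ_surjective
        fun _ _ => rfl, ⟨e⟩⟩
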